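/- Let $Y$ be a locally compact metrizable space and let $\alpha=(\alpha_t)_{t\in\mathbb R}$ be a continuous flow on $Y$ without fixed points. A line foliation chart is a homeomorphism $\varphi$ of an open set $U\subseteq Y$ onto $\mathbb R\times T$ with $T$ locally compact metrizable; the sets $\varphi^{-1}(\mathbb R\times\{x\})$ are its plaques; two charts are coherent if any intersection of a plaque of one with a plaque of the other is open in both plaques. A line foliation is a maximal family of pairwise coherent charts covering $Y$. The charts given by the tubes of $\alpha$ (interiors of $\alpha_{[-l/2,l/2]}(S)$ with $l>0$, $S$ compact and $S\times[-l/2,l/2]\to Y$, $(z,t)\mapsto\alpha_t(z)$, an embedding; the plaques are the orbit pieces $\alpha_{(-l/2,l/2)}(z)$, $z \in S$, inside the interior) are contained in exactly one line foliation $\mathcal F$, which consists of all charts coherent with them. The holonomy groupoid $G_{\mathcal F}$ is the set of holonomy classes of paths $\gamma$ along the leaves (two such paths are equivalent if they have the same end points and the same holonomy germ between transversals at these end points), with range $\gamma(0)$, domain $\gamma(1)$, concatenation as product and reversal as inverse. A subbase of its topology consists of the sets of classes of all leafwise paths $\gamma'$ with $\gamma'([t_{i-1},t_i])\subseteq U_i$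 for $1\le i\le n$, for charts $U_1,\dots,U_n$ of $\mathcal F$ and $0=t_0<\dots<t_n=1$. The transformation groupoid $Y\rtimes\mathbb R$ is $Y\times\mathbb R$ with $r(y,t)=(y,0)$, $d(y,t)=(\alpha_{-t}(y),0)$, $(y,s)(\alpha_{-s}(y),t)=(y,s+t)$, and $\mu$ denotes the family of measures on its range fibers given by Lebesgue measure on $\mathbb R$. For a possibly non-Hausdorff space $X$, $C_c(X)$ is the linear span of the functions that vanish outside some Hausdorff open set, on which they are continuous and compactly supported. A left Haar system on a topological groupoid $G$ is a family of regular Borel measures $\lambda^u$ of full support on the fibers $G^u=r^{-1}(u)$, $u\in G^0$, such that $u\mapsto\int f\,d\lambda^u$ lies in $C_c(G^0)$ and $\int f(xz)\,d\lambda^{d(x)}(z)=\int f(y)\,d\lambda^{r(x)}(y)$ for all $f\in C_c(G)$, $x\in G$. $C^*(G,\lambda)$ is the maximal groupoid $C^*$-algebra, i.e. the completion of the convolution $*$-algebra $C_c(G)$ in the supremum of the seminorms of its $I$-norm bounded $*$-representations on Hilbert spaces. Then $\mu$ is a left Haar system on $Y\rtimes\mathbb R$, and $G_{\mathcal F}$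 is a topological groupoid whose unit space and range fibers are locally compact Hausdorff and whose topology has a basis of interiors of compact Hausdorff sets (a countable family of such sets suffices if $Y$ is second countable). The map $\pi\colon Y\rtimes\mathbb R\to G_{\mathcal F}$ sending $(y,t)$ to the holonomy class of $s\mapsto\alpha_{-ts}(y)$, $s\in[0,1]$, is well defined and is a fiberwise groupoid covering map, that is, a surjective groupoid homomorphism which is a local homeomorphism and restricts to a homeomorphism of the unit spaces. There is a left Haar system $\lambda$ on $G_{\mathcal F}$ such that $\pi$ intertwines $\mu$ and $\lambda$: for every unit $u$ and every open $W\subseteq Y\rtimes\mathbb R$ on which $\pi$ is a homeomorphism onto its image, $\pi$ pushes $\mu^u|_{W\cap r^{-1}(u)}$ forward to $\lambda^{\pi(u)}|_{\pi(W)\cap r^{-1}(\pi(u))}$. For every such $\lambda$ there is a surjective $*$-homomorphism $C_0(Y)\rtimes_\alpha\mathbb R\to C^*(G_{\mathcal F},\lambda)$, so $C^*(G_{\mathcal F},\lambda)$ is a quotient of $C_0(Y)\rtimes_\alpha\mathbb R$. -/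

import Mathlib

universe u

noncomputable section

open Set Filter Topology MeasureTheory

/-! ### Line foliations -/

/-- A line foliation chart `(U, T, φ)`: `U ⊆ Y` is open, `T` is a locally compact metrizable space
and `φ` is a homeomorphism of `U` onto `ℝ × T`. Here `U` is the source of `φ`. -/
structure FoliationChart (Y : Type u) [TopologicalSpace Y] where
  T : Type u
  [topT : TopologicalSpace T]
  [lcT : LocallyCompactSpace T]
  [metT : TopologicalSpace.MetrizableSpace T]
  φ : OpenPartialHomeomorph Y (ℝ × T)
  target_eq : φ.target = univ

attribute [instance] FoliationChart.topT FoliationChart.lcT FoliationChart.metT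

namespace FoliationChart

variable {Y : Type u} [TopologicalSpace Y]

/-- The domain `U` of the chart `(U, T, φ)`. -/
def dom (c : FoliationChart Y) : Set Y := c.φ.source

/-- The plaque over `x`, that is, the preimage of `ℝ × {x}` under `φ`. -/
def plaque (c : FoliationChart Y) (x : c.T) : Set Y := {y | y ∈ c.dom ∧ (c.φ y).2 = x}

/-- Two charts are coherent if the intersection of any plaque `P` of the first with any plaque `P'`
of the second is open in `P` and in `P'`. -/
def Coherent (c d : FoliationChart Y) : Prop :=
  ∀ (x : c.T) (x' : d.T),
    IsOpen {p : c.plaque x | (p : Y) ∈ d.plaque x'} ∧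
    IsOpen {p : d.plaque x' | (p : Y) ∈ c.plaque x}

/-- The canonical identification of the transversals `c.T` and `d.T` at `y ∈ c.dom ∩ d.dom`: the point
of `c.T` labelling a plaque of `c` near `y` is sent to the point of `d.T` labelling the plaque of `d`
that it meets near `y`. Only the germ of this function at the base point `c.base y` matters, and that
germ is the germ of a homeomorphism. -/
def trans (c d : FoliationChart Y) (y : Y) : c.T → d.T :=
  fun x => (d.φ (c.φ.symm ((c.φ y).1, x))).2

/-- The base point, given by `y`, of the transversal `c.T`. -/
def base (c : FoliationChart Y) (y : Y) : c.T := (c.φ y).2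

lemma trans_self (c : FoliationChart Y) (y : Y) : c.trans c y = id := by
  funext x
  have : ((c.φ y).1, x) ∈ c.φ.target := by rw [c.target_eq]; trivial
  simp [trans, c.φ.right_inv this]

lemma symm_mem (c : FoliationChart Y) (p : ℝ × c.T) : c.φ.symm p ∈ c.dom :=
  c.φ.map_target (by rw [c.target_eq]; trivial)

lemma φ_symm (c : FoliationChart Y) (p : ℝ × c.T) : c.φ (c.φ.symm p) = p :=
  c.φ.right_inv (by rw [c.target_eq]; trivial)

lemma continuous_symm (c : FoliationChart Y) : Continuous c.φ.symm := by
  rw [← continuousOn_univ, ← c.target_eq]; exact c.φ.continuousOn_symm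

lemma trans_base (c d : FoliationChart Y) {y : Y} (hc : y ∈ c.dom) :
    c.trans d y (c.base y) = d.base y := by
  simp only [trans, base, Prod.mk.eta]
  rw [c.φ.left_inv hc]

lemma tendsto_trans (c d : FoliationChart Y) {y : Y} (hc : y ∈ c.dom) (hd : y ∈ d.dom) :
    Tendsto (c.trans d y) (𝓝 (c.base y)) (𝓝 (d.base y)) := by
  rw [← trans_base c d hc]
  have h : c.φ.symm ((c.φ y).1, c.base y) = y := by
    simp only [base, Prod.mk.eta]; exact c.φ.left_inv hc
  have h1 : ContinuousAt d.φ (c.φ.symm ((c.φ y).1, c.base y)) := by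
    rw [h]; exact d.φ.continuousAt hd
  have h2 : ContinuousAt (fun x : c.T => c.φ.symm ((c.φ y).1, x)) (c.base y) :=
    (c.continuous_symm.comp (by fun_prop)).continuousAt
  exact (continuous_snd.continuousAt.comp (ContinuousAt.comp (x := c.base y) h1 h2))

/-- Near `y`, the transverse coordinate of `d` does not vary along the plaques of `c`. -/
lemma Coherent.locally_const {c d : FoliationChart Y} (h : c.Coherent d) {y : Y}
    (hc : y ∈ c.dom) (hd : y ∈ d.dom) :
    ∀ᶠ p : ℝ × c.T in 𝓝 (c.φ y), c.trans d y p.2 = (d.φ (c.φ.symm p)).2 := by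
  have hy : c.φ.symm (c.φ y) = y := c.φ.left_inv hc
  have ho : c.φ.symm ⁻¹' d.dom ∈ 𝓝 (c.φ y) := by
    apply c.continuous_symm.continuousAt
    rw [hy]; exact d.φ.open_source.mem_nhds hd
  rw [show c.φ y = ((c.φ y).1, (c.φ y).2) from rfl, nhds_prod_eq] at ho
  obtain ⟨A, hA, W, hW, hAW⟩ := Filter.mem_prod_iff.1 ho
  obtain ⟨ε, hε, hA'⟩ := Metric.mem_nhds_iff.1 hA
  rw [show c.φ y = ((c.φ y).1, (c.φ y).2) from rfl, nhds_prod_eq]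
  filter_upwards [prod_mem_prod (Metric.ball_mem_nhds _ hε) hW]
  rintro ⟨s, x⟩ ⟨hs, hx⟩
  simp only at hs hx
  let B := Metric.ball (c.φ y).1 ε
  let f : B → d.T := fun s => (d.φ (c.φ.symm (s.1, x))).2
  have hBd : ∀ s : B, c.φ.symm (s.1, x) ∈ d.dom := fun s => hAW ⟨hA' s.2, hx⟩
  have hf : IsLocallyConstant f := by
    rw [IsLocallyConstant.iff_eventually_eq]
    intro s₁
    have hp : ∀ s : B, c.φ.symm (s.1, x) ∈ c.plaque x :=
      fun s => ⟨c.symm_mem _, by rw [c.φ_symm]⟩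
    have hcont : Continuous (fun s : B => (⟨_, hp s⟩ : c.plaque x)) :=
      Continuous.subtype_mk (c.continuous_symm.comp (by fun_prop)) _
    have := (h x (f s₁)).1.preimage hcont
    filter_upwards [this.mem_nhds (show _ ∈ d.plaque (f s₁) from ⟨hBd s₁, rfl⟩)] with s hs
    exact hs.2
  have : PreconnectedSpace B :=
    isPreconnected_iff_preconnectedSpace.1 (convex_ball _ _).isPreconnected
  exact hf.apply_eq_of_preconnectedSpace ⟨_, Metric.mem_ball_self hε⟩ ⟨s, hs⟩

lemma trans_trans {c d e : FoliationChart Y} (h : d.Coherent e) {y : Y}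
    (hc : y ∈ c.dom) (hd : y ∈ d.dom) (he : y ∈ e.dom) :
    d.trans e y ∘ c.trans d y =ᶠ[𝓝 (c.base y)] c.trans e y := by
  have hy : c.φ.symm ((c.φ y).1, c.base y) = y := c.φ.left_inv hc
  have h1 : Tendsto (fun x : c.T => c.φ.symm ((c.φ y).1, x)) (𝓝 (c.base y)) (𝓝 y) := by
    have := ((c.continuous_symm.comp
      (Continuous.prodMk_right (c.φ y).1)).continuousAt (x := c.base y)).tendsto
    simpa [hy, Function.comp_def] using this
  have h2 := (d.φ.continuousAt hd).tendsto.comp h1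
  filter_upwards [h2.eventually (h.locally_const hd he),
    h1.eventually (d.φ.open_source.mem_nhds hd)] with x hx hx'
  simp only [Function.comp_apply] at hx ⊢
  rw [d.φ.left_inv hx'] at hx
  exact hx

/-- The germ of `trans` does not change while one moves inside a plaque of `c` and one of `d`. -/
lemma Coherent.trans_eq_of_path {c d : FoliationChart Y} (h : c.Coherent d) {g : ℝ → Y}
    (hg : Continuous g) {s t : ℝ} (hst : s ≤ t) {x : c.T}
    (hgc : ∀ r ∈ Icc s t, g r ∈ c.plaque x) (hgd : ∀ r ∈ Icc s t, g r ∈ d.dom) :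
    c.trans d (g s) =ᶠ[𝓝 x] c.trans d (g t) := by
  let f : Icc s t → Germ (𝓝 x) d.T := fun r => (c.trans d (g r) : Germ (𝓝 x) d.T)
  have hf : IsLocallyConstant f := by
    rw [IsLocallyConstant.iff_eventually_eq]
    intro r
    have hcr := (hgc r r.2).1
    have hx : (c.φ (g r)).2 = x := (hgc r r.2).2
    have := h.locally_const hcr (hgd r r.2)
    rw [show c.φ (g r) = ((c.φ (g r)).1, (c.φ (g r)).2) from rfl, nhds_prod_eq, hx] at this
    have h2 := this.curry
    have h3 : Tendsto (fun r : Icc s t => (c.φ (g r)).1) (𝓝 r) (𝓝 (c.φ (g r)).1) :=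
      (continuous_fst.continuousAt.comp (ContinuousAt.comp (f := fun r : Icc s t => g r)
        (c.φ.continuousAt hcr) (by fun_prop))).tendsto
    filter_upwards [h3.eventually h2] with r' hr'
    refine Germ.coe_eq.2 ?_
    filter_upwards [hr'] with z hz
    exact hz.symm
  have : PreconnectedSpace (Icc s t) :=
    isPreconnected_iff_preconnectedSpace.1 isPreconnected_Icc
  exact Germ.coe_eq.1
    (hf.apply_eq_of_preconnectedSpace ⟨s, left_mem_Icc.2 hst⟩ ⟨t, right_mem_Icc.2 hst⟩)

end FoliationChart

/-- A line foliation: a maximal collection of pairwise coherent charts that cover `Y`. (Two foliated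
atlases give the same foliation iff their union is a foliated atlas, so that a foliation is the same
thing as a maximal atlas.) -/
structure LineFoliation (Y : Type u) [TopologicalSpace Y] where
  charts : Set (FoliationChart Y)
  cover : ∀ y, ∃ c ∈ charts, y ∈ c.dom
  coherent : ∀ c ∈ charts, ∀ d ∈ charts, c.Coherent d
  maximal : ∀ c, (∀ d ∈ charts, c.Coherent d) → c ∈ charts

namespace LineFoliation

variable {Y : Type u} [TopologicalSpace Y] (F : LineFoliation Y)

/-- `F.HolChain g a c b d H` says that `H : c.T → d.T` is obtained from a finite chain of charts
along the path `g` on the parameter interval `[a, b]`, starting with the transversal `c.T` at `g a` and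
ending with the transversal `d.T` at `g b`: the parameter interval is divided into finitely many pieces,
`g` runs inside a single plaque of one chart on each piece, and `H` is the composition of the canonical
identifications between the transversals of consecutive charts. -/
inductive HolChain (g : ℝ → Y) (a : ℝ) (c : FoliationChart Y) :
    ℝ → (d : FoliationChart Y) → (c.T → d.T) → Prop
  | start (hc : c ∈ F.charts) (ha : g a ∈ c.dom) : HolChain g a c a c id
  | step {s t : ℝ} {d e : FoliationChart Y} {H : c.T → d.T}
      (h : HolChain g a c s d H) (hst : s ≤ t)
      (hd : ∃ x, ∀ r ∈ Icc s t, g r ∈ d.plaque x)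
      (he : e ∈ F.charts) (ht : g t ∈ e.dom) :
      HolChain g a c t e (d.trans e (g t) ∘ H)

namespace HolChain

variable {F} {g g' : ℝ → Y} {a b : ℝ} {c d e f : FoliationChart Y}

lemma le {H : c.T → d.T} (h : F.HolChain g a c b d H) : a ≤ b := by
  induction h with
  | start => exact le_rfl
  | step _ hst _ _ _ ih => exact ih.trans hst

lemma mem {H : c.T → d.T} (h : F.HolChain g a c b d H) : d ∈ F.charts ∧ g b ∈ d.dom := by
  cases h with
  | start hc ha => exact ⟨hc, ha⟩
  | step _ _ _ he ht => exact ⟨he, ht⟩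

lemma mem_left {H : c.T → d.T} (h : F.HolChain g a c b d H) : c ∈ F.charts ∧ g a ∈ c.dom := by
  induction h with
  | start hc ha => exact ⟨hc, ha⟩
  | step _ _ _ _ _ ih => exact ih

lemma base_eq {s t : ℝ} (hst : s ≤ t) (hd : ∃ x, ∀ r ∈ Icc s t, g r ∈ d.plaque x) :
    d.base (g s) = d.base (g t) ∧ g t ∈ d.dom ∧ g s ∈ d.dom := by
  obtain ⟨x, hx⟩ := hd
  have h1 := hx s (left_mem_Icc.2 hst)
  have h2 := hx t (right_mem_Icc.2 hst)
  exact ⟨h1.2.trans h2.2.symm, h2.1, h1.1⟩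

lemma tendsto {H : c.T → d.T} (h : F.HolChain g a c b d H) :
    Tendsto H (𝓝 (c.base (g a))) (𝓝 (d.base (g b))) := by
  induction h with
  | start => exact tendsto_id
  | step h hst hd he ht ih =>
    obtain ⟨h1, h2, -⟩ := base_eq hst hd
    rw [h1] at ih
    exact (FoliationChart.tendsto_trans _ _ h2 ht).comp ih

lemma comp {H : c.T → d.T} (h : F.HolChain g a c b d H) {t : ℝ} {K : d.T → e.T}
    (k : F.HolChain g b d t e K) : F.HolChain g a c t e (K ∘ H) := by
  induction k with
  | start => exact h
  | step _ hst hd he ht ih => exact ih.step hst hd he ht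

/-- A chain along one piece of a plaque induces the transition map. -/
lemma eq_of_plaque (hg : Continuous g) {s b : ℝ} (hd : d ∈ F.charts) {x : d.T}
    (hx : ∀ r ∈ Icc s b, g r ∈ d.plaque x) {t : ℝ} {K : f.T → e.T}
    (k : F.HolChain g s f t e K) (htb : t ≤ b) :
    K =ᶠ[𝓝 (f.base (g s))] d.trans e (g t) ∘ f.trans d (g s) := by
  have hsb : s ≤ b := k.le.trans htb
  have hsd := (hx s (left_mem_Icc.2 hsb)).1
  obtain ⟨hfF, hfs⟩ := k.mem_left
  have hT := FoliationChart.tendsto_trans f d hfs hsd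
  have hbase : d.base (g s) = x := (hx s (left_mem_Icc.2 hsb)).2
  rw [hbase] at hT
  induction k with
  | start =>
    have := FoliationChart.trans_trans (F.coherent d hd f hfF) hfs hsd hfs
    rw [FoliationChart.trans_self] at this
    exact this.symm
  | @step t t' e e' K k htt he he' ht' ih =>
    have ih := ih (htt.trans htb)
    obtain ⟨x', hx'⟩ := he
    have ht'm : t' ∈ Icc s b := ⟨k.le.trans htt, htb⟩
    have h1 : d.trans e (g t) =ᶠ[𝓝 x] d.trans e (g t') :=
      (F.coherent d hd e k.mem.1).trans_eq_of_path hg htt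
        (fun r hr => hx r ⟨k.le.trans hr.1, hr.2.trans htb⟩) (fun r hr => (hx' r hr).1)
    have h2 := FoliationChart.trans_trans (F.coherent e k.mem.1 e' he') (hx t' ht'm).1
      (hx' t' (right_mem_Icc.2 htt)).1 ht'
    rw [show d.base (g t') = x from (hx t' ht'm).2] at h2
    filter_upwards [ih, hT.eventually h1, hT.eventually h2] with z hz1 hz2 hz3
    simp only [Function.comp_apply] at *
    rw [hz1, hz2, hz3]

/-- A chain can be cut at any intermediate time. -/
lemma cut {t : ℝ} {K : c.T → e.T} (k : F.HolChain g a c t e K) {s : ℝ} (has : a ≤ s)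
    (hst : s ≤ t) : ∃ (f : FoliationChart Y) (L : c.T → f.T) (M : f.T → e.T),
      F.HolChain g a c s f L ∧ F.HolChain g s f t e M ∧ K = M ∘ L := by
  induction k with
  | start hc ha =>
    obtain rfl := le_antisymm hst has
    exact ⟨c, id, id, .start hc ha, .start hc ha, rfl⟩
  | @step t₀ t' d e' K k htt hd he' ht' ih =>
    by_cases hs : s ≤ t₀
    · obtain ⟨f, L, M, h1, h2, h3⟩ := ih hs
      exact ⟨f, L, _, h1, h2.step htt hd he' ht', by rw [h3]; rfl⟩
    · push Not at hs
      obtain ⟨x, hx⟩ := hd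
      have hsd : g s ∈ d.dom := (hx s ⟨hs.le, hst⟩).1
      have h1 := k.step hs.le ⟨x, fun r hr => hx r ⟨hr.1, hr.2.trans hst⟩⟩ k.mem.1 hsd
      rw [FoliationChart.trans_self] at h1
      exact ⟨d, K, _, h1, (HolChain.start k.mem.1 hsd).step hst
        ⟨x, fun r hr => hx r ⟨hs.le.trans hr.1, hr.2⟩⟩ he' ht', rfl⟩

lemma trans_comp_eq (hg : Continuous g) {t : ℝ} {H : c.T → d.T} {K : c.T → e.T}
    (h : F.HolChain g a c t d H) (k : F.HolChain g a c t e K) :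
    K =ᶠ[𝓝 (c.base (g a))] d.trans e (g t) ∘ H := by
  induction h generalizing e with
  | start hc ha =>
    have := eq_of_plaque hg hc (x := c.base (g a)) (b := a)
      (fun r hr => by
        obtain rfl : r = a := le_antisymm hr.2 hr.1
        exact ⟨ha, rfl⟩) k le_rfl
    rwa [FoliationChart.trans_self] at this
  | @step t₀ t' d d' H h htt hd hd' ht' ih =>
    obtain ⟨f, L, M, h1, h2, rfl⟩ := k.cut h.le htt
    have i1 := ih h1
    obtain ⟨hb, hdt, hdt0⟩ := base_eq htt hd
    obtain ⟨x, hx⟩ := hd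
    have i2 := eq_of_plaque hg h.mem.1 hx h2 le_rfl
    have i3 := FoliationChart.trans_trans (F.coherent f h1.mem.1 d h.mem.1) hdt0 h1.mem.2 hdt0
    have i4 := FoliationChart.trans_trans (F.coherent d' hd' e k.mem.1) hdt ht' k.mem.2
    rw [← hb] at i4
    filter_upwards [i1, h1.tendsto.eventually i2, h.tendsto.eventually i3,
      h.tendsto.eventually i4] with z z1 z2 z3 z4
    simp only [Function.comp_apply, FoliationChart.trans_self, id] at *
    rw [z2, z1, z3, z4]

/-- The germ of the holonomy does not depend on the chain. -/
lemma unique (hg : Continuous g) {t : ℝ} {H K : c.T → d.T}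
    (h : F.HolChain g a c t d H) (k : F.HolChain g a c t d K) :
    H =ᶠ[𝓝 (c.base (g a))] K := by
  simpa [FoliationChart.trans_self] using (trans_comp_eq hg h k).symm

/-- Change of parameter. -/
lemma reparam {H : c.T → d.T} (h : F.HolChain g a c b d H) {k m a' b' : ℝ} (hk : 0 < k)
    (ha : a = k * a' + m) (hb : b = k * b' + m)
    (hgg : ∀ r ∈ Icc a' b', g' r = g (k * r + m)) : F.HolChain g' a' c b' d H := by
  induction h generalizing b' with
  | start hc h =>
    have hab : a' = b' := mul_left_cancel₀ hk.ne' (by linarith)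
    subst hab
    exact .start hc (by rw [hgg a' (by simp), ← ha]; exact h)
  | @step s t d e H h hst hd he ht ih =>
    have hab : a' ≤ b' := le_of_mul_le_mul_left (by linarith [h.le]) hk
    have hs : s = k * ((s - m) / k) + m := by field_simp; ring
    have hsb : (s - m) / k ≤ b' := by rw [div_le_iff₀ hk]; linarith
    have has : a' ≤ (s - m) / k := by rw [le_div_iff₀ hk]; linarith [h.le]
    have h1 := ih hs (fun r hr => hgg r ⟨hr.1, hr.2.trans hsb⟩)
    obtain ⟨x, hx⟩ := hd
    have e1 : g' b' = g t := by rw [hgg b' ⟨hab, le_rfl⟩, ← hb]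
    have := h1.step (t := b') (e := e) hsb ⟨x, fun r hr => by
      rw [hgg r ⟨has.trans hr.1, hr.2⟩]
      have r1 := hr.1
      rw [div_le_iff₀ hk] at r1
      exact hx _ ⟨by linarith, by rw [hb]; nlinarith [hr.2]⟩⟩ he (by rw [e1]; exact ht)
    rwa [e1] at this

/-- A chain can be reversed, which inverts the germ of the holonomy. -/
lemma reverse {H : c.T → d.T} (h : F.HolChain g a c b d H) :
    ∃ K : d.T → c.T, F.HolChain (fun r => g (-r)) (-b) d (-a) c K ∧
      K ∘ H =ᶠ[𝓝 (c.base (g a))] id ∧ H ∘ K =ᶠ[𝓝 (d.base (g b))] id := by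
  induction h with
  | start hc h => exact ⟨id, .start hc (by simpa using h), .rfl, .rfl⟩
  | @step s t d e H h hst hd he ht ih =>
    obtain ⟨K, k, k1, k2⟩ := ih
    obtain ⟨hb, hdt, hds⟩ := base_eq hst hd
    obtain ⟨x, hx⟩ := hd
    have hT := FoliationChart.tendsto_trans e d ht hdt
    have hT' := FoliationChart.tendsto_trans d e hdt ht
    have i1 := FoliationChart.trans_trans (F.coherent e he d h.mem.1) hdt ht hdt
    have i2 := FoliationChart.trans_trans (F.coherent d h.mem.1 e he) ht hdt ht
    rw [FoliationChart.trans_self] at i1 i2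
    have l1 : F.HolChain (fun r => g (-r)) (-t) e (-t) d (e.trans d (g t)) := by
      have := (HolChain.start (F := F) (g := fun r => g (-r)) (a := -t) he (by simpa)).step
        (le_refl (-t)) ⟨e.base (g t), fun r hr => by
          obtain rfl : r = -t := le_antisymm hr.2 hr.1
          simpa using ⟨ht, rfl⟩⟩ h.mem.1 (by simpa)
      simpa using this
    have l2 : F.HolChain (fun r => g (-r)) (-t) e (-s) d (e.trans d (g t)) := by
      have := l1.step (t := -s) (neg_le_neg hst) ⟨x, fun r hr => hx _ ⟨by linarith [hr.2],
        by linarith [hr.1]⟩⟩ h.mem.1 (by simpa)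
      rwa [FoliationChart.trans_self] at this
    refine ⟨_, l2.comp k, ?_, ?_⟩
    · rw [← hb] at i1
      filter_upwards [h.tendsto.eventually i1, k1] with z z1 z2
      simp only [Function.comp_apply, id] at *
      rw [z1, z2]
    · rw [hb] at k2
      filter_upwards [hT.eventually k2, i2] with z z1 z2
      simp only [Function.comp_apply, id] at *
      rw [z1, z2]

end HolChain

/-- A path along a leaf of `F`: a path in `Y` that can be divided into finitely many pieces, each of
which runs inside a plaque of some chart of `F`. (A leaf is an equivalence class of the relation
generated by lying in the same plaque, and these are the paths in the leaf for its topology as a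
one-dimensional manifold.) -/
structure LeafPath where
  start : Y
  finish : Y
  path : Path start finish
  leafwise : ∃ c d H, F.HolChain path.extend 0 c 1 d H

variable {F}

namespace LeafPath

/-- The germ of `H` at the base point of `c.T` is the holonomy germ of `p`, with respect to the
transversals `c.T` at the starting point and `d.T` at the end point of `p`. -/
def IsHolonomy (p : F.LeafPath) (c d : FoliationChart Y) (H : c.T → d.T) : Prop :=
  F.HolChain p.path.extend 0 c 1 d H

/-- Two paths along leaves have the same holonomy class if they have the same end points and the same
holonomy germ. -/
def HolEq (p q : F.LeafPath) : Prop :=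
  p.start = q.start ∧ p.finish = q.finish ∧
    ∀ (c d : FoliationChart Y) (H K : c.T → d.T),
      p.IsHolonomy c d H → q.IsHolonomy c d K → H =ᶠ[𝓝 (c.base p.start)] K

namespace IsHolonomy

variable {p q : F.LeafPath} {c d e : FoliationChart Y}

lemma unique {H K : c.T → d.T} (h : p.IsHolonomy c d H) (k : p.IsHolonomy c d K) :
    H =ᶠ[𝓝 (c.base p.start)] K := by
  simpa using HolChain.unique p.path.extend.continuous h k

lemma tendsto {H : c.T → d.T} (h : p.IsHolonomy c d H) :
    Tendsto H (𝓝 (c.base p.start)) (𝓝 (d.base p.finish)) := by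
  simpa using HolChain.tendsto h

lemma change_left {H : c.T → d.T} (h : p.IsHolonomy c d H) (he : e ∈ F.charts)
    (hp : p.start ∈ e.dom) : p.IsHolonomy e d (H ∘ e.trans c p.start) := by
  have h0 : p.path.extend 0 ∈ e.dom := by simpa using hp
  have hm := HolChain.mem_left h
  have := (HolChain.start (F := F) (g := p.path.extend) (a := 0) he h0).step le_rfl
    ⟨e.base (p.path.extend 0), fun r hr => by
      obtain rfl : r = 0 := le_antisymm hr.2 hr.1
      exact ⟨h0, rfl⟩⟩ hm.1 hm.2
  simpa [IsHolonomy] using HolChain.comp this h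

lemma change_right {H : c.T → d.T} (h : p.IsHolonomy c d H) (he : e ∈ F.charts)
    (hp : p.finish ∈ e.dom) : p.IsHolonomy c e (d.trans e p.finish ∘ H) := by
  have h0 : p.path.extend 1 ∈ e.dom := by simpa using hp
  have := HolChain.step h le_rfl ⟨d.base (p.path.extend 1), fun r hr => by
      obtain rfl : r = 1 := le_antisymm hr.2 hr.1
      exact ⟨(HolChain.mem h).2, rfl⟩⟩ he h0
  simpa [IsHolonomy] using this

end IsHolonomy

lemma exists_isHolonomy (p : F.LeafPath) {c d : FoliationChart Y} (hc : c ∈ F.charts)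
    (hd : d ∈ F.charts) (hpc : p.start ∈ c.dom) (hpd : p.finish ∈ d.dom) :
    ∃ H, p.IsHolonomy c d H := by
  obtain ⟨c', d', H, h⟩ := p.leafwise
  exact ⟨_, IsHolonomy.change_right (IsHolonomy.change_left h hc hpc) hd hpd⟩

lemma IsHolonomy.holEq {p q : F.LeafPath} {c d : FoliationChart Y} {H K : c.T → d.T}
    (h : p.IsHolonomy c d H) (k : q.IsHolonomy c d K) (h1 : p.start = q.start)
    (h2 : p.finish = q.finish) (hHK : H =ᶠ[𝓝 (c.base p.start)] K) : p.HolEq q := by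
  refine ⟨h1, h2, fun c' d' H' K' h' k' => ?_⟩
  have mc : c' ∈ F.charts ∧ p.start ∈ c'.dom := by simpa using HolChain.mem_left h'
  have md : d' ∈ F.charts ∧ p.finish ∈ d'.dom := by simpa using HolChain.mem h'
  have nc : p.start ∈ c.dom := by simpa using (HolChain.mem_left h).2
  have i1 := ((h.change_left mc.1 mc.2).change_right md.1 md.2).unique h'
  have i2 := ((k.change_left mc.1 (h1 ▸ mc.2)).change_right md.1 (h2 ▸ md.2)).unique k'
  rw [← h1, ← h2] at i2
  filter_upwards [i1, i2, (FoliationChart.tendsto_trans c' c mc.2 nc).eventually hHK]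
    with z z1 z2 z3
  rw [← z1, ← z2]
  simp [z3]

lemma holEq_equivalence : Equivalence (HolEq (F := F)) where
  refl p := ⟨rfl, rfl, fun _ _ _ _ h k => h.unique k⟩
  symm {p q} h := ⟨h.1.symm, h.2.1.symm, fun c d H K h' k' => by
    rw [← h.1]; exact (h.2.2 c d K H k' h').symm⟩
  trans {p q r} h k := ⟨h.1.trans k.1, h.2.1.trans k.2.1, fun c d H K h' k' => by
    have mc := HolChain.mem_left h'
    have md := HolChain.mem h'
    obtain ⟨L, l⟩ := q.exists_isHolonomy mc.1 md.1 (by simpa [h.1] using mc.2)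
      (by simpa [h.2.1] using md.2)
    exact (h.2.2 _ _ _ _ h' l).trans (by rw [h.1]; exact k.2.2 _ _ _ _ l k')⟩

variable (F) in
/-- The constant path. -/
def const (y : Y) : F.LeafPath where
  start := y
  finish := y
  path := Path.refl y
  leafwise := by
    obtain ⟨c, hc, hy⟩ := F.cover y
    exact ⟨c, c, _, (HolChain.start hc (by simpa)).step zero_le_one
      ⟨c.base y, fun r _ => by simpa using ⟨hy, rfl⟩⟩ hc (by simpa)⟩

lemma const_isHolonomy {y : Y} {c : FoliationChart Y} (hc : c ∈ F.charts) (hy : y ∈ c.dom) :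
    (const F y).IsHolonomy c c id := by
  have := (HolChain.start (F := F) (g := (const F y).path.extend) (a := 0) hc
    (by simpa [const])).step (e := c) zero_le_one
      ⟨c.base y, fun r _ => by simpa [const] using ⟨hy, rfl⟩⟩ hc (by simpa [const])
  simpa [IsHolonomy, FoliationChart.trans_self] using this

lemma chain_left (p q : F.LeafPath) (h : p.finish = q.start) {c d : FoliationChart Y}
    {H : c.T → d.T} (hp : p.IsHolonomy c d H) :
    F.HolChain ((p.path.cast rfl h.symm).trans q.path).extend 0 c (1 / 2) d H :=
  HolChain.reparam hp (k := 2) (m := 0) two_pos (by norm_num) (by norm_num) fun r hr => by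
    rw [Path.extend_trans_of_le_half _ _ hr.2, Path.extend_cast, add_zero]

lemma chain_right (p q : F.LeafPath) (h : p.finish = q.start) {c d : FoliationChart Y}
    {H : c.T → d.T} (hq : q.IsHolonomy c d H) :
    F.HolChain ((p.path.cast rfl h.symm).trans q.path).extend (1 / 2) c 1 d H :=
  HolChain.reparam hq (k := 2) (m := -1) two_pos (by norm_num) (by norm_num) fun r hr => by
    rw [Path.extend_trans_of_half_le _ _ hr.1, sub_eq_add_neg]

/-- Concatenation: first `p`, then `q`. -/
def comp (p q : F.LeafPath) (h : p.finish = q.start) : F.LeafPath where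
  start := p.start
  finish := q.finish
  path := (p.path.cast rfl h.symm).trans q.path
  leafwise := by
    obtain ⟨c, d, H, hp⟩ := p.leafwise
    have m : d ∈ F.charts ∧ p.finish ∈ d.dom := by simpa using HolChain.mem hp
    obtain ⟨d', e, K, hq⟩ := q.leafwise
    have hq := IsHolonomy.change_left (p := q) hq m.1 (h ▸ m.2)
    exact ⟨_, _, _, (chain_left p q h hp).comp (chain_right p q h hq)⟩

lemma IsHolonomy.comp {p q : F.LeafPath} {c d e : FoliationChart Y} {H : c.T → d.T}
    {K : d.T → e.T} (hp : p.IsHolonomy c d H) (hq : q.IsHolonomy d e K)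
    (h : p.finish = q.start) : (p.comp q h).IsHolonomy c e (K ∘ H) :=
  (chain_left p q h hp).comp (chain_right p q h hq)

lemma chain_symm (p : F.LeafPath) {c d : FoliationChart Y} {K : d.T → c.T}
    (k : F.HolChain (fun r => p.path.extend (-r)) (-1) d (-0) c K) :
    F.HolChain p.path.symm.extend 0 d 1 c K :=
  k.reparam (k := 1) (m := -1) one_pos (by norm_num) (by norm_num) fun r hr => by
    rw [Path.extend_symm_apply]; congr 1; ring

/-- The reversed path. -/
def symm (p : F.LeafPath) : F.LeafPath where
  start := p.finish
  finish := p.start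
  path := p.path.symm
  leafwise := by
    obtain ⟨c, d, H, hp⟩ := p.leafwise
    obtain ⟨K, k, -⟩ := hp.reverse
    exact ⟨_, _, K, p.chain_symm k⟩

lemma IsHolonomy.symm {p : F.LeafPath} {c d : FoliationChart Y} {H : c.T → d.T}
    (h : p.IsHolonomy c d H) : ∃ K, p.symm.IsHolonomy d c K ∧
      K ∘ H =ᶠ[𝓝 (c.base p.start)] id ∧ H ∘ K =ᶠ[𝓝 (d.base p.finish)] id := by
  obtain ⟨K, k, k1, k2⟩ := HolChain.reverse h
  exact ⟨K, p.chain_symm k, by simpa using k1, by simpa using k2⟩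

lemma HolEq.comp {p p' q q' : F.LeafPath} (hp : p.HolEq p') (hq : q.HolEq q')
    (h : p.finish = q.start) (h' : p'.finish = q'.start) :
    (p.comp q h).HolEq (p'.comp q' h') := by
  obtain ⟨c, hc, hpc⟩ := F.cover p.start
  obtain ⟨d, hd, hpd⟩ := F.cover p.finish
  obtain ⟨e, he, hqe⟩ := F.cover q.finish
  obtain ⟨H, hH⟩ := p.exists_isHolonomy hc hd hpc hpd
  obtain ⟨H', hH'⟩ := p'.exists_isHolonomy hc hd (hp.1 ▸ hpc) (hp.2.1 ▸ hpd)
  obtain ⟨K, hK⟩ := q.exists_isHolonomy hd he (h ▸ hpd) hqe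
  obtain ⟨K', hK'⟩ := q'.exists_isHolonomy hd he (hq.1 ▸ h ▸ hpd) (hq.2.1 ▸ hqe)
  refine (hH.comp hK h).holEq (hH'.comp hK' h') hp.1 hq.2.1 ?_
  have i1 := hp.2.2 _ _ _ _ hH hH'
  have i2 := hq.2.2 _ _ _ _ hK hK'
  rw [← h] at i2
  change _ =ᶠ[𝓝 (c.base p.start)] _
  filter_upwards [i1, hH.tendsto.eventually i2] with z z1 z2
  simp only [Function.comp_apply] at *
  rw [z2, z1]

lemma HolEq.symm' {p p' : F.LeafPath} (hp : p.HolEq p') : p.symm.HolEq p'.symm := by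
  obtain ⟨c, hc, hpc⟩ := F.cover p.start
  obtain ⟨d, hd, hpd⟩ := F.cover p.finish
  obtain ⟨H, hH⟩ := p.exists_isHolonomy hc hd hpc hpd
  obtain ⟨H', hH'⟩ := p'.exists_isHolonomy hc hd (hp.1 ▸ hpc) (hp.2.1 ▸ hpd)
  obtain ⟨K, hK, k1, k2⟩ := hH.symm
  obtain ⟨K', hK', k1', k2'⟩ := hH'.symm
  refine hK.holEq hK' hp.2.1 hp.1 ?_
  have i1 := hp.2.2 _ _ _ _ hH hH'
  rw [← hp.1] at k1'
  have hT := hK.tendsto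
  change Tendsto K (𝓝 (d.base p.finish)) (𝓝 (c.base p.start)) at hT
  change _ =ᶠ[𝓝 (d.base p.finish)] _
  filter_upwards [hT.eventually i1, hT.eventually k1', k2] with z z1 z2 z3
  simp only [Function.comp_apply, id] at *
  rw [← z2, ← z1, z3]

end LeafPath

variable (F)

/-- Having the same holonomy class, as an equivalence relation. -/
def holSetoid : Setoid F.LeafPath := ⟨LeafPath.HolEq, LeafPath.holEq_equivalence⟩

/-- The set of holonomy classes of paths along the leaves. -/
def Holonomy : Type u := Quotient F.holSetoid

namespace Holonomy

variable {F}

/-- The holonomy class of a path. -/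
def mk (p : F.LeafPath) : F.Holonomy := Quotient.mk F.holSetoid p

/-- The starting point of a class. -/
def start : F.Holonomy → Y := Quotient.lift LeafPath.start fun _ _ h => h.1

/-- The end point of a class. -/
def finish : F.Holonomy → Y := Quotient.lift LeafPath.finish fun _ _ h => h.2.1

variable (F) in
/-- The class of the constant path. -/
def unit (y : Y) : F.Holonomy := mk (LeafPath.const F y)

lemma unit_injective : Function.Injective (unit F) := fun _ _ h => congrArg start h

/-- The class of the reversed path. -/
def inv : F.Holonomy → F.Holonomy := Quotient.map LeafPath.symm fun _ _ h => h.symm'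

open Classical in
/-- Concatenation of classes; the value `a` for non-composable pairs is never used. -/
def comp : F.Holonomy → F.Holonomy → F.Holonomy :=
  Quotient.map₂ (fun p q => if h : p.finish = q.start then p.comp q h else p)
    fun p p' hp q q' hq => by
      by_cases h : p.finish = q.start
      · have h' : p'.finish = q'.start := by rw [← hp.2.1, ← hq.1, h]
        simp only [h, h', dif_pos]
        exact hp.comp hq h h'
      · have h' : ¬ p'.finish = q'.start := by rwa [← hp.2.1, ← hq.1]
        simpa only [h, h', dif_neg, not_false_eq_true] using hp

open Classical in
lemma mk_comp (p q : F.LeafPath) (h : p.finish = q.start) :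
    comp (mk p) (mk q) = mk (p.comp q h) := by
  change mk (if h : p.finish = q.start then p.comp q h else p) = _
  rw [dif_pos h]

end Holonomy

end LineFoliation

/-! ### Groupoids -/

/-- A groupoid, given by its set `G` of arrows; units are identified with their identity arrows, `r`
and `d` are the range and domain maps, and `mul x y` is defined when `d x = r y`. -/
structure GroupoidStr (G : Type u) where
  r : G → G
  d : G → G
  inv : G → G
  mul : (x y : G) → d x = r y → G
  r_r : ∀ x, r (r x) = r x
  d_r : ∀ x, d (r x) = r x
  r_d : ∀ x, r (d x) = d x
  d_d : ∀ x, d (d x) = d x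
  r_inv : ∀ x, r (inv x) = d x
  d_inv : ∀ x, d (inv x) = r x
  r_mul : ∀ x y h, r (mul x y h) = r x
  d_mul : ∀ x y h, d (mul x y h) = d y
  mul_assoc : ∀ x y z (h : d x = r y) (h' : d y = r z),
    mul (mul x y h) z ((d_mul x y h).trans h') = mul x (mul y z h') (h.trans (r_mul y z h').symm)
  unit_mul : ∀ x, mul (r x) x (d_r x) = x
  mul_unit : ∀ x, mul x (d x) (r_d x).symm = x
  mul_inv : ∀ x, mul x (inv x) (r_inv x).symm = r x
  inv_mul : ∀ x, mul (inv x) x (d_inv x) = d x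

open LineFoliation in
/-- The holonomy groupoid of `F`: the range and the domain of the class of `p` are (the constant paths
at) the starting point and the end point of `p`, the product is concatenation and the inverse is
reversal. -/
def LineFoliation.holonomyGroupoid {Y : Type u} [TopologicalSpace Y] (F : LineFoliation Y) :
    GroupoidStr F.Holonomy where
  r a := Holonomy.unit F a.start
  d a := Holonomy.unit F a.finish
  inv := Holonomy.inv
  mul a b _ := a.comp b
  r_r _ := rfl
  d_r _ := rfl
  r_d _ := rfl
  d_d _ := rfl
  r_inv a := by induction a using Quotient.ind; rfl
  d_inv a := by induction a using Quotient.ind; rfl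
  r_mul a b h := by
    induction a using Quotient.ind with | _ p
    induction b using Quotient.ind with | _ q
    have h : p.finish = q.start := Holonomy.unit_injective h
    change Holonomy.unit F ((Holonomy.mk p).comp (.mk q)).start = _
    rw [Holonomy.mk_comp p q h]; rfl
  d_mul a b h := by
    induction a using Quotient.ind with | _ p
    induction b using Quotient.ind with | _ q
    have h : p.finish = q.start := Holonomy.unit_injective h
    change Holonomy.unit F ((Holonomy.mk p).comp (.mk q)).finish = _
    rw [Holonomy.mk_comp p q h]; rfl
  mul_assoc a b c h h' := by
    induction a using Quotient.ind with | _ p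
    induction b using Quotient.ind with | _ q
    induction c using Quotient.ind with | _ s
    have h : p.finish = q.start := Holonomy.unit_injective h
    have h' : q.finish = s.start := Holonomy.unit_injective h'
    change ((Holonomy.mk p).comp (.mk q)).comp (.mk s) = (Holonomy.mk p).comp ((Holonomy.mk q).comp (.mk s))
    rw [Holonomy.mk_comp p q h, Holonomy.mk_comp q s h', Holonomy.mk_comp (p.comp q h) s h',
      Holonomy.mk_comp p (q.comp s h') h]
    refine Quotient.sound ?_
    obtain ⟨c₁, m₁, i₁⟩ := F.cover p.start
    obtain ⟨c₂, m₂, i₂⟩ := F.cover p.finish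
    obtain ⟨c₃, m₃, i₃⟩ := F.cover q.finish
    obtain ⟨c₄, m₄, i₄⟩ := F.cover s.finish
    obtain ⟨H, hH⟩ := p.exists_isHolonomy m₁ m₂ i₁ i₂
    obtain ⟨K, hK⟩ := q.exists_isHolonomy m₂ m₃ (h ▸ i₂) i₃
    obtain ⟨L, hL⟩ := s.exists_isHolonomy m₃ m₄ (h' ▸ i₃) i₄
    exact ((hH.comp hK h).comp hL h').holEq (hH.comp (hK.comp hL h') h) rfl rfl .rfl
  unit_mul a := by
    induction a using Quotient.ind with | _ p
    change (Holonomy.mk (LeafPath.const F p.start)).comp (.mk p) = .mk p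
    rw [Holonomy.mk_comp _ p rfl]
    refine Quotient.sound ?_
    obtain ⟨c₁, m₁, i₁⟩ := F.cover p.start
    obtain ⟨c₂, m₂, i₂⟩ := F.cover p.finish
    obtain ⟨H, hH⟩ := p.exists_isHolonomy m₁ m₂ i₁ i₂
    exact ((LeafPath.const_isHolonomy m₁ i₁).comp hH rfl).holEq hH rfl rfl .rfl
  mul_unit a := by
    induction a using Quotient.ind with | _ p
    change (Holonomy.mk p).comp (.mk (LeafPath.const F p.finish)) = .mk p
    rw [Holonomy.mk_comp p _ rfl]
    refine Quotient.sound ?_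
    obtain ⟨c₁, m₁, i₁⟩ := F.cover p.start
    obtain ⟨c₂, m₂, i₂⟩ := F.cover p.finish
    obtain ⟨H, hH⟩ := p.exists_isHolonomy m₁ m₂ i₁ i₂
    exact (hH.comp (LeafPath.const_isHolonomy m₂ i₂) rfl).holEq hH rfl rfl .rfl
  mul_inv a := by
    induction a using Quotient.ind with | _ p
    change (Holonomy.mk p).comp (.mk p.symm) = .mk (LeafPath.const F p.start)
    rw [Holonomy.mk_comp p _ rfl]
    refine Quotient.sound ?_
    obtain ⟨c₁, m₁, i₁⟩ := F.cover p.start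
    obtain ⟨c₂, m₂, i₂⟩ := F.cover p.finish
    obtain ⟨H, hH⟩ := p.exists_isHolonomy m₁ m₂ i₁ i₂
    obtain ⟨K, hK, k1, k2⟩ := hH.symm
    exact (hH.comp hK rfl).holEq (LeafPath.const_isHolonomy m₁ i₁) rfl rfl k1
  inv_mul a := by
    induction a using Quotient.ind with | _ p
    change (Holonomy.mk p.symm).comp (.mk p) = .mk (LeafPath.const F p.finish)
    rw [Holonomy.mk_comp p.symm p rfl]
    refine Quotient.sound ?_
    obtain ⟨c₁, m₁, i₁⟩ := F.cover p.start
    obtain ⟨c₂, m₂, i₂⟩ := F.cover p.finish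
    obtain ⟨H, hH⟩ := p.exists_isHolonomy m₁ m₂ i₁ i₂
    obtain ⟨K, hK, k1, k2⟩ := hH.symm
    exact (hK.comp hH rfl).holEq (LeafPath.const_isHolonomy m₂ i₂) rfl rfl k2


/-- The classes of all paths along leaves that follow the chain `U 0, ..., U n` of charts, being inside
`U i` during the time interval `[t i, t (i + 1)]`. -/
def LineFoliation.chainNhd {Y : Type u} [TopologicalSpace Y] (F : LineFoliation Y) {n : ℕ}
    (U : Fin (n + 1) → FoliationChart Y) (t : Fin (n + 2) → ℝ) : Set F.Holonomy :=
  {a | ∃ p : F.LeafPath, LineFoliation.Holonomy.mk p = a ∧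
    ∀ i : Fin (n + 1), ∀ s ∈ Icc (t i.castSucc) (t i.succ), p.path.extend s ∈ (U i).dom}

/-- The topology of the holonomy groupoid: a subbase is given by the sets `chainNhd` for all finite
chains of charts of `F` and all subdivisions `0 = t 0 < ... < t (n + 1) = 1`. -/
instance {Y : Type u} [TopologicalSpace Y] (F : LineFoliation Y) :
    TopologicalSpace F.Holonomy :=
  TopologicalSpace.generateFrom
    {V | ∃ (n : ℕ) (U : Fin (n + 1) → FoliationChart Y) (t : Fin (n + 2) → ℝ),
      (∀ i, U i ∈ F.charts) ∧ StrictMono t ∧ t 0 = 0 ∧ t (Fin.last (n + 1)) = 1 ∧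
      V = F.chainNhd U t}

/-! ### The foliation and the transformation groupoid of a flow -/

section FlowFoliation

variable {Y : Type u} [TopologicalSpace Y] (α : Flow ℝ Y)

/-- A chart given by a tube of the flow `α`. A tube of length `l > 0` with central slice `S` is the
image `B` of `S × [-l/2, l/2]` under `(z, t) ↦ α t z`, where `S` is compact and this map is an embedding.
The domain of the corresponding chart is the interior of `B`, and its plaques are the pieces
`{α t z : |t| < l/2}` of orbits with `z ∈ S` that are inside this interior. -/
def IsTubeChart (c : FoliationChart Y) : Prop :=
  ∃ (S : Set Y) (l : ℝ), IsCompact S ∧ 0 < l ∧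
    IsEmbedding (fun p : S × Icc (-(l / 2)) (l / 2) => α p.2 p.1) ∧
    c.dom = interior ((fun p : Y × ℝ => α p.2 p.1) '' (S ×ˢ Icc (-(l / 2)) (l / 2))) ∧
    ∀ x : c.T, ∃ z ∈ S, c.plaque x = (fun t => α t z) '' Ioo (-(l / 2)) (l / 2)

/-- `F` is the foliation given by the atlas of all tube charts of `α`, that is, its charts are all
those that are coherent with every tube chart. -/
def LineFoliation.IsInducedBy (F : LineFoliation Y) : Prop :=
  F.charts = {c | ∀ d, IsTubeChart α d → c.Coherent d}

/-- The transformation groupoid `Y ⋊ ℝ`: `r (y, t) = (y, 0)`, `d (y, t) = (α (-t) y, 0)` and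
`(y, s) (α (-s) y, t) = (y, s + t)`. -/
def transformationGroupoid : GroupoidStr (Y × ℝ) where
  r x := (x.1, 0)
  d x := (α (-x.2) x.1, 0)
  inv x := (α (-x.2) x.1, -x.2)
  mul x y _ := (x.1, x.2 + y.2)
  r_r _ := rfl
  d_r _ := by simp
  r_d _ := rfl
  d_d _ := by simp
  r_inv _ := rfl
  d_inv _ := by simp [← Flow.map_add]
  r_mul _ _ _ := rfl
  d_mul x y h := by
    have : α (-x.2) x.1 = y.1 := congrArg Prod.fst h
    simp [← this, ← Flow.map_add]
  mul_assoc _ _ _ _ _ := by simp [add_assoc]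
  unit_mul _ := by simp
  mul_unit _ := by simp
  mul_inv _ := by simp
  inv_mul _ := by simp

end FlowFoliation

/-! ### Haar systems -/

/-- The functions `f` for which there is a Hausdorff open set `U` such that `f` vanishes outside `U`
and the restriction of `f` to `U` is continuous and compactly supported. -/
def CcZero (X : Type*) [TopologicalSpace X] : Set (X → ℂ) :=
  {f | ∃ U : Set X, IsOpen U ∧ T2Space U ∧ (∀ x ∉ U, f x = 0) ∧
    Continuous (fun x : U => f x) ∧ HasCompactSupport (fun x : U => f x)}

/-- The space `C_c(X)` for a possibly non-Hausdorff space `X`. -/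
def Cc (X : Type*) [TopologicalSpace X] : Submodule ℂ (X → ℂ) := Submodule.span ℂ (CcZero X)

namespace GroupoidStr

variable {G : Type u} (𝒢 : GroupoidStr G)

/-- The unit space. -/
def units : Set G := {u | 𝒢.r u = u}

/-- The range fiber `G^u` of a unit `u` (it is empty if `u` is not a unit). -/
def Fiber (u : G) : Type u := {x : G // 𝒢.r x = u}

variable [TopologicalSpace G]

instance (u : G) : TopologicalSpace (𝒢.Fiber u) := inferInstanceAs (TopologicalSpace {x // _})
instance (u : G) : MeasurableSpace (𝒢.Fiber u) := borel _
instance (u : G) : BorelSpace (𝒢.Fiber u) := ⟨rfl⟩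

/-- Multiplication and inversion are continuous, so that `G` is a topological groupoid. -/
structure IsTopological : Prop where
  continuous_mul : Continuous fun p : {p : G × G // 𝒢.d p.1 = 𝒢.r p.2} => 𝒢.mul p.1.1 p.1.2 p.2
  continuous_inv : Continuous 𝒢.inv

/-- The topological axioms of a locally compact, locally Hausdorff groupoid, apart from the
countability of the basis in `basis`, which is `HasCountableBasis` below. -/
structure IsLocallyCompact : Prop extends 𝒢.IsTopological where
  units_locallyCompact : LocallyCompactSpace 𝒢.units
  units_t2 : T2Space 𝒢.units
  basis : TopologicalSpace.IsTopologicalBasis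
    {V : Set G | ∃ C : Set G, IsCompact C ∧ T2Space C ∧ V = interior C}
  fiber_locallyCompact : ∀ u ∈ 𝒢.units, LocallyCompactSpace (𝒢.Fiber u)
  fiber_t2 : ∀ u ∈ 𝒢.units, T2Space (𝒢.Fiber u)

/-- There is a countable family of compact Hausdorff sets whose interiors are a basis. -/
def HasCountableBasis (G : Type*) [TopologicalSpace G] : Prop :=
  ∃ 𝒞 : Set (Set G), 𝒞.Countable ∧ (∀ C ∈ 𝒞, IsCompact C ∧ T2Space C) ∧
    TopologicalSpace.IsTopologicalBasis (interior '' 𝒞)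

/-- A family of Borel measures on the range fibers. -/
abbrev FiberMeasures := (u : G) → Measure (𝒢.Fiber u)

variable {𝒢}

/-- The family `μ` is a left Haar system. -/
structure IsHaarSystem (μ : 𝒢.FiberMeasures) : Prop where
  regular : ∀ u ∈ 𝒢.units, (μ u).Regular
  full_support : ∀ u ∈ 𝒢.units, (μ u).IsOpenPosMeasure
  continuous : ∀ f ∈ Cc G, (fun u : 𝒢.units => ∫ x, f x.1 ∂μ u) ∈ Cc 𝒢.units
  left_invariant : ∀ f ∈ Cc G, ∀ x : G,
    ∫ z, f (𝒢.mul x z.1 z.2.symm) ∂μ (𝒢.d x) = ∫ y, f y.1 ∂μ (𝒢.r x)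

/-- The convolution product `(f * g) x = ∫ f y * g (y⁻¹ x) dμ^{r x} y`. -/
def conv (μ : 𝒢.FiberMeasures) (f g : G → ℂ) (x : G) : ℂ :=
  ∫ y, f y.1 * g (𝒢.mul (𝒢.inv y.1) x ((𝒢.d_inv y.1).trans y.2)) ∂μ (𝒢.r x)

open ENNReal in
/-- The `I`-norm: the larger one of the suprema over all units `u` of `∫ |f x| dμ^u x` and of
`∫ |f x⁻¹| dμ^u x`. -/
def iNorm (μ : 𝒢.FiberMeasures) (f : G → ℂ) : ℝ≥0∞ :=
  max (⨆ u ∈ 𝒢.units, ∫⁻ x, ‖f x.1‖ₑ ∂μ u) (⨆ u ∈ 𝒢.units, ∫⁻ x, ‖f (𝒢.inv x.1)‖ₑ ∂μ u)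

/-- A representation of the convolution `*`-algebra `C_c(G)` on a Hilbert space, bounded by the
`I`-norm, with `f * g` as in `conv` and `f^* x = conj (f x⁻¹)`. -/
structure Rep (μ : 𝒢.FiberMeasures) where
  H : Type u
  [normed : NormedAddCommGroup H]
  [inner : InnerProductSpace ℂ H]
  [complete : CompleteSpace H]
  toLin : Cc G →ₗ[ℂ] (H →L[ℂ] H)
  map_conv : ∀ f g h : Cc G, (h : G → ℂ) = conv μ f g → toLin h = toLin f * toLin g
  map_star : ∀ f h : Cc G, (∀ x, (h : G → ℂ) x = star ((f : G → ℂ) (𝒢.inv x))) →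
    toLin h = star (toLin f)
  bounded : ∀ f : Cc G, ‖toLin f‖ₑ ≤ iNorm μ f

attribute [instance] Rep.normed Rep.inner Rep.complete

open ENNReal in
/-- The maximal groupoid `C*`-algebra `C*(G, μ)`: the completion of `C_c(G)` with respect to the
supremum of the seminorms given by all representations, realized as the closure of the image of `C_c(G)`
in the `ℓ^∞`-product of the algebras of bounded operators of all representations. -/
def cstar (μ : 𝒢.FiberMeasures) :
    NonUnitalStarSubalgebra ℂ (lp (fun ρ : Rep μ => ρ.H →L[ℂ] ρ.H) ∞) :=
  (NonUnitalStarAlgebra.adjoin ℂ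
    {a | ∃ f : Cc G, ∀ ρ : Rep μ, a ρ = ρ.toLin f}).topologicalClosure

end GroupoidStr

/-! ### Fiberwise groupoid coverings -/

/-- `π : G → H` is a fiberwise groupoid covering map. -/
structure IsFiberwiseCovering {G H : Type u} [TopologicalSpace G] [TopologicalSpace H]
    (𝒢 : GroupoidStr G) (ℋ : GroupoidStr H) (π : G → H) : Prop where
  map_r : ∀ x, π (𝒢.r x) = ℋ.r (π x)
  map_d : ∀ x, π (𝒢.d x) = ℋ.d (π x)
  map_mul : ∀ x y (h : 𝒢.d x = 𝒢.r y) (h' : ℋ.d (π x) = ℋ.r (π y)),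
    π (𝒢.mul x y h) = ℋ.mul (π x) (π y) h'
  units_homeo : ∃ e : 𝒢.units ≃ₜ ℋ.units, ∀ u, (e u : H) = π u
  surjective : Function.Surjective π
  isLocalHomeomorph : IsLocalHomeomorph π

namespace IsFiberwiseCovering

variable {G H : Type u} [TopologicalSpace G] [TopologicalSpace H]
  {𝒢 : GroupoidStr G} {ℋ : GroupoidStr H} {π : G → H} (hπ : IsFiberwiseCovering 𝒢 ℋ π)

/-- The restriction `G^u → H^{π u}` of `π`. -/
def fiberMap (u : G) (x : 𝒢.Fiber u) : ℋ.Fiber (π u) :=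
  ⟨π x.1, by rw [← hπ.map_r, x.2]⟩

/-- `π` intertwines the Haar systems `μ` and `lam`: for every unit `u` and every open set `U` on which
`π` is a homeomorphism onto its image, `π` pushes the restriction of `μ^u` to `U ∩ G^u` forward to the
restriction of `lam^{π u}` to `π(U) ∩ H^{π u}`. -/
def Intertwines (μ : 𝒢.FiberMeasures) (lam : ℋ.FiberMeasures) : Prop :=
  ∀ u ∈ 𝒢.units, ∀ U : Set G, IsOpen U → IsEmbedding (fun x : U => π x) →
    ((μ u).restrict {x | x.1 ∈ U}).map (hπ.fiberMap u) =
      (lam (π u)).restrict {y | y.1 ∈ π '' U}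

end IsFiberwiseCovering

/-! ### Crossed products -/

section CrossedProduct

variable {Y : Type u} [TopologicalSpace Y] (α : Flow ℝ Y)

open scoped ZeroAtInfty

/-- The action of `ℝ` on `C₀(Y)`, `f ↦ f ∘ α (-t)`. -/
def flowAction (t : ℝ) (f : C₀(Y, ℂ)) : C₀(Y, ℂ) :=
  f.comp ((α.toHomeomorph (-t)).toCocompactMap)

/-- A covariant representation `(π, U)` of `(C₀(Y), ℝ, α)` on a Hilbert space. -/
structure CovariantRep where
  H : Type u
  [normed : NormedAddCommGroup H]
  [inner : InnerProductSpace ℂ H]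
  [complete : CompleteSpace H]
  π : C₀(Y, ℂ) →⋆ₙₐ[ℂ] (H →L[ℂ] H)
  U : ℝ → unitary (H →L[ℂ] H)
  U_add : ∀ s t, U (s + t) = U s * U t
  U_continuous : ∀ ξ : H, Continuous fun t => (U t : H →L[ℂ] H) ξ
  covariant : ∀ t f, (U t : H →L[ℂ] H) * π f * star (U t : H →L[ℂ] H) = π (flowAction α t f)

attribute [instance] CovariantRep.normed CovariantRep.inner CovariantRep.complete

open ENNReal in
/-- The crossed product `C₀(Y) ⋊ ℝ`: the completion of `C_c(ℝ, C₀(Y))` with respect to the supremum of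
the seminorms given by the integrated forms `f ↦ ∫ π (f t) U_t dt` of all covariant representations,
realized as the closure of the image of `C_c(ℝ, C₀(Y))` in the `ℓ^∞`-product of the algebras of bounded
operators of all covariant representations. -/
def crossedProduct :
    NonUnitalStarSubalgebra ℂ (lp (fun ρ : CovariantRep α => ρ.H →L[ℂ] ρ.H) ∞) :=
  (NonUnitalStarAlgebra.adjoin ℂ
    {a | ∃ f : ℝ → C₀(Y, ℂ), Continuous f ∧ HasCompactSupport f ∧
      ∀ (ρ : CovariantRep α) (ξ : ρ.H),
        a ρ ξ = ∫ t, ρ.π (f t) ((ρ.U t : ρ.H →L[ℂ] ρ.H) ξ)}).topologicalClosure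

/-- The Lebesgue Haar system on `Y ⋊ ℝ`: the measure of `E ⊆ G^{(y, 0)}` is the Lebesgue measure of
`{t | (y, t) ∈ E}`. -/
def lebesgueSystem : (transformationGroupoid α).FiberMeasures :=
  fun _ => (volume : Measure ℝ).comap fun x => x.1.2

/-- `π (y, t)` is the holonomy class of the path `s ↦ α (-ts) y`, `s ∈ [0, 1]`, along the leaf of `y`. -/
def IsCanonicalMap (F : LineFoliation Y) (π : Y × ℝ → F.Holonomy) : Prop :=
  ∀ (y : Y) (t : ℝ), ∃ p : F.LeafPath,
    (∀ s : unitInterval, p.path s = α (-(t * s)) y) ∧ π (y, t) = LineFoliation.Holonomy.mk p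

end CrossedProduct

end

noncomputable section

open Set Filter Topology MeasureTheory Pointwise

/-! ### Local cross sections and tubes of a flow -/

namespace FlowFoliation

variable {Y : Type u} [TopologicalSpace Y] (α : Flow ℝ Y)

/-! Near a point that is not fixed, averaging a distance function along the flow yields a function
that is strictly increasing on short orbit pieces. A level set of it is a local cross section, so
every point lies inside arbitrarily small tubes (`exists_tube`). The time coordinate of a tube is
continuous, so tube charts are pairwise coherent, and the charts coherent with all of them form a
foliation (`flowFoliation`).

A leafwise path from `y` has the form `r ↦ α (θ r) y` with `θ` continuous and `θ 0 = 0`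
(`exists_isLift`), and its holonomy germ is the germ of the flow map `α (θ 1)` read in transverse
coordinates (`chain_germ`). Hence a holonomy class is determined by its starting point and one flow
time (`IsLift.holEq_iff`), and `canonicalMap` is surjective. It is locally injective because periods
near a given point are bounded below. It is continuous because a representative can be moved to
nearby data by a small linear change of `θ`. It is open because a path that stays close to a
reference path cannot end at a very different time. So the canonical map is a local homeomorphism
and an open quotient map, along which the topological properties of the holonomy groupoid descend.
The fiber over `y` is `ℝ` modulo a cyclic subgroup (`exists_holonomyKernel_eq_zmultiples`), and
Lebesgue measure on a fundamental domain gives a system intertwined with `μ`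
(`intertwines_holonomyHaar`).

For intertwined systems, summation over the fibers of the canonical map is a `*`-homomorphism of
convolution algebras from `C_c(Y × ℝ)` onto `C_c` of the holonomy groupoid (`exists_pushforward_eq`,
`conv_pushforward`, `pushforward_flowStar`), and the `I`-norm of an image satisfies the obvious
sup-norm estimate (`iNorm_pushforward_le`). A representation of the holonomy groupoid therefore
pulls back to a representation `L` of `C_c(Y × ℝ)`. On the closed span of the ranges of `L`,
translations by the flow and multiplication by functions on `Y` act as a covariant representation
whose integrated form is again `L` (`IsFlowRep.intOp_covariantRep`). Collecting this over all
representations gives a `*`-homomorphism between the products that define the two completions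
(`toRepProduct`). It maps the crossed product into `C*(G, λ)` with dense image, and ranges of
`*`-homomorphisms of `C*`-algebras are closed (`isClosed_range_starAlgHom`), so the map is onto. -/

lemma continuous_uncurry : Continuous fun p : Y × ℝ => α p.2 p.1 :=
  α.continuous continuous_snd continuous_fst

lemma continuous_orbit (y : Y) : Continuous fun t : ℝ => α t y :=
  α.continuous continuous_id continuous_const

lemma flow_eq_iff {s t : ℝ} {y z : Y} : α s y = α t z ↔ α (s - t) y = z := by
  constructor
  · intro h
    rw [sub_eq_neg_add, α.map_add, h, ← α.map_add]
    simp
  · rintro rfl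
    rw [← α.map_add]; simp

lemma tendsto_flow_zero (y : Y) : Tendsto (fun p : Y × ℝ => α p.2 p.1) (𝓝 (y, 0)) (𝓝 y) := by
  have := (continuous_uncurry α).tendsto (y, 0)
  simpa using this

/-- Near a point that is not fixed, some function is strictly increasing along the flow. -/
lemma exists_strictMonoOn [TopologicalSpace.MetrizableSpace Y] {y : Y} (hy : ∃ t, α t y ≠ y) :
    ∃ f : Y → ℝ, Continuous f ∧ ∃ V ∈ 𝓝 y, ∃ ε > 0, ∀ z ∈ V,
      StrictMonoOn (fun t => f (α t z)) (Icc (-ε) ε) := by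
  let _ := TopologicalSpace.metrizableSpaceMetric Y
  obtain ⟨τ, hτ⟩ := hy
  have hc : ∀ z, Continuous fun s : ℝ => dist y (α s z) := fun z =>
    continuous_const.dist (continuous_orbit α z)
  -- Averaging over an orbit piece of length `τ` makes the distance function differentiable along
  -- the flow: the derivative at `z` is `dist y (α τ z) - dist y z`, which is positive for `z` near
  -- `y` because `α τ y ≠ y`.
  refine ⟨fun z => ∫ s in (0 : ℝ)..τ, dist y (α s z), ?_, ?_⟩
  · apply intervalIntegral.continuous_parametric_intervalIntegral_of_continuous'
    exact continuous_const.dist (continuous_uncurry α)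
  have hP : ∀ᶠ w in 𝓝 y, 0 < dist y (α τ w) - dist y w := by
    have : Continuous fun w => dist y (α τ w) - dist y w :=
      (continuous_const.dist (α.continuous continuous_const continuous_id)).sub
        (continuous_const.dist continuous_id)
    refine (this.tendsto y).eventually_const_lt ?_
    simpa [dist_pos] using hτ.symm
  have h1 := (tendsto_flow_zero α y).eventually hP
  rw [nhds_prod_eq] at h1
  obtain ⟨V, hV, A, hA, hVA⟩ := Filter.mem_prod_iff.1 h1
  obtain ⟨ε, hε, hA'⟩ := Metric.mem_nhds_iff.1 hA
  refine ⟨V, hV, ε / 2, by positivity, fun z hz => ?_⟩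
  have hd : ∀ t, HasDerivAt (fun t => ∫ s in (0 : ℝ)..τ, dist y (α s (α t z)))
      (dist y (α (τ + t) z) - dist y (α t z)) t := by
    intro t
    -- A shift of the integration variable moves `t` from the integrand to the limits, where the
    -- fundamental theorem of calculus applies.
    have e : (fun t => ∫ s in (0 : ℝ)..τ, dist y (α s (α t z))) =
        fun t => (∫ s in (0 : ℝ)..(τ + t), dist y (α s z)) - ∫ s in (0 : ℝ)..t, dist y (α s z) := by
      funext t
      simp_rw [← α.map_add]
      rw [intervalIntegral.integral_comp_add_right (fun s => dist y (α s z)) t, zero_add,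
        intervalIntegral.integral_interval_sub_left] <;> exact (hc z).intervalIntegrable _ _
    rw [e]
    have d1 := (hc z).integral_hasStrictDerivAt 0 t |>.hasDerivAt
    have d2 := (hc z).integral_hasStrictDerivAt 0 (τ + t) |>.hasDerivAt
    exact (d2.comp_const_add τ t).sub d1
  refine strictMonoOn_of_deriv_pos (convex_Icc _ _)
    (fun t _ => (hd t).continuousAt.continuousWithinAt) fun t ht => ?_
  rw [(hd t).deriv, α.map_add]
  rw [interior_Icc] at ht
  refine hVA (mk_mem_prod hz (hA' ?_) : (z, t) ∈ V ×ˢ A)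
  rw [Metric.mem_ball, dist_zero_right, Real.norm_eq_abs, abs_lt]
  constructor <;> linarith [ht.1, ht.2]

/-- A function that is strictly monotone in time on `[-ε, ε]` separates `α t z` from `z`, and the
same `ε` serves all `z` near `y`. This is the source of the local injectivity of the canonical map.
-/
lemma no_small_periods [TopologicalSpace.MetrizableSpace Y] {y : Y} (hy : ∃ t, α t y ≠ y) :
    ∃ ε > 0, ∀ᶠ z in 𝓝 y, ∀ t, |t| ≤ ε → α t z = z → t = 0 := by
  obtain ⟨f, -, V, hV, ε, hε, h⟩ := exists_strictMonoOn α hy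
  refine ⟨ε, hε, ?_⟩
  filter_upwards [hV] with z hz t ht h0
  refine (h z hz).injOn (abs_le.1 ht) ⟨by linarith, hε.le⟩ ?_
  simp [h0]

/-- The tube with central slice `S` and length `l`. -/
def tube (S : Set Y) (l : ℝ) : Set Y :=
  (fun p : Y × ℝ => α p.2 p.1) '' (S ×ˢ Icc (-(l / 2)) (l / 2))

/-- The slice is the level set of the increasing function `f` through `y`, cut down to a compact
neighbourhood. Monotonicity shows that a short orbit piece meets it at most once, and the
intermediate value theorem shows that every orbit near `y` meets it at a small time. -/
lemma exists_tube [TopologicalSpace.MetrizableSpace Y] [LocallyCompactSpace Y] {y : Y}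
    (hy : ∃ t, α t y ≠ y) {N : Set Y} (hN : N ∈ 𝓝 y) :
    ∃ (S : Set Y) (l : ℝ), IsCompact S ∧ 0 < l ∧
      InjOn (fun p : Y × ℝ => α p.2 p.1) (S ×ˢ Icc (-(l / 2)) (l / 2)) ∧
      y ∈ interior (tube α S l) ∧ tube α S l ⊆ N := by
  obtain ⟨f, hf, V, hV, ε, hε, hm⟩ := exists_strictMonoOn α hy
  have h1 := (tendsto_flow_zero α y).eventually hN
  rw [nhds_prod_eq] at h1
  obtain ⟨V', hV', A, hA, hVA⟩ := Filter.mem_prod_iff.1 h1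
  obtain ⟨δ, hδ, hA'⟩ := Metric.mem_nhds_iff.1 hA
  obtain ⟨K, hK, hKV, hKc⟩ := local_compact_nhds (inter_mem hV hV')
  -- `l ≤ ε` keeps differences of two tube times within the range of monotonicity; `l ≤ δ` keeps the
  -- tube inside `N`.
  set l := min ε δ with hl
  have hl0 : 0 < l := lt_min hε hδ
  have hball : ∀ t ∈ Icc (-(l / 2)) (l / 2), t ∈ A := fun t ht => hA' (by
    rw [Metric.mem_ball, dist_zero_right, Real.norm_eq_abs, abs_lt]
    constructor <;> linarith [ht.1, ht.2, min_le_right ε δ])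
  refine ⟨K ∩ f ⁻¹' {f y}, l, hKc.inter_right (isClosed_singleton.preimage hf), hl0, ?_, ?_, ?_⟩
  · rintro ⟨z, t⟩ ⟨⟨hz, hz'⟩, ht⟩ ⟨w, s⟩ ⟨⟨hw, hw'⟩, hs⟩ h
    simp only [mem_preimage, mem_singleton_iff] at hz' hw' ht hs
    have e := (flow_eq_iff α).1 h
    have := (hm z (hKV hz).1).injOn (x₁ := t - s) (x₂ := 0) ⟨by linarith [ht.1, hs.2, min_le_left ε δ],
      by linarith [ht.2, hs.1, min_le_left ε δ]⟩ ⟨by linarith, hε.le⟩ (by simp [e, hz', hw'])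
    obtain rfl : t = s := by linarith
    simp at e
    rw [e]
  · have hKn := (tendsto_flow_zero α y).eventually hK
    rw [nhds_prod_eq] at hKn
    obtain ⟨W, hW, B, hB, hWB⟩ := Filter.mem_prod_iff.1 hKn
    obtain ⟨η, hη, hB'⟩ := Metric.mem_nhds_iff.1 hB
    -- A crossing time in `[-k, k]` is a tube time by the first bound, and by the second one the
    -- crossing point lies in the compact neighbourhood `K`.
    set k := min (l / 2) (η / 2)
    have hk : 0 < k := lt_min (by positivity) (by positivity)
    have hkl : k ≤ l / 2 := min_le_left _ _
    have hkη : k ≤ η / 2 := min_le_right _ _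
    have hlε : l ≤ ε := min_le_left _ _
    have m := hm y (mem_of_mem_nhds hV)
    have p1 : f y < f (α k y) := by
      simpa using m (a := 0) ⟨by linarith, by linarith⟩ (b := k) ⟨by linarith, by linarith⟩ hk
    have p2 : f (α (-k) y) < f y := by
      simpa using m (a := -k) ⟨by linarith, by linarith⟩ (b := 0) ⟨by linarith, by linarith⟩
        (by linarith)
    have c1 : Continuous fun z => f (α k z) := hf.comp (α.continuous continuous_const continuous_id)
    have c2 : Continuous fun z => f (α (-k) z) :=
      hf.comp (α.continuous continuous_const continuous_id)
    rw [mem_interior_iff_mem_nhds]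
    filter_upwards [c1.continuousAt.eventually_const_lt p1, c2.continuousAt.eventually_lt_const p2,
      hW] with z h1 h2 hzW
    obtain ⟨t, ht, e⟩ := intermediate_value_Icc (f := fun t => f (α t z)) (a := -k) (b := k)
      (by linarith) (hf.comp (continuous_orbit α z)).continuousOn ⟨h2.le, h1.le⟩
    have htB : t ∈ B := hB' (by
      rw [Metric.mem_ball, dist_zero_right, Real.norm_eq_abs, abs_lt]
      constructor <;> linarith [ht.1, ht.2])
    refine ⟨(α t z, -t), ⟨⟨hWB (mk_mem_prod hzW htB : (z, t) ∈ W ×ˢ B), e⟩, ?_⟩, ?_⟩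
    · constructor <;> simp only <;> linarith [ht.1, ht.2]
    · simp [← α.map_add]
  · rintro _ ⟨⟨z, t⟩, ⟨hz, ht⟩, rfl⟩
    exact hVA (mk_mem_prod (hKV hz.1).2 (hball t ht) : (z, t) ∈ V' ×ˢ A)

section Tube

variable {α} {S : Set Y} {l : ℝ}

lemma isEmbedding_of_injOn [T2Space Y] (hS : IsCompact S)
    (hi : InjOn (fun p : Y × ℝ => α p.2 p.1) (S ×ˢ Icc (-(l / 2)) (l / 2))) :
    IsEmbedding (fun p : S × Icc (-(l / 2)) (l / 2) => α p.2 p.1) := by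
  have : CompactSpace S := isCompact_iff_compactSpace.1 hS
  refine (Continuous.isClosedEmbedding ?_ ?_).isEmbedding
  · exact α.continuous (by fun_prop) (by fun_prop)
  · intro p q h
    have := hi (x₁ := (p.1.1, p.2.1)) ⟨p.1.2, p.2.2⟩ (x₂ := (q.1.1, q.2.1)) ⟨q.1.2, q.2.2⟩ h
    simp only [Prod.mk.injEq] at this
    exact Prod.ext (Subtype.ext this.1) (Subtype.ext this.2)

lemma injOn_of_isEmbedding
    (h : IsEmbedding (fun p : S × Icc (-(l / 2)) (l / 2) => α p.2 p.1)) :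
    InjOn (fun p : Y × ℝ => α p.2 p.1) (S ×ˢ Icc (-(l / 2)) (l / 2)) := by
  rintro ⟨z, t⟩ ⟨hz, ht⟩ ⟨w, s⟩ ⟨hw, hs⟩ e
  have := h.injective (a₁ := (⟨z, hz⟩, ⟨t, ht⟩)) (a₂ := (⟨w, hw⟩, ⟨s, hs⟩)) e
  simpa using this

/-- The time coordinate of an embedded tube is continuous. -/
lemma eventually_time_near
    (h : IsEmbedding (fun p : S × Icc (-(l / 2)) (l / 2) => α p.2 p.1)) {z : Y} (hz : z ∈ S)
    {t : ℝ} (ht : t ∈ Icc (-(l / 2)) (l / 2)) {ε : ℝ} (hε : 0 < ε) :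
    ∀ᶠ v in 𝓝 (α t z), ∀ z' ∈ S, ∀ s ∈ Icc (-(l / 2)) (l / 2), α s z' = v → |s - t| < ε := by
  have h1 : ∀ᶠ p : S × Icc (-(l / 2)) (l / 2) in 𝓝 (⟨z, hz⟩, ⟨t, ht⟩), |(p.2 : ℝ) - t| < ε := by
    have : Continuous fun p : S × Icc (-(l / 2)) (l / 2) => |(p.2 : ℝ) - t| := by fun_prop
    exact (this.tendsto (⟨z, hz⟩, ⟨t, ht⟩)).eventually_lt_const (by simpa)
  rw [h.nhds_eq_comap, eventually_comap] at h1
  filter_upwards [h1] with v hv z' hz' s hs e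
  exact hv (⟨z', hz'⟩, ⟨s, hs⟩) e

/-- One interior point makes the whole open orbit piece interior: the flow map for time `t - t'`
takes points near `α t' z` to points of the tube whose time is near `t`, and shifting that time back
by `t' - t` remains allowed because `t'` is strictly inside the interval. -/
lemma mem_interior_tube
    (h : IsEmbedding (fun p : S × Icc (-(l / 2)) (l / 2) => α p.2 p.1)) {z : Y} (hz : z ∈ S)
    {t : ℝ} (ht : t ∈ Icc (-(l / 2)) (l / 2)) (hi : α t z ∈ interior (tube α S l)) {t' : ℝ}
    (ht' : t' ∈ Ioo (-(l / 2)) (l / 2)) : α t' z ∈ interior (tube α S l) := by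
  obtain ⟨ε, hε, hb⟩ := Metric.isOpen_iff.1 isOpen_Ioo t' ht'
  rw [mem_interior_iff_mem_nhds] at hi ⊢
  have hT : Tendsto (fun v => α (t - t') v) (𝓝 (α t' z)) (𝓝 (α t z)) := by
    have := (α.continuous (continuous_const (y := t - t')) continuous_id).tendsto (α t' z)
    rwa [id, ← α.map_add, sub_add_cancel] at this
  filter_upwards [hT.eventually hi, hT.eventually (eventually_time_near h hz ht hε)] with v h1 h2
  obtain ⟨⟨z', s⟩, ⟨hz', hs⟩, e⟩ := h1
  have h3 := h2 z' hz' s hs e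
  have h4 : s - t + t' ∈ Ioo (-(l / 2)) (l / 2) := hb (by
    rw [Metric.mem_ball, Real.dist_eq]; convert h3 using 2; ring)
  refine ⟨(z', s - t + t'), ⟨hz', Ioo_subset_Icc_self h4⟩, ?_⟩
  simp only at e ⊢
  rw [show s - t + t' = (t' - t) + s by ring, α.map_add, e, ← α.map_add]
  simp

/-- Orbit points `α r z` with `r` near `t` still lie in the tube, so they have tube coordinates
`(z', s)`; injectivity forces `s = r`. Thus a whole neighbourhood of `t` consists of tube times. -/
lemma time_mem_Ioo (hl : 0 < l)
    (h : IsEmbedding (fun p : S × Icc (-(l / 2)) (l / 2) => α p.2 p.1)) {z : Y} (hz : z ∈ S)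
    {t : ℝ} (ht : t ∈ Icc (-(l / 2)) (l / 2)) (hi : α t z ∈ interior (tube α S l)) :
    t ∈ Ioo (-(l / 2)) (l / 2) := by
  rw [← interior_Icc, mem_interior_iff_mem_nhds]
  rw [mem_interior_iff_mem_nhds] at hi
  have hT := (continuous_orbit α z).tendsto t
  -- Two errors below `l / 4` give `|r - s| < l / 2`, so that `r - s` is itself an admissible tube
  -- time.
  filter_upwards [hT.eventually hi, hT.eventually (eventually_time_near h hz ht
    (show 0 < l / 4 by positivity)), Metric.ball_mem_nhds t (show 0 < l / 4 by positivity)]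
    with r h1 h2 h3
  obtain ⟨⟨z', s⟩, ⟨hz', hs⟩, e⟩ := h1
  have h4 := abs_lt.1 (h2 z' hz' s hs e)
  rw [Metric.mem_ball, Real.dist_eq, abs_lt] at h3
  have e' := (flow_eq_iff α).1 e.symm
  have := injOn_of_isEmbedding h (x₁ := (z, r - s)) ⟨hz, by constructor <;> simp only <;> linarith⟩
    (x₂ := (z', 0)) ⟨hz', by constructor <;> simp only <;> linarith⟩ (by simpa using e')
  simp only [Prod.mk.injEq] at this
  rwa [show r = s by linarith [this.2]]

end Tube

end FlowFoliation

/-! ### Charts given by tubes -/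

namespace FlowFoliation

variable {Y : Type u} [TopologicalSpace Y] (α : Flow ℝ Y)

/-- A homeomorphism of `ℝ` onto `(-(l / 2), l / 2)`. -/
def timeScale (l r : ℝ) : ℝ := l / Real.pi * Real.arctan r

lemma continuous_timeScale (l : ℝ) : Continuous (timeScale l) :=
  continuous_const.mul Real.continuous_arctan

lemma strictMono_timeScale {l : ℝ} (hl : 0 < l) : StrictMono (timeScale l) :=
  Real.arctan_strictMono.const_mul (div_pos hl Real.pi_pos)

lemma range_timeScale {l : ℝ} (hl : 0 < l) : range (timeScale l) = Ioo (-(l / 2)) (l / 2) := by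
  have hp := Real.pi_pos
  ext t
  constructor
  · rintro ⟨r, rfl⟩
    have e : l / 2 = l / Real.pi * (Real.pi / 2) := by field_simp
    have h := div_pos hl Real.pi_pos
    rw [e, ← mul_neg]
    exact ⟨mul_lt_mul_of_pos_left (Real.neg_pi_div_two_lt_arctan r) h,
      mul_lt_mul_of_pos_left (Real.arctan_lt_pi_div_two r) h⟩
  · intro ht
    refine ⟨Real.tan (Real.pi / l * t), ?_⟩
    have e : Real.pi / 2 = Real.pi / l * (l / 2) := by field_simp
    have h := div_pos Real.pi_pos hl
    rw [timeScale, Real.arctan_tan]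
    · field_simp
    · rw [e, ← mul_neg]; exact mul_lt_mul_of_pos_left ht.1 h
    · rw [e]; exact mul_lt_mul_of_pos_left ht.2 h

variable {α} in
-- The inverse of the chart is `(r, z) ↦ α (timeScale l r) z`, for `z` in the part of the slice
-- inside the interior of the tube. The function `u` is the tube time; the two last clauses (plaques
-- are orbit pieces timed by `u`, short flow times preserve plaques) are what later arguments need
-- to know about the chart.
lemma exists_chart_of_tube [TopologicalSpace.MetrizableSpace Y] [LocallyCompactSpace Y]
    {S : Set Y} {l : ℝ} (hS : IsCompact S) (hl : 0 < l)
    (hE : IsEmbedding (fun p : S × Icc (-(l / 2)) (l / 2) => α p.2 p.1))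
    (hne : (interior (tube α S l)).Nonempty) :
    ∃ c : FoliationChart Y, IsTubeChart α c ∧ c.dom = interior (tube α S l) ∧
      ∃ u : Y → ℝ, ContinuousOn u c.dom ∧
        (∀ z ∈ c.dom, ∀ w ∈ c.dom, (c.φ z).2 = (c.φ w).2 → α (u w - u z) z = w) ∧
        ∀ z ∈ c.dom, ∀ᶠ p : Y × ℝ in 𝓝 (z, 0), (c.φ (α p.2 p.1)).2 = (c.φ p.1).2 := by
  let T : Type u := {z : Y // z ∈ S ∩ interior (tube α S l)}
  have hTlc : LocallyCompactSpace T :=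
    ((hS.isClosed.isLocallyClosed).inter isOpen_interior.isLocallyClosed).locallyCompactSpace
  have hmem : ∀ r, timeScale l r ∈ Ioo (-(l / 2)) (l / 2) := fun r => by
    rw [← range_timeScale hl]; exact ⟨r, rfl⟩
  let kh : ℝ → Icc (-(l / 2)) (l / 2) := fun r => ⟨timeScale l r, Ioo_subset_Icc_self (hmem r)⟩
  have hkh : IsEmbedding kh := by
    have : IsEmbedding (timeScale l) :=
      (strictMono_timeScale hl).isEmbedding_of_ordConnected
        (by rw [range_timeScale hl]; exact ordConnected_Ioo)
    exact IsEmbedding.of_comp (by exact (continuous_timeScale l).subtype_mk _)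
      continuous_subtype_val this
  let kx : T → S := inclusion inter_subset_left
  have hkx : IsEmbedding kx := IsEmbedding.inclusion _
  let j : ℝ × T → Y := fun p => α (timeScale l p.1) p.2.1
  have hj : IsEmbedding j :=
    (hE.comp (hkx.prodMap hkh)).comp (Homeomorph.prodComm ℝ T).isEmbedding
  have hr : range j = interior (tube α S l) := by
    ext w
    constructor
    · rintro ⟨p, rfl⟩
      have h0 : (0 : ℝ) ∈ Icc (-(l / 2)) (l / 2) := by constructor <;> linarith
      exact mem_interior_tube hE p.2.2.1 h0 (by simpa using p.2.2.2) (hmem p.1)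
    · intro hw
      obtain ⟨⟨z, t⟩, ⟨hz, ht⟩, e⟩ := interior_subset hw
      simp only at hz ht e
      subst e
      have ht' := time_mem_Ioo hl hE hz ht hw
      have h0 : (0 : ℝ) ∈ Ioo (-(l / 2)) (l / 2) := by constructor <;> linarith
      have hz' := mem_interior_tube hE hz ht hw h0
      rw [α.map_zero, id] at hz'
      obtain ⟨r, rfl⟩ : t ∈ range (timeScale l) := by rwa [range_timeScale hl]
      exact ⟨(r, ⟨z, hz, hz'⟩), rfl⟩
  have hjo : IsOpenEmbedding j := ⟨hj, by rw [hr]; exact isOpen_interior⟩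
  have : Nonempty (ℝ × T) := by
    obtain ⟨w, hw⟩ := hne
    rw [← hr] at hw
    exact ⟨hw.choose⟩
  let c : FoliationChart Y :=
    { T := T, φ := (hjo.toOpenPartialHomeomorph j).symm, target_eq := by simp }
  have hdom : c.dom = range j := by simp [c, FoliationChart.dom]
  have hφ : ∀ p, c.φ (j p) = p := fun p =>
    (hjo.toOpenPartialHomeomorph j).left_inv (by simp)
  have hu : ContinuousOn (fun w => timeScale l (c.φ w).1) c.dom :=
    (continuous_timeScale l).comp_continuousOn (continuous_fst.comp_continuousOn c.φ.continuousOn)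
  refine ⟨c, ⟨S, l, hS, hl, hE, hdom.trans hr, fun x => ⟨x.1, x.2.1, ?_⟩⟩, hdom.trans hr,
    fun w => timeScale l (c.φ w).1, hu, ?_, ?_⟩
  · ext w
    simp only [FoliationChart.plaque, hdom, mem_ofPred_eq]
    constructor
    · rintro ⟨⟨p, rfl⟩, h⟩
      rw [hφ] at h
      subst h
      exact ⟨_, hmem p.1, rfl⟩
    · rintro ⟨t, ht, rfl⟩
      rw [← range_timeScale hl] at ht
      obtain ⟨r, rfl⟩ := ht
      exact ⟨⟨(r, x), rfl⟩, congrArg Prod.snd (hφ (r, x))⟩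
  · rw [hdom]
    rintro _ ⟨p, rfl⟩ _ ⟨q, rfl⟩ h
    rw [hφ, hφ] at h
    simp only [hφ]
    rw [← α.map_add, sub_add_cancel, h]
  · intro z hz
    have hzn : c.dom ∈ 𝓝 z := c.φ.open_source.mem_nhds hz
    have hu' : Tendsto (fun p : Y × ℝ => timeScale l (c.φ p.1).1 + p.2) (𝓝 (z, 0))
        (𝓝 (timeScale l (c.φ z).1 + 0)) := by
      have h1 := (hu.continuousAt hzn).tendsto
      rw [nhds_prod_eq]
      exact (h1.comp tendsto_fst).add tendsto_snd
    have h1 := hu'.eventually (isOpen_Ioo.mem_nhds (by rw [add_zero]; exact hmem _))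
    have h2 : ∀ᶠ p : Y × ℝ in 𝓝 (z, 0), p.1 ∈ c.dom := by
      rw [nhds_prod_eq]; exact tendsto_fst.eventually hzn
    filter_upwards [h1, h2] with p hp hp'
    rw [hdom] at hp'
    obtain ⟨q, hq⟩ := hp'
    rw [← hq, hφ] at hp
    obtain ⟨r, hr⟩ : _ ∈ range (timeScale l) := by rw [range_timeScale hl]; exact hp
    have : α p.2 p.1 = j (r, q.2) := by
      simp only [j, hr]
      rw [← hq, ← α.map_add, add_comm]
    rw [this, hφ, ← hq, hφ]

/-- Every point is in the domain of arbitrarily small tube charts. -/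
lemma exists_tubeChart [TopologicalSpace.MetrizableSpace Y] [LocallyCompactSpace Y] {y : Y}
    (hy : ∃ t, α t y ≠ y) {N : Set Y} (hN : N ∈ 𝓝 y) :
    ∃ c : FoliationChart Y, IsTubeChart α c ∧ y ∈ c.dom ∧ c.dom ⊆ N ∧
      ∃ u : Y → ℝ, ContinuousOn u c.dom ∧
        (∀ z ∈ c.dom, ∀ w ∈ c.dom, (c.φ z).2 = (c.φ w).2 → α (u w - u z) z = w) ∧
        ∀ z ∈ c.dom, ∀ᶠ p : Y × ℝ in 𝓝 (z, 0), (c.φ (α p.2 p.1)).2 = (c.φ p.1).2 := by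
  obtain ⟨S, l, hS, hl, hi, hyi, hN⟩ := exists_tube α hy hN
  obtain ⟨c, h1, h2, h3⟩ := exists_chart_of_tube hS hl (isEmbedding_of_injOn hS hi) ⟨y, hyi⟩
  exact ⟨c, h1, h2 ▸ hyi, h2 ▸ interior_subset.trans hN, h3⟩

end FlowFoliation

/-! ### Coherence via an intermediate chart -/

namespace FoliationChart

variable {Y : Type u} [TopologicalSpace Y] {c d e : FoliationChart Y}

lemma isOpen_plaque_inter_iff {x : c.T} {x' : d.T} :
    IsOpen {p : c.plaque x | (p : Y) ∈ d.plaque x'} ↔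
      ∀ p ∈ c.plaque x, p ∈ d.plaque x' → ∀ᶠ q in 𝓝[c.plaque x] p, q ∈ d.plaque x' := by
  rw [isOpen_iff_eventually]
  simp only [mem_ofPred_eq, Subtype.forall]
  refine forall₃_congr fun p hp _ => ?_
  rw [nhdsWithin_eq_map_subtype_coe hp, eventually_map]

/-- Coherence passes through a chart with a plaque at every common point. -/
lemma coherent_of_middle
    (h : ∀ y ∈ c.dom ∩ d.dom, ∃ e : FoliationChart Y, y ∈ e.dom ∧ c.Coherent e ∧ d.Coherent e) :
    c.Coherent d := by
  have key : ∀ {c d e : FoliationChart Y} (_ : c.Coherent e) (_ : d.Coherent e) (x : c.T) (x' : d.T)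
      (p : Y), p ∈ e.dom → p ∈ c.plaque x → p ∈ d.plaque x' →
      ∀ᶠ q in 𝓝[c.plaque x] p, q ∈ d.plaque x' := by
    intro c d e hc hd x x' p he hp hp'
    -- Near `p`, the plaque of `c` stays in the plaque of `e` through `p`, and that one stays in the
    -- plaque of `d`.
    have hpe : p ∈ e.plaque (e.φ p).2 := ⟨he, rfl⟩
    have h1 := isOpen_plaque_inter_iff.1 (hc x (e.φ p).2).1 p hp hpe
    have h2 := isOpen_plaque_inter_iff.1 (hd x' (e.φ p).2).2 p hpe hp'
    rw [eventually_nhdsWithin_iff] at *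
    filter_upwards [h1, h2] with q q1 q2 hq
    exact q2 (q1 hq)
  intro x x'
  constructor
  · rw [isOpen_plaque_inter_iff]
    intro p hp hp'
    obtain ⟨e, h1, h2, h3⟩ := h p ⟨hp.1, hp'.1⟩
    exact key h2 h3 x x' p h1 hp hp'
  · rw [isOpen_plaque_inter_iff]
    intro p hp hp'
    obtain ⟨e, h1, h2, h3⟩ := h p ⟨hp'.1, hp.1⟩
    exact key h3 h2 x' x p h1 hp hp'

end FoliationChart

/-! ### The foliation of a flow and its local time functions -/

namespace FlowFoliation

variable {Y : Type u} [TopologicalSpace Y] {α : Flow ℝ Y}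

/-- Moving along a plaque of `c` near the common point changes its time `t` to a nearby `r`, because
tube time is continuous. In `d` the same point has a time `s` strictly inside the open interval, so
`s + (r - t)` is still admissible there. -/
lemma coherent_of_isTubeChart {c d : FoliationChart Y} (hc : IsTubeChart α c)
    (hd : IsTubeChart α d) : c.Coherent d := by
  have key : ∀ {c d : FoliationChart Y}, IsTubeChart α c → IsTubeChart α d →
      ∀ (x : c.T) (x' : d.T), ∀ p ∈ c.plaque x, p ∈ d.plaque x' →
        ∀ᶠ q in 𝓝[c.plaque x] p, q ∈ d.plaque x' := by
    intro c d ⟨S, l, hS, hl, hE, hdom, hp⟩ ⟨S', l', hS', hl', hE', hdom', hp'⟩ x x' p hx hx'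
    obtain ⟨z, hz, e⟩ := hp x
    obtain ⟨z', hz', e'⟩ := hp' x'
    rw [e] at hx
    rw [e'] at hx'
    obtain ⟨t, ht, rfl⟩ := hx
    obtain ⟨s, hs, hst⟩ := hx'
    obtain ⟨ε, hε, hb⟩ := Metric.isOpen_iff.1 isOpen_Ioo s hs
    rw [eventually_nhdsWithin_iff, e, e']
    filter_upwards [eventually_time_near hE hz (Ioo_subset_Icc_self ht) hε]
    rintro _ hq ⟨r, hr, rfl⟩
    have := hq z hz r (Ioo_subset_Icc_self hr) rfl
    refine ⟨r - t + s, hb ?_, ?_⟩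
    · rw [Metric.mem_ball, Real.dist_eq]; convert this using 2; ring
    · simp only at hst ⊢
      rw [α.map_add, hst, ← α.map_add, sub_add_cancel]
  intro x x'
  rw [FoliationChart.isOpen_plaque_inter_iff, FoliationChart.isOpen_plaque_inter_iff]
  exact ⟨key hc hd x x', key hd hc x' x⟩

variable [TopologicalSpace.MetrizableSpace Y] [LocallyCompactSpace Y]

variable (α) in
/-- The foliation given by the tubes of a flow without fixed points. -/
def flowFoliation (hα : ∀ y, ∃ t, α t y ≠ y) : LineFoliation Y where
  charts := {c | ∀ d, IsTubeChart α d → c.Coherent d}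
  cover y := by
    obtain ⟨c, h1, h2, -⟩ := exists_tubeChart α (hα y) univ_mem
    exact ⟨c, fun d hd => coherent_of_isTubeChart h1 hd, h2⟩
  -- Two charts that are coherent with all tube charts are compared through a tube chart around each
  -- common point.
  coherent c hc d hd := FoliationChart.coherent_of_middle fun y _ => by
    obtain ⟨e, h1, h2, -⟩ := exists_tubeChart α (hα y) univ_mem
    exact ⟨e, h2, hc e h1, hd e h1⟩
  maximal c hc d hd := hc d fun _ he => coherent_of_isTubeChart hd he

variable {hα : ∀ y, ∃ t, α t y ≠ y} {c d : FoliationChart Y}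

lemma exists_chart (hα : ∀ y, ∃ t, α t y ≠ y) (y : Y) {N : Set Y} (hN : N ∈ 𝓝 y) :
    ∃ c ∈ (flowFoliation α hα).charts, y ∈ c.dom ∧ c.dom ⊆ N ∧
      ∃ u : Y → ℝ, ContinuousOn u c.dom ∧
        (∀ z ∈ c.dom, ∀ w ∈ c.dom, (c.φ z).2 = (c.φ w).2 → α (u w - u z) z = w) ∧
        ∀ z ∈ c.dom, ∀ᶠ p : Y × ℝ in 𝓝 (z, 0), (c.φ (α p.2 p.1)).2 = (c.φ p.1).2 := by
  obtain ⟨c, h1, h2⟩ := exists_tubeChart α (hα y) hN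
  exact ⟨c, fun d hd => coherent_of_isTubeChart h1 hd, h2⟩

lemma eventually_trans_eq (hc : c ∈ (flowFoliation α hα).charts)
    (hd : d ∈ (flowFoliation α hα).charts) {y : Y} (hy : y ∈ c.dom) (hy' : y ∈ d.dom) :
    ∀ᶠ z in 𝓝 y, c.trans d y (c.φ z).2 = (d.φ z).2 := by
  have h := ((flowFoliation α hα).coherent c hc d hd).locally_const hy hy'
  filter_upwards [(c.φ.continuousAt hy).tendsto.eventually h, c.φ.open_source.mem_nhds hy]
    with z hz hz'
  rw [hz, c.φ.left_inv hz']

/-- The transverse coordinate is locally constant along the flow. -/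
lemma eventually_transverse_flow (hc : c ∈ (flowFoliation α hα).charts) {y : Y} (hy : y ∈ c.dom) :
    ∀ᶠ p : Y × ℝ in 𝓝 (y, 0), (c.φ (α p.2 p.1)).2 = (c.φ p.1).2 := by
  obtain ⟨e, he, hye, -, -, -, -, h⟩ := exists_chart hα y univ_mem
  have h1 := eventually_trans_eq he hc hye hy
  have hf : Tendsto (fun p : Y × ℝ => p.1) (𝓝 (y, 0)) (𝓝 y) := by
    rw [nhds_prod_eq]; exact tendsto_fst
  filter_upwards [h y hye, (tendsto_flow_zero α y).eventually h1, hf.eventually h1] with p p1 p2 p3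
  rw [← p2, ← p3, p1]

/-- Nearby points with the same transverse coordinate are related by a small time of the flow, which
depends continuously on them. -/
lemma exists_local_time (hc : c ∈ (flowFoliation α hα).charts) {y : Y} (hy : y ∈ c.dom) :
    ∃ W ∈ 𝓝 y, ∃ u : Y → ℝ, ContinuousOn u W ∧
      ∀ z ∈ W, ∀ w ∈ W, (c.φ z).2 = (c.φ w).2 → α (u w - u z) z = w := by
  obtain ⟨e, he, hye, -, u, hu, hu', -⟩ := exists_chart hα y univ_mem
  refine ⟨_, inter_mem (eventually_trans_eq hc he hy hye) (e.φ.open_source.mem_nhds hye), u,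
    hu.mono inter_subset_right, ?_⟩
  rintro z ⟨hz, hz'⟩ w ⟨hw, hw'⟩ h
  simp only [mem_ofPred_eq] at hz hw
  exact hu' z hz' w hw' (by rw [← hz, ← hw, h])

/-- The connecting time `u w - u z` is continuous and vanishes at `(y, y)`. This converts equality
of transverse coordinates into a short flow time. -/
lemma eventually_small_time (hc : c ∈ (flowFoliation α hα).charts) {y : Y} (hy : y ∈ c.dom)
    {ε : ℝ} (hε : 0 < ε) :
    ∀ᶠ p : Y × Y in 𝓝 (y, y), (c.φ p.1).2 = (c.φ p.2).2 → ∃ s, |s| < ε ∧ α s p.1 = p.2 := by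
  obtain ⟨W, hW, u, hu, h⟩ := exists_local_time hc hy
  have hu' := (hu.continuousAt hW).tendsto
  have h1 : Tendsto (fun p : Y × Y => |u p.2 - u p.1|) (𝓝 (y, y)) (𝓝 |u y - u y|) := by
    rw [nhds_prod_eq]
    exact ((hu'.comp tendsto_snd).sub (hu'.comp tendsto_fst)).abs
  have h2 : ∀ᶠ p : Y × Y in 𝓝 (y, y), p.1 ∈ W ∧ p.2 ∈ W := by
    rw [nhds_prod_eq]; exact prod_mem_prod hW hW
  filter_upwards [h1.eventually_lt_const (by simpa), h2] with p p1 p2 p3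
  exact ⟨_, p1, h _ p2.1 _ p2.2 p3⟩

end FlowFoliation

/-! ### Leafwise paths as reparametrized orbits, and their holonomy -/

/-- A transitive relation between the points of a compact interval that holds locally holds between
the end points. -/
lemma Icc_chain {R : ℝ → ℝ → Prop} {s t : ℝ} (hst : s ≤ t)
    (trans : ∀ a b c, a ≤ b → b ≤ c → R a b → R b c → R a c)
    (local_rel : ∀ r ∈ Icc s t, ∃ ε > 0, ∀ a b, a ≤ b → a ∈ Metric.ball r ε → b ∈ Metric.ball r ε →
      a ∈ Icc s t → b ∈ Icc s t → R a b) : R s t := by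
  choose! ε hε h using local_rel
  obtain ⟨x, h0, hm, ⟨m, hx⟩, hc⟩ := exists_monotone_Icc_subset_open_cover_Icc hst
    (c := fun r : Icc s t => Subtype.val ⁻¹' Metric.ball (r : ℝ) (ε r))
    (fun r => Metric.isOpen_ball.preimage continuous_subtype_val)
    (fun r _ => mem_iUnion.2 ⟨r, Metric.mem_ball_self (hε r r.2)⟩)
  have step : ∀ n, R (x n) (x (n + 1)) := fun n => by
    obtain ⟨i, hi⟩ := hc n
    have hn : x n ≤ x (n + 1) := hm n.le_succ
    exact h i i.2 _ _ hn (hi (left_mem_Icc.2 hn)) (hi (right_mem_Icc.2 hn)) (x n).2 (x (n + 1)).2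
  have key : ∀ n, R (x 0) (x (n + 1)) := by
    intro n
    induction n with
    | zero => exact step 0
    | succ n ih => exact trans _ _ _ (hm (Nat.zero_le _)) (hm (Nat.le_succ _)) ih (step _)
  have := key m
  rwa [h0, hx (m + 1) m.le_succ] at this

namespace FlowFoliation

variable {Y : Type u} [TopologicalSpace Y] {α : Flow ℝ Y}
lemma lift_trans {g : ℝ → Y} {a b c : ℝ} (hab : a ≤ b) (_ : b ≤ c)
    (h1 : ∃ θ : ℝ → ℝ, Continuous θ ∧ θ a = 0 ∧ ∀ r ∈ Icc a b, g r = α (θ r) (g a))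
    (h2 : ∃ θ : ℝ → ℝ, Continuous θ ∧ θ b = 0 ∧ ∀ r ∈ Icc b c, g r = α (θ r) (g b)) :
    ∃ θ : ℝ → ℝ, Continuous θ ∧ θ a = 0 ∧ ∀ r ∈ Icc a c, g r = α (θ r) (g a) := by
  obtain ⟨θ, hθ, hθa, h⟩ := h1
  obtain ⟨η, hη, hηb, k⟩ := h2
  -- `min` and `max` freeze each lift outside its own interval, so the sum is continuous without any
  -- gluing.
  refine ⟨fun r => η (max r b) + θ (min r b), by fun_prop, by simp [hab, hθa, hηb], fun r hr => ?_⟩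
  simp only
  rcases le_total r b with hrb | hbr
  · rw [max_eq_right hrb, min_eq_left hrb, hηb, zero_add]
    exact h r ⟨hr.1, hrb⟩
  · rw [max_eq_left hbr, min_eq_right hbr, α.map_add, ← h b (right_mem_Icc.2 hab)]
    exact k r ⟨hbr, hr.2⟩

variable [TopologicalSpace.MetrizableSpace Y] [LocallyCompactSpace Y]
variable {hα : ∀ y, ∃ t, α t y ≠ y} {c d : FoliationChart Y}

/-- Locally the lift is the increment of the local time function along `g`; compactness of the
interval reduces to this case. -/
lemma exists_lift_of_plaque (hd : d ∈ (flowFoliation α hα).charts) {g : ℝ → Y} (hg : Continuous g)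
    {s t : ℝ} (hst : s ≤ t) {x : d.T} (hx : ∀ r ∈ Icc s t, g r ∈ d.plaque x) :
    ∃ θ : ℝ → ℝ, Continuous θ ∧ θ s = 0 ∧ ∀ r ∈ Icc s t, g r = α (θ r) (g s) := by
  refine Icc_chain (R := fun a b => ∃ θ : ℝ → ℝ, Continuous θ ∧ θ a = 0 ∧
    ∀ r ∈ Icc a b, g r = α (θ r) (g a)) hst (fun a b c => lift_trans) fun r hr => ?_
  obtain ⟨W, hW, u, hu, h⟩ := exists_local_time hd (hx r hr).1
  obtain ⟨ε, hε, hb⟩ := Metric.mem_nhds_iff.1 (hg.continuousAt hW)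
  refine ⟨ε, hε, fun a b hab ha hb' ha' hb'' => ?_⟩
  -- The time function is controlled only on `W`, so the parameter is projected onto `[a, b]` to
  -- obtain a lift that is continuous on all of `ℝ`.
  have hm : ∀ r', max a (min r' b) ∈ Icc a b := fun r' =>
    ⟨le_max_left _ _, max_le hab (min_le_right _ _)⟩
  have hball : Icc a b ⊆ Metric.ball r ε := by
    rw [Real.ball_eq_Ioo] at *
    exact fun q hq => ⟨ha.1.trans_le hq.1, hq.2.trans_lt hb'.2⟩
  refine ⟨fun r' => u (g (max a (min r' b))) - u (g a), ?_, ?_, fun q hq => ?_⟩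
  · refine Continuous.sub ?_ continuous_const
    exact hu.comp_continuous (by fun_prop) fun r' => hb (hball (hm r'))
  · simp [hab]
  · simp only [min_eq_left hq.2, max_eq_right hq.1]
    refine (h _ (hb ha) _ (hb (hball hq)) ?_).symm
    rw [(hx a ha').2, (hx q ⟨ha'.1.trans hq.1, hq.2.trans hb''.2⟩).2]

lemma exists_lift_of_chain {g : ℝ → Y} (hg : Continuous g) {a b : ℝ} {H : c.T → d.T}
    (h : (flowFoliation α hα).HolChain g a c b d H) :
    ∃ θ : ℝ → ℝ, Continuous θ ∧ θ a = 0 ∧ ∀ r ∈ Icc a b, g r = α (θ r) (g a) := by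
  induction h with
  | start hc ha =>
    refine ⟨fun _ => 0, continuous_const, rfl, fun r hr => ?_⟩
    rw [le_antisymm hr.2 hr.1]; simp
  | step h hst hd he ht ih =>
    obtain ⟨x, hx⟩ := hd
    exact lift_trans h.le hst ih (exists_lift_of_plaque h.mem.1 hg hst hx)

/-- The germ of the transverse coordinate does not change along the flow inside a chart. -/
lemma eventually_transverse_of_path (hd : d ∈ (flowFoliation α hα).charts) {y : Y} {θ : ℝ → ℝ}
    (hθ : Continuous θ) {s t : ℝ} (hst : s ≤ t)
    (h : ∀ r ∈ Icc s t, α (θ r - θ s) y ∈ d.dom) :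
    ∀ᶠ z in 𝓝 y, (d.φ (α (θ t - θ s) z)).2 = (d.φ z).2 := by
  -- The germ at `y` is locally constant in the parameter, because short flow times preserve
  -- transverse coordinates, and the parameter interval is connected.
  let f : Icc s t → Germ (𝓝 y) d.T := fun r =>
    ((fun z => (d.φ (α (θ r - θ s) z)).2 : Y → d.T) : Germ (𝓝 y) d.T)
  have hf : IsLocallyConstant f := by
    rw [IsLocallyConstant.iff_eventually_eq]
    intro r
    have h1 := eventually_transverse_flow hd (h r r.2)
    rw [nhds_prod_eq, eventually_swap_iff] at h1
    have h2 := h1.curry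
    have h3 : Tendsto (fun r' : Icc s t => θ r' - θ r) (𝓝 r) (𝓝 0) := by
      have : Continuous fun r' : Icc s t => θ r' - θ r := by fun_prop
      simpa using this.tendsto r
    filter_upwards [h3.eventually h2] with r' hr'
    refine Germ.coe_eq.2 ?_
    have h4 : Tendsto (fun z => α (θ r - θ s) z) (𝓝 y) (𝓝 (α (θ r - θ s) y)) :=
      (α.continuous continuous_const continuous_id).tendsto y
    filter_upwards [h4.eventually hr'] with z hz
    simp only [Prod.swap_prod_mk] at hz
    rwa [← α.map_add, sub_add_sub_cancel] at hz
  have : PreconnectedSpace (Icc s t) :=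
    isPreconnected_iff_preconnectedSpace.1 isPreconnected_Icc
  have := Germ.coe_eq.1
    (hf.apply_eq_of_preconnectedSpace ⟨t, right_mem_Icc.2 hst⟩ ⟨s, left_mem_Icc.2 hst⟩)
  filter_upwards [this] with z hz
  simpa using hz

/-- In coordinates, holonomy is the flow map for the total elapsed time: movement inside one chart
does not change the transverse coordinate, and a change of chart composes with the transition germ.
Hence only the final value of the lift matters. -/
lemma chain_germ {g : ℝ → Y} {a b : ℝ} {H : c.T → d.T}
    (h : (flowFoliation α hα).HolChain g a c b d H) {θ : ℝ → ℝ} (hθ : Continuous θ) (ha : θ a = 0)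
    (hg : ∀ r ∈ Icc a b, g r = α (θ r) (g a)) :
    ∀ᶠ z in 𝓝 (g a), H (c.φ z).2 = (d.φ (α (θ b) z)).2 := by
  induction h with
  | start => simp [ha]
  | @step s t d e H h hst hd he ht ih =>
    obtain ⟨x, hx⟩ := hd
    have has := h.le
    have hs := hg s ⟨has, hst⟩
    have hT : Tendsto (fun z => α (θ s) z) (𝓝 (g a)) (𝓝 (g s)) := by
      rw [hs]; exact (α.continuous continuous_const continuous_id).tendsto _
    have hT' : Tendsto (fun z => α (θ t) z) (𝓝 (g a)) (𝓝 (g t)) := by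
      rw [hg t ⟨has.trans hst, le_rfl⟩]
      exact (α.continuous continuous_const continuous_id).tendsto _
    have h1 := eventually_transverse_of_path h.mem.1 (y := g s) hθ hst fun r hr => by
      rw [hs, ← α.map_add, sub_add_cancel, ← hg r ⟨has.trans hr.1, hr.2⟩]
      exact (hx r hr).1
    have h2 := eventually_trans_eq h.mem.1 he (hx t (right_mem_Icc.2 hst)).1 ht
    filter_upwards [ih fun r hr => hg r ⟨hr.1, hr.2.trans hst⟩, hT.eventually h1,
      hT'.eventually h2] with z h3 h4 h5
    rw [← α.map_add, sub_add_cancel] at h4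
    rw [Function.comp_apply, h3, ← h4, h5]

/-- Conversely, a continuously reparametrized orbit is leafwise: on a short parameter interval it
stays in one plaque, and short pieces are chained by `Icc_chain`. -/
lemma exists_chain {g : ℝ → Y} {θ : ℝ → ℝ} (hθ : Continuous θ) {y : Y} {a b : ℝ}
    (hg : ∀ r ∈ Icc a b, g r = α (θ r) y) (hab : a ≤ b)
    (hc : c ∈ (flowFoliation α hα).charts) (hca : g a ∈ c.dom) :
    ∃ d H, (flowFoliation α hα).HolChain g a c b d H := by
  have := Icc_chain (R := fun a b => ∀ c ∈ (flowFoliation α hα).charts, g a ∈ c.dom →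
    ∃ d H, (flowFoliation α hα).HolChain g a c b d H) hab ?_ ?_
  · exact this c hc hca
  · intro a b e _ _ h k c hc hca
    obtain ⟨d, H, h⟩ := h c hc hca
    obtain ⟨e, K, k⟩ := k d h.mem.1 h.mem.2
    exact ⟨e, _, h.comp k⟩
  · intro r hr
    obtain ⟨d, hd, hdr, -⟩ := exists_chart hα (α (θ r) y) univ_mem
    have h1 := eventually_transverse_flow hd hdr
    have h2 : ∀ᶠ r' in 𝓝 r, (d.φ (α (θ r') y)).2 = (d.φ (α (θ r) y)).2 := by
      have : Tendsto (fun r' => (α (θ r) y, θ r' - θ r)) (𝓝 r) (𝓝 (α (θ r) y, 0)) := by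
        have : Continuous fun r' => (α (θ r) y, θ r' - θ r) := by fun_prop
        simpa using this.tendsto r
      filter_upwards [this.eventually h1] with r' h
      simpa [← α.map_add] using h
    have h3 : ∀ᶠ r' in 𝓝 r, α (θ r') y ∈ d.dom :=
      (α.continuous hθ continuous_const).continuousAt.eventually (d.φ.open_source.mem_nhds hdr)
    obtain ⟨ε, hε, h4⟩ := Metric.mem_nhds_iff.1 (h2.and h3)
    refine ⟨ε, hε, fun a' b' hab' ha hb ha' hb' c hc hca => ?_⟩
    have hball : ∀ q ∈ Icc a' b', g q ∈ d.plaque (d.φ (α (θ r) y)).2 := fun q hq => by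
      have hq' : q ∈ Metric.ball r ε := by
        rw [Real.ball_eq_Ioo] at *
        exact ⟨ha.1.trans_le hq.1, hq.2.trans_lt hb.2⟩
      have := h4 hq'
      rw [hg q ⟨ha'.1.trans hq.1, hq.2.trans hb'.2⟩]
      exact ⟨this.2, this.1⟩
    -- A step over a degenerate interval switches from the given chart `c` to `d` before moving
    -- inside the plaque of `d`.
    exact ⟨d, _, ((LineFoliation.HolChain.start hc hca).step le_rfl ⟨(c.φ (g a')).2, fun q hq => by
      obtain rfl := le_antisymm hq.2 hq.1
      exact ⟨hca, rfl⟩⟩ hd (hball a' (left_mem_Icc.2 hab')).1).step hab' ⟨_, hball⟩ hd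
        (hball b' (right_mem_Icc.2 hab')).1⟩

/-- The path `p` is obtained by moving for the time `θ s` along the flow. -/
def IsLift (p : (flowFoliation α hα).LeafPath) (θ : ℝ → ℝ) : Prop :=
  Continuous θ ∧ θ 0 = 0 ∧ ∀ r ∈ Icc (0 : ℝ) 1, p.path.extend r = α (θ r) p.start

lemma exists_isLift (p : (flowFoliation α hα).LeafPath) : ∃ θ, IsLift p θ := by
  obtain ⟨c, d, H, h⟩ := p.leafwise
  obtain ⟨θ, h1, h2, h3⟩ := exists_lift_of_chain p.path.extend.continuous h
  exact ⟨θ, h1, h2, by simpa using h3⟩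

variable (hα) in
/-- The path `s ↦ α (θ s) y`. -/
def orbitPath (y : Y) (θ : ℝ → ℝ) (hθ : Continuous θ) (h0 : θ 0 = 0) :
    (flowFoliation α hα).LeafPath where
  start := y
  finish := α (θ 1) y
  path :=
    { toFun := fun s => α (θ s) y
      continuous_toFun := α.continuous (by fun_prop) continuous_const
      source' := by simp [h0]
      target' := by simp }
  leafwise := by
    obtain ⟨c, hc, hy⟩ := (flowFoliation α hα).cover y
    obtain ⟨d, H, h⟩ := exists_chain (hα := hα) hθ (y := y) (a := 0) (b := 1) (c := c)
      (g := Path.extend ⟨⟨fun s : unitInterval => α (θ s) y, _⟩, _, _⟩)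
      (fun r hr => Path.extend_apply _ hr) zero_le_one hc (by simpa [h0] using hy)
    exact ⟨c, d, H, h⟩

lemma isLift_orbitPath {y : Y} {θ : ℝ → ℝ} {hθ : Continuous θ} {h0 : θ 0 = 0} :
    IsLift (orbitPath hα y θ hθ h0) θ :=
  ⟨hθ, h0, fun _ hr => Path.extend_apply _ hr⟩

variable {p q : (flowFoliation α hα).LeafPath} {θ η : ℝ → ℝ}

lemma IsLift.finish (h : IsLift p θ) : p.finish = α (θ 1) p.start := by
  simpa using h.2.2 1 (right_mem_Icc.2 zero_le_one)

lemma IsLift.germ (h : IsLift p θ) {H : c.T → d.T} (hH : p.IsHolonomy c d H) :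
    ∀ᶠ z in 𝓝 p.start, H (c.φ z).2 = (d.φ (α (θ 1) z)).2 := by
  have := chain_germ hH h.1 h.2.1 (by simpa using h.2.2)
  simpa using this

/-- The flow times `s` and `t` have the same end point and the same holonomy germ at `y`. -/
def HolRel (hα : ∀ y, ∃ t, α t y ≠ y) (y : Y) (s t : ℝ) : Prop :=
  α s y = α t y ∧ ∃ d ∈ (flowFoliation α hα).charts, α s y ∈ d.dom ∧
    ∀ᶠ z in 𝓝 y, (d.φ (α s z)).2 = (d.φ (α t z)).2

/-- Transition germs show that the relation does not depend on the chart used to test it. -/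
lemma HolRel.eventually {y : Y} {s t : ℝ} (h : HolRel hα y s t)
    (hc : c ∈ (flowFoliation α hα).charts) (hy : α s y ∈ c.dom) :
    ∀ᶠ z in 𝓝 y, (c.φ (α s z)).2 = (c.φ (α t z)).2 := by
  obtain ⟨e, d, hd, hyd, h⟩ := h
  have h1 := eventually_trans_eq hd hc hyd hy
  have hs : Tendsto (fun z => α s z) (𝓝 y) (𝓝 (α s y)) :=
    (α.continuous continuous_const continuous_id).tendsto y
  have ht : Tendsto (fun z => α t z) (𝓝 y) (𝓝 (α s y)) := by
    rw [e]; exact (α.continuous continuous_const continuous_id).tendsto y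
  filter_upwards [h, hs.eventually h1, ht.eventually h1] with z z1 z2 z3
  rw [← z2, ← z3, z1]

lemma HolRel.refl (hα : ∀ y, ∃ t, α t y ≠ y) (y : Y) (s : ℝ) : HolRel hα y s s := by
  obtain ⟨c, hc, hy⟩ := (flowFoliation α hα).cover (α s y)
  exact ⟨rfl, c, hc, hy, .of_forall fun _ => rfl⟩

/-- By `IsLift.germ` both holonomies are flow maps in transverse coordinates. Equality of germs on
the transversal passes to `Y` through the coordinate map, and back through a local section of it. -/
lemma IsLift.holEq_iff (hp : IsLift p θ) (hq : IsLift q η) :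
    p.HolEq q ↔ p.start = q.start ∧ HolRel hα p.start (θ 1) (η 1) := by
  have hf := hp.finish
  have hf' := hq.finish
  obtain ⟨c, hc, hpc⟩ := (flowFoliation α hα).cover p.start
  obtain ⟨d, hd, hpd⟩ := (flowFoliation α hα).cover p.finish
  have hT : Tendsto (fun z => (c.φ z).2) (𝓝 p.start) (𝓝 (c.base p.start)) :=
    (c.φ.continuousAt hpc).snd
  constructor
  · intro h
    obtain ⟨H, hH⟩ := p.exists_isHolonomy hc hd hpc hpd
    obtain ⟨K, hK⟩ := q.exists_isHolonomy hc hd (h.1 ▸ hpc) (h.2.1 ▸ hpd)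
    have g1 := hp.germ hH
    have g2 := hq.germ hK
    rw [← h.1] at g2 hf'
    refine ⟨h.1, by rw [← hf, ← hf', h.2.1], d, hd, hf ▸ hpd, ?_⟩
    filter_upwards [g1, g2, hT.eventually (h.2.2 c d H K hH hK)] with z z1 z2 z3
    rw [← z1, ← z2, z3]
  · rintro ⟨hs, hr⟩
    have hfin : p.finish = q.finish := by rw [hf, hf', ← hs, hr.1]
    obtain ⟨H, hH⟩ := p.exists_isHolonomy hc hd hpc hpd
    obtain ⟨K, hK⟩ := q.exists_isHolonomy hc hd (hs ▸ hpc) (hfin ▸ hpd)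
    have g1 := hp.germ hH
    have g2 := hq.germ hK
    rw [← hs] at g2
    have g3 := hr.eventually hd (hf ▸ hpd)
    refine hH.holEq hK hs hfin ?_
    -- The local section of the transverse coordinate that passes through the starting point.
    have hS : Tendsto (fun x => c.φ.symm ((c.φ p.start).1, x)) (𝓝 (c.base p.start))
        (𝓝 p.start) := by
      have h0 : c.φ.symm ((c.φ p.start).1, c.base p.start) = p.start := c.φ.left_inv hpc
      have := (c.continuous_symm.comp (Continuous.prodMk_right (c.φ p.start).1)).tendsto
        (c.base p.start)
      simpa [h0, Function.comp_def] using this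
    filter_upwards [hS.eventually g1, hS.eventually g2, hS.eventually g3] with x x1 x2 x3
    rw [c.φ_symm] at x1 x2
    simp only at x1 x2
    rw [x1, x2, x3]

/-- The class of the path `s ↦ α (-ts) y`. -/
def canonicalMap (hα : ∀ y, ∃ t, α t y ≠ y) (x : Y × ℝ) : (flowFoliation α hα).Holonomy :=
  .mk (orbitPath hα x.1 (fun s => -(x.2 * s)) (by fun_prop) (by simp))

lemma mk_eq_mk_iff : LineFoliation.Holonomy.mk p = .mk q ↔ p.HolEq q := Quotient.eq

lemma mk_eq_canonicalMap_iff (hp : IsLift p θ) {x : Y × ℝ} :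
    LineFoliation.Holonomy.mk p = canonicalMap hα x ↔
      p.start = x.1 ∧ HolRel hα x.1 (θ 1) (-x.2) := by
  rw [canonicalMap, mk_eq_mk_iff, hp.holEq_iff isLift_orbitPath]
  simp only [mul_one]
  exact and_congr_right fun h => by rw [h]; rfl

lemma canonicalMap_eq_iff {x x' : Y × ℝ} :
    canonicalMap hα x = canonicalMap hα x' ↔ x.1 = x'.1 ∧ HolRel hα x.1 (-x.2) (-x'.2) := by
  rw [canonicalMap, mk_eq_canonicalMap_iff isLift_orbitPath]
  simp only [mul_one]
  exact and_congr_right fun h : x.1 = x'.1 => by rw [h]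

lemma isCanonicalMap : IsCanonicalMap α (flowFoliation α hα) (canonicalMap hα) :=
  fun _ _ => ⟨_, fun _ => rfl, rfl⟩

lemma canonicalMap_surjective : Function.Surjective (canonicalMap hα) := by
  intro a
  induction a using Quotient.ind with | _ p
  obtain ⟨θ, h⟩ := exists_isLift p
  -- The sign appears because the canonical path of `(y, t)` runs for flow time `-t`.
  refine ⟨(p.start, -θ 1), ((mk_eq_canonicalMap_iff h).2 ⟨rfl, ?_⟩).symm⟩
  rw [neg_neg]
  exact HolRel.refl _ _ _

end FlowFoliation

/-! ### The canonical map is a local homeomorphism -/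

lemma eventually_forall_abs_lt {Y : Type*} [TopologicalSpace Y] {y : Y} {P : Y → ℝ → Prop}
    (h : ∀ᶠ q : Y × ℝ in 𝓝 (y, 0), P q.1 q.2) :
    ∃ ε > 0, ∀ᶠ z in 𝓝 y, ∀ δ, |δ| < ε → P z δ := by
  rw [nhds_prod_eq] at h
  obtain ⟨V, hV, A, hA, hVA⟩ := Filter.mem_prod_iff.1 h
  obtain ⟨ε, hε, hb⟩ := Metric.mem_nhds_iff.1 hA
  refine ⟨ε, hε, ?_⟩
  filter_upwards [hV] with z hz δ hδ
  exact hVA (mk_mem_prod hz (hb (by simpa using hδ)) : (z, δ) ∈ V ×ˢ A)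

/-- Turns a property that holds near one point into germ statements at all nearby base points, as
needed when the starting point of a path varies. -/
lemma eventually_slice {Y Z : Type*} [TopologicalSpace Y] [TopologicalSpace Z] {q : Y × Z}
    {P : Y → Z → Prop} (h : ∀ᶠ q in 𝓝 q, P q.1 q.2) :
    ∀ᶠ q in 𝓝 q, ∀ᶠ z in 𝓝 q.1, P z q.2 := by
  filter_upwards [h.eventually_nhds] with q hq
  have : Tendsto (fun z => (z, q.2)) (𝓝 q.1) (𝓝 (q.1, q.2)) :=
    (Continuous.prodMk_left q.2).tendsto q.1
  exact this.eventually hq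

namespace FlowFoliation

variable {Y : Type u} [TopologicalSpace Y] {α : Flow ℝ Y}
variable [TopologicalSpace.MetrizableSpace Y] [LocallyCompactSpace Y]
variable {hα : ∀ y, ∃ t, α t y ≠ y}

/-- A subbasic set containing the class of `(y, τ)` contains it through some representative with
lift `θ`, which need not be the canonical path: `θ 1` may differ from `-τ` by a loop without
holonomy. For nearby data `x`, the path from `x.1` with lift `s ↦ θ s + s * δ` and a small `δ`
follows the same charts, and `δ` is chosen so that it ends at the right point with the right germ.
-/
lemma continuous_canonicalMap : Continuous (canonicalMap hα) := by
  rw [continuous_generateFrom_iff]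
  rintro _ ⟨n, U, t, hU, ht, ht0, ht1, rfl⟩
  rw [isOpen_iff_mem_nhds]
  rintro ⟨y, τ⟩ ⟨p, hp, hpU⟩
  obtain ⟨θ, hθ⟩ := exists_isLift p
  obtain ⟨hs, hr⟩ := (mk_eq_canonicalMap_iff hθ).1 hp
  simp only at hs hr
  obtain ⟨hw, d, hd, hyd, hg⟩ := hr
  have ht' : ∀ i : Fin (n + 1), Icc (t i.castSucc) (t i.succ) ⊆ Icc 0 1 := fun i =>
    Icc_subset_Icc (ht0 ▸ ht.monotone (Fin.zero_le _)) (ht1 ▸ ht.monotone (Fin.le_last _))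
  have hθc := hθ.1
  have h1 : ∀ᶠ q : Y × ℝ in 𝓝 (y, 0), ∀ i : Fin (n + 1), ∀ s ∈ Icc (t i.castSucc) (t i.succ),
      α (θ s + s * q.2) q.1 ∈ (U i).dom := by
    rw [eventually_all]
    intro i
    refine isCompact_Icc.eventually_forall_of_forall_eventually fun s hs' => ?_
    have hc : Continuous fun z : (Y × ℝ) × ℝ => α (θ z.2 + z.2 * z.1.2) z.1.1 :=
      α.continuous (by fun_prop) (by fun_prop)
    refine (hc.tendsto ((y, 0), s)).eventually ((U i).φ.open_source.mem_nhds ?_)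
    have := hpU i s hs'
    rw [hθ.2.2 s (ht' i hs'), hs] at this
    simpa [FoliationChart.dom] using this
  have hT : ∀ s, Tendsto (fun z => α s z) (𝓝 y) (𝓝 (α s y)) := fun s =>
    (α.continuous continuous_const continuous_id).tendsto y
  have h2 : ∀ᶠ q : Y × ℝ in 𝓝 (y, 0), ∀ᶠ z in 𝓝 q.1,
      (d.φ (α (θ 1 + q.2) z)).2 = (d.φ (α (θ 1) z)).2 := by
    have h := eventually_transverse_flow hd hyd
    have hc : Continuous fun q : Y × ℝ => (α (θ 1) q.1, q.2) :=
      (α.continuous continuous_const continuous_fst).prodMk continuous_snd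
    have h' := (hc.tendsto (y, 0)).eventually h
    refine eventually_slice (P := fun z s => (d.φ (α (θ 1 + s) z)).2 = (d.φ (α (θ 1) z)).2) ?_
    filter_upwards [h'] with q hq
    rwa [← α.map_add, add_comm] at hq
  obtain ⟨ε, hε, h3⟩ := eventually_forall_abs_lt
    (P := fun y' δ => (∀ i : Fin (n + 1), ∀ s ∈ Icc (t i.castSucc) (t i.succ),
      α (θ s + s * δ) y' ∈ (U i).dom) ∧
      ∀ᶠ z in 𝓝 y', (d.φ (α (θ 1 + δ) z)).2 = (d.φ (α (θ 1) z)).2) (h1.and h2)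
  have h4 : ∀ᶠ x : Y × ℝ in 𝓝 (y, τ), ∀ᶠ z in 𝓝 x.1,
      (d.φ (α (-x.2) z)).2 = (d.φ (α (-τ) z)).2 := by
    have h := eventually_transverse_flow hd hyd
    have hc : Continuous fun q : Y × ℝ => (α (-τ) q.1, τ - q.2) :=
      (α.continuous continuous_const continuous_fst).prodMk (by fun_prop)
    have h' := (hc.tendsto (y, τ)).eventually (by simpa [hw] using h)
    refine eventually_slice (P := fun z s => (d.φ (α (-s) z)).2 = (d.φ (α (-τ) z)).2) ?_
    filter_upwards [h'] with q hq
    rwa [← α.map_add, show τ - q.2 + -τ = -q.2 by ring] at hq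
  have h5 : ∀ᶠ x : Y × ℝ in 𝓝 (y, τ), (d.φ (α (θ 1) x.1)).2 = (d.φ (α (-x.2) x.1)).2 →
      ∃ s, |s| < ε ∧ α s (α (θ 1) x.1) = α (-x.2) x.1 := by
    have hc : Continuous fun x : Y × ℝ => (α (θ 1) x.1, α (-x.2) x.1) :=
      (α.continuous continuous_const continuous_fst).prodMk
        (α.continuous (by fun_prop) continuous_fst)
    have := hc.tendsto (y, τ)
    simp only [← hw] at this
    exact this.eventually (eventually_small_time hd hyd hε)
  have h6 : ∀ᶠ x : Y × ℝ in 𝓝 (y, τ), α (-x.2) x.1 ∈ d.dom := by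
    have hc : Continuous fun x : Y × ℝ => α (-x.2) x.1 :=
      α.continuous (by fun_prop) continuous_fst
    exact (hc.tendsto (y, τ)).eventually (d.φ.open_source.mem_nhds (by rw [← hw]; exact hyd))
  have hfst : Tendsto (Prod.fst : Y × ℝ → Y) (𝓝 (y, τ)) (𝓝 y) := continuous_fst.tendsto _
  filter_upwards [hfst.eventually h3, hfst.eventually hg.eventually_nhds, h4, h5, h6]
    with x x3 xg x4 x5 x6
  -- Evaluated at the base point, the germ identities say that both end points have the same
  -- transverse coordinate, so a short flow time `δ` joins them.
  obtain ⟨δ, hδ, hδ'⟩ := x5 (by rw [x4.self_of_nhds, xg.self_of_nhds])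
  rw [← α.map_add, add_comm] at hδ'
  obtain ⟨y1, y2⟩ := x3 δ hδ
  have hl : IsLift (orbitPath hα x.1 (fun s => θ s + s * δ) (by fun_prop)
    (by simp [hθ.2.1])) _ := isLift_orbitPath
  refine ⟨_, (mk_eq_canonicalMap_iff hl).2 ⟨rfl, ?_⟩, fun i s hs => ?_⟩
  · simp only [one_mul]
    refine ⟨hδ', d, hd, by rwa [hδ'], ?_⟩
    filter_upwards [y2, xg, x4] with z z1 z2 z3
    rw [z1, z2, z3]
  · rw [hl.2.2 s (ht' i hs)]
    exact y1 i s hs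

/-- The canonical path of `(y, τ)` is covered by a chain of small charts. A path `q` through the
same chain has a lift `θ` and stays `η`-close to the reference path. Its deviation `θ r + τ * r`
starts at `0` and cannot reach `±ε`, because flowing for time `±ε` moves points away by more than
`η`. So `-θ 1` is close to `τ`, and the class of `q` is the image of the nearby point `(q.start, -θ
1)`. -/
lemma isOpenMap_canonicalMap : IsOpenMap (canonicalMap hα) := by
  let _ := TopologicalSpace.metrizableSpaceMetric Y
  rw [isOpenMap_iff_nhds_le]
  rintro ⟨y, τ⟩ W hW
  rw [mem_map, nhds_prod_eq] at hW
  obtain ⟨N, hN, A, hA, hNA⟩ := Filter.mem_prod_iff.1 hW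
  obtain ⟨ε₁, hε₁, hb⟩ := Metric.mem_nhds_iff.1 hA
  obtain ⟨ε₂, hε₂, hper⟩ := no_small_periods α (hα y)
  have hper := hper.self_of_nhds
  obtain ⟨ε, hε, hεε⟩ : ∃ ε, 0 < ε ∧ ε < ε₁ ∧ ε ≤ ε₂ :=
    ⟨min (ε₁ / 2) ε₂, lt_min (by positivity) hε₂, (min_le_left _ _).trans_lt (by linarith),
      min_le_right _ _⟩
  -- `ε` is at most the bound on small periods at `y`, and periods are constant along the orbit, so
  -- time `±ε` moves every point of the reference path.
  have hne : ∀ e, |e| = ε → ∀ r, 0 < dist (α e (α (-(τ * r)) y)) (α (-(τ * r)) y) := by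
    intro e he r
    rw [dist_pos]
    intro h
    rw [← α.map_add, add_comm, α.map_add] at h
    have h' := congrArg (α (τ * r)) h
    simp only [← α.map_add, add_neg_cancel, add_neg_cancel_left, α.map_zero_apply] at h'
    have := hper e (he.trans_le hεε.2) h'
    rw [this, abs_zero] at he
    exact hε.ne he
  -- The real coordinate of `q` is a candidate lower bound for the distances; starting from the
  -- bound `0` at `y`, this yields a positive bound and a neighbourhood of `y` together.
  have hev : ∀ e, |e| = ε → ∀ᶠ q : Y × ℝ in 𝓝 (y, 0), ∀ r ∈ Icc (0 : ℝ) 1,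
      q.2 < dist (α e (α (-(τ * r)) q.1)) (α (-(τ * r)) y) := by
    intro e he
    refine isCompact_Icc.eventually_forall_of_forall_eventually fun r _ => ?_
    have c1 : Continuous fun z : (Y × ℝ) × ℝ =>
        dist (α e (α (-(τ * z.2)) z.1.1)) (α (-(τ * z.2)) y) :=
      (α.continuous continuous_const (α.continuous (by fun_prop) (by fun_prop))).dist
        (α.continuous (by fun_prop) continuous_const)
    exact (continuous_fst.snd.tendsto ((y, (0 : ℝ)), r)).eventually_lt (c1.tendsto _) (hne e he r)
  obtain ⟨η', hη', hev'⟩ := eventually_forall_abs_lt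
    (P := fun y' η => (∀ r ∈ Icc (0 : ℝ) 1, η < dist (α ε (α (-(τ * r)) y')) (α (-(τ * r)) y)) ∧
      ∀ r ∈ Icc (0 : ℝ) 1, η < dist (α (-ε) (α (-(τ * r)) y')) (α (-(τ * r)) y))
    ((hev ε (abs_of_pos hε)).and (hev (-ε) (by rw [abs_neg, abs_of_pos hε])))
  obtain ⟨η, hη, hηη⟩ : ∃ η, 0 < η ∧ η < η' := exists_between hη'
  have hp : Continuous fun r => α (-(τ * r)) y := α.continuous (by fun_prop) continuous_const
  -- Radius `η / 2` makes any two points of one chart domain `η`-close. The chart at time `0` is cut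
  -- down further, since it has to control the starting point of the other path.
  have hchart : ∀ s : ℝ, ∃ c ∈ (flowFoliation α hα).charts, α (-(τ * s)) y ∈ c.dom ∧
      c.dom ⊆ Metric.ball (α (-(τ * s)) y) (η / 2) ∧
      (s = 0 → c.dom ⊆ N ∩ {y' | ∀ δ, |δ| < η' →
        ((∀ r ∈ Icc (0 : ℝ) 1, δ < dist (α ε (α (-(τ * r)) y')) (α (-(τ * r)) y)) ∧
        ∀ r ∈ Icc (0 : ℝ) 1, δ < dist (α (-ε) (α (-(τ * r)) y')) (α (-(τ * r)) y))}) := by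
    intro s
    have hB := Metric.ball_mem_nhds (α (-(τ * s)) y) (half_pos hη)
    by_cases hs : s = 0
    · subst hs
      have hN' := inter_mem hN hev'
      have e0 : α (-(τ * 0)) y = y := by simp
      rw [← congrArg 𝓝 e0] at hN'
      obtain ⟨c, h1, h2, h3, -⟩ := exists_chart hα (α (-(τ * 0)) y)
        (inter_mem hB hN')
      exact ⟨c, h1, h2, h3.trans inter_subset_left, fun _ => h3.trans inter_subset_right⟩
    · obtain ⟨c, h1, h2, h3, -⟩ := exists_chart hα (α (-(τ * s)) y) hB
      exact ⟨c, h1, h2, h3, fun h => absurd h hs⟩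
  choose C hC hCp hCb hC0 using hchart
  -- Removing the times `r ≤ 0` from all sets except the one for `s = 0` forces the first chart of
  -- the chain to be the special chart at time `0`.
  obtain ⟨δ, hδ, hleb⟩ := lebesgue_number_lemma_of_metric (isCompact_Icc (a := (0 : ℝ)) (b := 1))
    (c := fun s : ℝ => (fun r => α (-(τ * r)) y) ⁻¹' (C s).dom ∩ {r | s = 0 ∨ 0 < r})
    (fun s => ((C s).φ.open_source.preimage hp).inter (by
      by_cases hs : s = 0
      · simp [hs]
      · simpa [hs] using isOpen_lt continuous_const continuous_id)) (fun r hr => mem_iUnion.2 ⟨r, hCp r, by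
        rcases hr.1.eq_or_lt with h | h
        · exact Or.inl h.symm
        · exact Or.inr h⟩)
  obtain ⟨n, hn⟩ := exists_nat_one_div_lt hδ
  let t : Fin (n + 2) → ℝ := fun i => (i : ℝ) / (n + 1)
  have hn0 : (0 : ℝ) < n + 1 := by positivity
  have htm : StrictMono t := fun i j hij => by
    have : (i : ℝ) < j := by exact_mod_cast hij
    exact div_lt_div_of_pos_right this hn0
  have ht0 : t 0 = 0 := by simp [t]
  have ht1 : t (Fin.last (n + 1)) = 1 := by simp [t, Fin.val_last, div_self hn0.ne']
  have ht' : ∀ i, t i ∈ Icc 0 1 := fun i =>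
    ⟨ht0 ▸ htm.monotone (Fin.zero_le _), ht1 ▸ htm.monotone (Fin.le_last _)⟩
  choose s hs using fun i : Fin (n + 1) => hleb (t i.castSucc) (ht' _)
  have hseg : ∀ i : Fin (n + 1), Icc (t i.castSucc) (t i.succ) ⊆ Metric.ball (t i.castSucc) δ := by
    intro i r hr
    have : t i.succ = t i.castSucc + 1 / (n + 1) := by
      simp only [t, Fin.val_succ, Fin.val_castSucc]; push_cast; ring
    rw [Real.ball_eq_Ioo]
    constructor <;> linarith [hr.1, hr.2]
  have hs0 : s 0 = 0 := by
    have := (hs 0 (Metric.mem_ball_self hδ)).2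
    simpa [ht0] using this
  have hO : IsOpen ((flowFoliation α hα).chainNhd (fun i => C (s i)) t) :=
    TopologicalSpace.isOpen_generateFrom_of_mem ⟨n, _, t, fun i => hC _, htm, ht0, ht1, rfl⟩
  refine mem_of_superset (hO.mem_nhds ?_) ?_
  · refine ⟨_, rfl, fun i r hr => ?_⟩
    have hr' : r ∈ Icc (0 : ℝ) 1 := ⟨(ht' _).1.trans hr.1, hr.2.trans (ht' _).2⟩
    rw [isLift_orbitPath.2.2 r hr']
    exact (hs i (hseg i hr)).1
  · rintro _ ⟨q, rfl, hq⟩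
    obtain ⟨θ, hθ⟩ := exists_isLift q
    have hq0 : q.start ∈ (C (s 0)).dom := by
      have := hq 0 0 (by
        simp only [Fin.castSucc_zero, ht0, left_mem_Icc]; exact (ht' _).1)
      simpa using this
    obtain ⟨hqN, hqd⟩ := hC0 _ hs0 hq0
    obtain ⟨d1, d2⟩ := hqd η (by rwa [abs_of_pos hη])
    have hcov : ∀ r ∈ Icc (0 : ℝ) 1, ∃ i : Fin (n + 1), r ∈ Icc (t i.castSucc) (t i.succ) := by
      intro r hr
      have hf : 0 ≤ r * (n + 1) := mul_nonneg hr.1 hn0.le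
      rcases hr.2.eq_or_lt with h1 | h1
      · refine ⟨Fin.last n, ?_, ?_⟩
        · rw [h1]; exact (ht' _).2
        · rw [h1, Fin.succ_last, ht1]
      · have hlt : ⌊r * (n + 1)⌋₊ < n + 1 := by
          rw [Nat.floor_lt hf]; push_cast; nlinarith
        refine ⟨⟨_, hlt⟩, ?_, ?_⟩
        · simp only [t, Fin.val_castSucc]
          rw [div_le_iff₀ hn0]; exact Nat.floor_le hf
        · simp only [t, Fin.val_succ]
          rw [le_div_iff₀ hn0]; push_cast; exact (Nat.lt_floor_add_one _).le
    have hclose : ∀ r ∈ Icc (0 : ℝ) 1, dist (α (θ r) q.start) (α (-(τ * r)) y) < η := by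
      intro r hr
      obtain ⟨i, hi⟩ := hcov r hr
      have e1 := hCb _ (hq i r hi)
      have e2 := hCb _ (hs i (hseg i hi)).1
      rw [hθ.2.2 r hr] at e1
      rw [Metric.mem_ball] at e1 e2
      linarith [dist_triangle_right (α (θ r) q.start) (α (-(τ * r)) y) (α (-(τ * s i)) y)]
    have hnot : ∀ r ∈ Icc (0 : ℝ) 1, |θ r + τ * r| ≠ ε := by
      intro r hr h
      have e : α (θ r) q.start = α (θ r + τ * r) (α (-(τ * r)) q.start) := by
        rw [← α.map_add]; congr 1; ring
      have h1 := hclose r hr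
      rw [e] at h1
      rcases eq_or_eq_neg_of_abs_eq h with h | h <;> rw [h] at h1
      · exact lt_asymm h1 (d1 r hr)
      · exact lt_asymm h1 (d2 r hr)
    have hlast : |θ 1 + τ * 1| < ε := by
      by_contra! hle
      have hc : Continuous fun r => |θ r + τ * r| := by
        have := hθ.1
        fun_prop
      obtain ⟨r, hr, h⟩ := intermediate_value_Icc zero_le_one hc.continuousOn
        (show ε ∈ Icc _ _ from ⟨by simpa [hθ.2.1] using hε.le, hle⟩)
      exact hnot r hr h
    have := hNA (mk_mem_prod hqN (hb ?_) : (q.start, -θ 1) ∈ N ×ˢ A)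
    · have e : canonicalMap hα (q.start, -θ 1) = .mk q :=
        ((mk_eq_canonicalMap_iff hθ).2 ⟨rfl, by rw [neg_neg]; exact HolRel.refl _ _ _⟩).symm
      rw [← e]
      exact this
    · rw [Metric.mem_ball, Real.dist_eq, ← abs_neg]
      refine lt_of_eq_of_lt ?_ (hlast.trans hεε.1)
      congr 1; ring

/-- Two nearby pairs with the same class share `y` and the end point of their path, so the
difference of their times is a period of that end point, too small to be nonzero. -/
lemma eventually_injOn_canonicalMap (x : Y × ℝ) :
    ∃ W, IsOpen W ∧ x ∈ W ∧ InjOn (canonicalMap hα) W := by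
  obtain ⟨ε, hε, hper⟩ := no_small_periods α (hα (α (-x.2) x.1))
  have hc : Continuous fun x : Y × ℝ => α (-x.2) x.1 :=
    α.continuous (by fun_prop) continuous_fst
  have h2 : ∀ᶠ x' : Y × ℝ in 𝓝 x, |x'.2 - x.2| < ε / 2 := by
    have : Continuous fun x' : Y × ℝ => |x'.2 - x.2| := by fun_prop
    exact (this.tendsto x).eventually_lt_const (by simpa using half_pos hε)
  obtain ⟨W, hW, hWo, hxW⟩ := eventually_nhds_iff.1 (((hc.tendsto x).eventually hper).and h2)
  refine ⟨W, hWo, hxW, ?_⟩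
  rintro ⟨y, s⟩ hs ⟨y', t⟩ ht h
  obtain ⟨h1, h2⟩ := canonicalMap_eq_iff.1 h
  simp only at h1 h2
  subst h1
  have e := (flow_eq_iff α).1 h2.1
  have a1 := abs_lt.1 (hW _ hs).2
  have a2 := abs_lt.1 (hW _ ht).2
  simp only at a1 a2
  have := (hW _ ht).1 (t - s) (abs_le.2 ⟨by linarith, by linarith⟩) (by
    simp only
    rw [← α.map_add, add_comm, ← h2.1]
    rw [show -t + (t - s) = -s by ring])
  rw [show t = s by linarith]

lemma isLocalHomeomorph_canonicalMap : IsLocalHomeomorph (canonicalMap hα) := by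
  rw [isLocalHomeomorph_iff_isOpenEmbedding_restrict]
  intro x
  obtain ⟨W, hW, hx, hi⟩ := eventually_injOn_canonicalMap (hα := hα) x
  exact ⟨W, hW.mem_nhds hx, .of_continuous_injective_isOpenMap
    (continuous_canonicalMap.comp continuous_subtype_val) (injOn_iff_injective.1 hi)
    (isOpenMap_canonicalMap.domRestrict hW)⟩

end FlowFoliation

/-! ### Groupoid structure and topology transported along the canonical map -/

namespace LineFoliation

variable {Y : Type u} [TopologicalSpace Y] {F : LineFoliation Y}

lemma holonomyGroupoid_mul (a b : F.Holonomy) (h) : F.holonomyGroupoid.mul a b h = a.comp b := rfl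

lemma holonomyGroupoid_r (a : F.Holonomy) :
    F.holonomyGroupoid.r a = Holonomy.unit F a.start := rfl

lemma holonomyGroupoid_d (a : F.Holonomy) :
    F.holonomyGroupoid.d a = Holonomy.unit F a.finish := rfl

lemma Holonomy.finish_inv (a : F.Holonomy) : a.inv.finish = a.start :=
  Holonomy.unit_injective (F.holonomyGroupoid.d_inv a)

lemma Holonomy.start_inv (a : F.Holonomy) : a.inv.start = a.finish :=
  Holonomy.unit_injective (F.holonomyGroupoid.r_inv a)

lemma Holonomy.eq_inv {a b : F.Holonomy} (h : a.finish = b.start)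
    (hab : a.comp b = Holonomy.unit F a.start) : b = a.inv := by
  have h1 : a.inv.comp a = Holonomy.unit F a.finish := F.holonomyGroupoid.inv_mul a
  have h2 : a.inv.comp (Holonomy.unit F a.inv.finish) = a.inv := F.holonomyGroupoid.mul_unit a.inv
  have h3 : (a.inv.comp a).comp b = a.inv.comp (a.comp b) :=
    F.holonomyGroupoid.mul_assoc a.inv a b (F.holonomyGroupoid.d_inv a)
      (congrArg (Holonomy.unit F) h)
  have h4 : (Holonomy.unit F b.start).comp b = b := F.holonomyGroupoid.unit_mul b
  rw [h1, h, h4, hab] at h3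
  rw [h3, ← Holonomy.finish_inv, h2]

end LineFoliation

namespace FlowFoliation

open LineFoliation

variable {Y : Type u} [TopologicalSpace Y] {α : Flow ℝ Y}
lemma isTopological_transformationGroupoid : (transformationGroupoid α).IsTopological where
  continuous_mul := by
    change Continuous fun p : {p : (Y × ℝ) × (Y × ℝ) // _} => (p.1.1.1, p.1.1.2 + p.1.2.2)
    fun_prop
  continuous_inv := by
    change Continuous fun x : Y × ℝ => (α (-x.2) x.1, -x.2)
    exact (α.continuous (by fun_prop) continuous_fst).prodMk (by fun_prop)

variable [TopologicalSpace.MetrizableSpace Y] [LocallyCompactSpace Y]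
variable {hα : ∀ y, ∃ t, α t y ≠ y}

@[simp] lemma start_canonicalMap (x : Y × ℝ) : (canonicalMap hα x).start = x.1 := rfl

@[simp] lemma finish_canonicalMap (x : Y × ℝ) : (canonicalMap hα x).finish = α (-x.2) x.1 := by
  change α (-(x.2 * 1)) x.1 = _
  rw [mul_one]

lemma unit_eq_canonicalMap (y : Y) :
    Holonomy.unit (flowFoliation α hα) y = canonicalMap hα (y, 0) := by
  have : IsLift (LeafPath.const (flowFoliation α hα) y) fun _ => 0 :=
    ⟨continuous_const, rfl, fun r _ => by simp [LeafPath.const]⟩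
  refine (mk_eq_canonicalMap_iff this).2 ⟨rfl, ?_⟩
  simpa using HolRel.refl hα y 0

/-- No lift of the concatenated path is computed. Some lift `θ` exists, and multiplicativity of
holonomy shows that `θ 1` and `-(s + t)` have the same end point and germ. -/
lemma comp_canonicalMap (y : Y) (s t : ℝ) :
    (canonicalMap hα (y, s)).comp (canonicalMap hα (α (-s) y, t)) = canonicalMap hα (y, s + t) := by
  set p := orbitPath hα y (fun r => -(s * r)) (by fun_prop) (by simp) with hp
  set q := orbitPath hα (α (-s) y) (fun r => -(t * r)) (by fun_prop) (by simp) with hq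
  have hpl : IsLift p _ := isLift_orbitPath
  have hql : IsLift q _ := isLift_orbitPath
  have hpq : p.finish = q.start := by rw [hpl.finish, mul_one]; rfl
  change (Holonomy.mk p).comp (Holonomy.mk q) = _
  rw [Holonomy.mk_comp p q hpq]
  obtain ⟨θ, hθ⟩ := exists_isLift (p.comp q hpq)
  refine (mk_eq_canonicalMap_iff hθ).2 ⟨rfl, ?_⟩
  have hst : ∀ z, α (-(t * 1)) (α (-(s * 1)) z) = α (-(s + t)) z := fun z => by
    rw [← α.map_add]; congr 1; ring
  have hfin : α (θ 1) y = α (-(s + t)) y := by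
    have e : q.finish = α (θ 1) y := hθ.finish
    rw [← e, hql.finish, ← hst, mul_one, mul_one]; rfl
  obtain ⟨c, hc, hpc⟩ := (flowFoliation α hα).cover p.start
  obtain ⟨d, hd, hpd⟩ := (flowFoliation α hα).cover p.finish
  obtain ⟨e, he, hqe⟩ := (flowFoliation α hα).cover q.finish
  obtain ⟨H, hH⟩ := p.exists_isHolonomy hc hd hpc hpd
  obtain ⟨K, hK⟩ := q.exists_isHolonomy hd he (hpq ▸ hpd) hqe
  refine ⟨hfin, e, he, ?_, ?_⟩
  · have e' : q.finish = α (θ 1) y := hθ.finish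
    rwa [← e']
  have hT : Tendsto (fun z => α (-(s * 1)) z) (𝓝 y) (𝓝 q.start) := by
    have := (α.continuous (continuous_const (y := -(s * 1))) continuous_id).tendsto y
    rwa [← hpq, hpl.finish]
  filter_upwards [hθ.germ (hH.comp hK hpq), hpl.germ hH, hT.eventually (hql.germ hK)]
    with z z1 z2 z3
  rw [← z1, Function.comp_apply, z2, z3, hst]

lemma isOpenQuotientMap_canonicalMap : IsOpenQuotientMap (canonicalMap hα) :=
  ⟨canonicalMap_surjective, continuous_canonicalMap, isOpenMap_canonicalMap⟩

lemma continuous_start : Continuous (Holonomy.start (F := flowFoliation α hα)) :=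
  isOpenQuotientMap_canonicalMap.continuous_comp_iff.1 continuous_fst

variable (hα) in
/-- The times `t` for which the path `s ↦ α (ts) y` is a loop without holonomy. -/
def holonomyKernel (y : Y) : AddSubgroup ℝ where
  carrier := {t | canonicalMap hα (y, t) = canonicalMap hα (y, 0)}
  zero_mem' := rfl
  add_mem' {s t} hs ht := by
    have h := congrArg Holonomy.finish hs
    simp only [finish_canonicalMap, neg_zero, α.map_zero_apply] at h
    change _ = _ at ht
    change _ = _
    rw [← comp_canonicalMap, h, ht, hs]
    have := comp_canonicalMap (hα := hα) y 0 0
    simpa using this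
  neg_mem' {s} hs := by
    have h := congrArg Holonomy.finish hs
    simp only [finish_canonicalMap, neg_zero, α.map_zero_apply] at h
    change _ = _
    have h1 := comp_canonicalMap (hα := hα) y s (-s)
    have h2 := comp_canonicalMap (hα := hα) y 0 (-s)
    change _ = _ at hs
    rw [hs, h, add_neg_cancel] at h1
    rw [neg_zero, α.map_zero_apply, zero_add] at h2
    rw [← h1, h2]

lemma mem_holonomyKernel {y : Y} {t : ℝ} :
    t ∈ holonomyKernel hα y ↔ canonicalMap hα (y, t) = canonicalMap hα (y, 0) := Iff.rfl

/-- Multiplicativity reduces equality of classes to a loop without holonomy: the range fiber over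
`y` is `ℝ` modulo `holonomyKernel hα y`. -/
lemma canonicalMap_eq_iff_sub_mem {y : Y} {s t : ℝ} :
    canonicalMap hα (y, s) = canonicalMap hα (y, t) ↔ s - t ∈ holonomyKernel hα y := by
  rw [mem_holonomyKernel]
  constructor
  · intro h
    have hf := congrArg Holonomy.finish h
    simp only [finish_canonicalMap] at hf
    rw [sub_eq_add_neg, ← comp_canonicalMap, hf, h, comp_canonicalMap, add_neg_cancel]
  · intro h
    have hf := congrArg Holonomy.finish h
    simp only [finish_canonicalMap, neg_zero, α.map_zero_apply] at hf
    have h1 := comp_canonicalMap (hα := hα) y (s - t) t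
    have h2 := comp_canonicalMap (hα := hα) y 0 t
    rw [neg_zero, α.map_zero_apply, zero_add] at h2
    rw [hf, h, sub_add_cancel, h2] at h1
    exact h1.symm

/-- Local injectivity at `(y, 0)` isolates `0` in the subgroup, and such a subgroup of `ℝ` is
cyclic. The fiber is a line if `b = 0` and a circle otherwise. -/
lemma exists_holonomyKernel_eq_zmultiples (y : Y) :
    ∃ b, holonomyKernel hα y = AddSubgroup.zmultiples b := by
  obtain ⟨W, hW, h0, hi⟩ := eventually_injOn_canonicalMap (hα := hα) (y, 0)
  have hT : Tendsto (fun t : ℝ => (y, t)) (𝓝 0) (𝓝 (y, 0)) :=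
    (Continuous.prodMk_right y).tendsto 0
  obtain ⟨ε, hε, hb⟩ := Metric.mem_nhds_iff.1 (hT.eventually (hW.mem_nhds h0))
  obtain ⟨b, hb⟩ := AddSubgroup.cyclic_of_isolated_zero (H := holonomyKernel hα y) hε (by
    rw [Set.disjoint_left]
    intro t ht ht'
    have hm : (y, t) ∈ W := hb (by simpa [abs_lt] using ⟨by linarith [ht'.1], ht'.2⟩)
    have := hi hm h0 ht
    simp only [Prod.mk.injEq] at this
    exact ht'.1.ne' this.2)
  exact ⟨b, by rw [hb, AddSubgroup.zmultiples_eq_closure]⟩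

lemma isClosed_holonomyKernel (y : Y) : IsClosed (holonomyKernel hα y : Set ℝ) := by
  obtain ⟨b, hb⟩ := exists_holonomyKernel_eq_zmultiples (hα := hα) y
  rw [hb]
  exact AddSubgroup.isClosed_of_discrete

/-! ### The range fibers -/

variable (hα) in
/-- The restriction of the canonical map to a range fiber. -/
def fiberParam {u : (flowFoliation α hα).Holonomy}
    (hu : u ∈ (flowFoliation α hα).holonomyGroupoid.units) (t : ℝ) :
    (flowFoliation α hα).holonomyGroupoid.Fiber u :=
  ⟨canonicalMap hα (u.start, t), hu⟩

lemma mem_units_iff {u : (flowFoliation α hα).Holonomy} :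
    u ∈ (flowFoliation α hα).holonomyGroupoid.units ↔ canonicalMap hα (u.start, 0) = u := by
  rw [← unit_eq_canonicalMap]; rfl

lemma canonicalMap_zero_mem_units (y : Y) :
    canonicalMap hα (y, 0) ∈ (flowFoliation α hα).holonomyGroupoid.units :=
  mem_units_iff.2 rfl

lemma start_of_fiber {u : (flowFoliation α hα).Holonomy}
    (a : (flowFoliation α hα).holonomyGroupoid.Fiber u) : a.1.start = u.start :=
  have h : Holonomy.unit (flowFoliation α hα) a.1.start = u := a.2
  (congrArg Holonomy.start h : (Holonomy.unit (flowFoliation α hα) a.1.start).start = u.start)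

lemma isOpenQuotientMap_fiberParam {u : (flowFoliation α hα).Holonomy}
    (hu : u ∈ (flowFoliation α hα).holonomyGroupoid.units) :
    IsOpenQuotientMap (fiberParam hα hu) := by
  refine ⟨?_, ?_, ?_⟩
  · intro a
    obtain ⟨x, hx⟩ := canonicalMap_surjective (hα := hα) a.1
    have h := start_of_fiber a
    rw [← hx] at h
    refine ⟨x.2, Subtype.ext ?_⟩
    change canonicalMap hα (u.start, x.2) = a.1
    rw [← hx, ← h, start_canonicalMap]
  · exact Continuous.subtype_mk (continuous_canonicalMap.comp (Continuous.prodMk_right _)) _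
  · intro E hE
    -- The image of `E` is the trace on the fiber of an open set, since an element of the fiber over
    -- `u` has starting point `u.start`.
    refine ⟨canonicalMap hα '' (univ ×ˢ E), isOpenMap_canonicalMap _ (isOpen_univ.prod hE), ?_⟩
    ext a
    constructor
    · rintro ⟨⟨y, t⟩, ⟨-, ht⟩, e⟩
      have h := start_of_fiber a
      rw [← e] at h
      simp only [start_canonicalMap] at h
      subst h
      exact ⟨t, ht, Subtype.ext e⟩
    · rintro ⟨t, ht, rfl⟩
      exact ⟨(u.start, t), ⟨trivial, ht⟩, rfl⟩

/-- The fiber is an open quotient of `ℝ`, and its relation `s - t ∈ holonomyKernel` is closed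
because the kernel is closed. The argument is fiberwise and says nothing about the whole groupoid,
which may fail to be Hausdorff. -/
lemma t2Space_fiber {u : (flowFoliation α hα).Holonomy}
    (hu : u ∈ (flowFoliation α hα).holonomyGroupoid.units) :
    T2Space ((flowFoliation α hα).holonomyGroupoid.Fiber u) := by
  rw [t2Space_iff_of_isOpenQuotientMap (isOpenQuotientMap_fiberParam hu)]
  have : {q : ℝ × ℝ | fiberParam hα hu q.1 = fiberParam hα hu q.2} =
      (fun q : ℝ × ℝ => q.1 - q.2) ⁻¹' (holonomyKernel hα u.start : Set ℝ) := by
    ext q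
    exact Subtype.ext_iff.trans canonicalMap_eq_iff_sub_mem
  rw [this]
  exact (isClosed_holonomyKernel _).preimage (by fun_prop)

lemma locallyCompactSpace_fiber {u : (flowFoliation α hα).Holonomy}
    (hu : u ∈ (flowFoliation α hα).holonomyGroupoid.units) :
    LocallyCompactSpace ((flowFoliation α hα).holonomyGroupoid.Fiber u) :=
  (isOpenQuotientMap_fiberParam hu).locallyCompactSpace

/-! ### The topological groupoid -/

variable (hα) in
/-- The homeomorphism between the unit spaces. -/
def unitsHomeo :
    (transformationGroupoid α).units ≃ₜ (flowFoliation α hα).holonomyGroupoid.units where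
  toFun u := ⟨canonicalMap hα u, mem_units_iff.2 (congrArg _ u.2)⟩
  invFun a := ⟨(a.1.start, 0), rfl⟩
  left_inv u := Subtype.ext u.2
  right_inv a := Subtype.ext (mem_units_iff.1 a.2)
  continuous_toFun := (continuous_canonicalMap.comp continuous_subtype_val).subtype_mk _
  continuous_invFun :=
    ((continuous_start.comp continuous_subtype_val).prodMk continuous_const).subtype_mk _

variable (α) in
/-- The unit space of `Y ⋊ ℝ` is `Y`. -/
def unitsHomeoBase : (transformationGroupoid α).units ≃ₜ Y where
  toFun u := u.1.1
  invFun y := ⟨(y, 0), rfl⟩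
  left_inv u := Subtype.ext u.2
  right_inv _ := rfl
  continuous_toFun := by fun_prop
  continuous_invFun := by fun_prop

lemma isFiberwiseCovering_canonicalMap :
    IsFiberwiseCovering (transformationGroupoid α) (flowFoliation α hα).holonomyGroupoid
      (canonicalMap hα) where
  map_r x := (unit_eq_canonicalMap x.1).symm
  map_d x := by
    change _ = Holonomy.unit _ (canonicalMap hα x).finish
    rw [finish_canonicalMap, unit_eq_canonicalMap]; rfl
  map_mul x x' h _ := by
    obtain ⟨y, s⟩ := x
    obtain ⟨y', t⟩ := x'
    obtain rfl : α (-s) y = y' := congrArg Prod.fst h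
    exact (comp_canonicalMap y s t).symm
  units_homeo := ⟨unitsHomeo hα, fun _ => rfl⟩
  surjective := canonicalMap_surjective
  isLocalHomeomorph := isLocalHomeomorph_canonicalMap

lemma inv_canonicalMap (y : Y) (t : ℝ) :
    (canonicalMap hα (y, t)).inv = canonicalMap hα (α (-t) y, -t) := by
  refine (Holonomy.eq_inv ?_ ?_).symm
  · simp
  · rw [comp_canonicalMap, add_neg_cancel, start_canonicalMap, unit_eq_canonicalMap]

lemma isTopological_holonomyGroupoid : (flowFoliation α hα).holonomyGroupoid.IsTopological where
  continuous_mul := by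
    set ℋ := (flowFoliation α hα).holonomyGroupoid
    -- Openness is what lets the quotient property survive products and the restriction to the
    -- preimage of the composable pairs, so that continuity can be checked on `Y × ℝ`.
    have hq := (isOpenQuotientMap_canonicalMap (hα := hα)).prodMap
      (isOpenQuotientMap_canonicalMap (hα := hα))
    have hr := hq.restrictPreimage {p | ℋ.d p.1 = ℋ.r p.2}
    refine hr.continuous_comp_iff.1 ?_
    have hc : Continuous fun p : {p : (Y × ℝ) × (Y × ℝ) // Prod.map (canonicalMap hα)
        (canonicalMap hα) p ∈ {p | ℋ.d p.1 = ℋ.r p.2}} =>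
        canonicalMap hα (p.1.1.1, p.1.1.2 + p.1.2.2) := continuous_canonicalMap.comp (by fun_prop)
    refine hc.congr ?_
    rintro ⟨⟨⟨y, s⟩, ⟨y', t⟩⟩, h⟩
    have h' := congrArg Holonomy.start h
    change (canonicalMap hα (y, s)).finish = y' at h'
    rw [finish_canonicalMap] at h'
    simp only at h'
    subst h'
    exact (comp_canonicalMap y s t).symm
  continuous_inv := by
    refine (isOpenQuotientMap_canonicalMap (hα := hα)).continuous_comp_iff.1 ?_
    refine (continuous_canonicalMap.comp
      (isTopological_transformationGroupoid (α := α)).continuous_inv).congr fun x => ?_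
    exact (inv_canonicalMap x.1 x.2).symm

lemma canonicalMap_homeo_image {W : Set (Y × ℝ)} (hi : InjOn (canonicalMap hα) W) (hW : IsOpen W) :
    IsOpenEmbedding (fun x : W => canonicalMap hα x) :=
  .of_continuous_injective_isOpenMap (continuous_canonicalMap.comp continuous_subtype_val)
    (injOn_iff_injective.1 hi) (isOpenMap_canonicalMap.domRestrict hW)

/-- On `W` the canonical map is an embedding, so the image of `K` is homeomorphic to a subset of the
Hausdorff space `Y × ℝ`. With `K` compact this provides the basis of the topology. -/
lemma t2Space_image {W K : Set (Y × ℝ)} (hi : InjOn (canonicalMap hα) W) (hW : IsOpen W)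
    (hK : K ⊆ W) : T2Space (canonicalMap hα '' K) := by
  have e := (canonicalMap_homeo_image hi hW).isEmbedding.comp (IsEmbedding.inclusion hK)
  have h := e.toHomeomorph
  have hr : range ((fun x : W => canonicalMap hα x) ∘ inclusion hK) = canonicalMap hα '' K := by
    rw [image_eq_range]; rfl
  rw [hr] at h
  exact h.t2Space

lemma exists_compact_image {a : (flowFoliation α hα).Holonomy} {O : Set _} (hO : O ∈ 𝓝 a) :
    ∃ x W, canonicalMap hα x = a ∧ IsOpen W ∧ x ∈ W ∧ InjOn (canonicalMap hα) W ∧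
      canonicalMap hα '' W ⊆ O := by
  obtain ⟨x, rfl⟩ := canonicalMap_surjective a
  obtain ⟨W, h1, h2, h3⟩ := eventually_injOn_canonicalMap (hα := hα) x
  obtain ⟨V, hV, hVo, hxV⟩ := mem_nhds_iff.1 (continuous_canonicalMap.continuousAt hO)
  exact ⟨x, W ∩ V, rfl, h1.inter hVo, ⟨h2, hxV⟩, h3.mono inter_subset_left,
    image_subset_iff.2 (inter_subset_right.trans hV)⟩

lemma isLocallyCompact_holonomyGroupoid :
    (flowFoliation α hα).holonomyGroupoid.IsLocallyCompact where
  toIsTopological := isTopological_holonomyGroupoid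
  units_locallyCompact :=
    ((unitsHomeoBase α).symm.trans (unitsHomeo hα)).locallyCompactSpace_iff.1 inferInstance
  units_t2 := ((unitsHomeoBase α).symm.trans (unitsHomeo hα)).t2Space
  fiber_locallyCompact _ := locallyCompactSpace_fiber
  fiber_t2 _ := t2Space_fiber
  basis := by
    refine TopologicalSpace.isTopologicalBasis_of_isOpen_of_nhds ?_ ?_
    · rintro _ ⟨C, -, -, rfl⟩
      exact isOpen_interior
    · intro a O ha hO
      obtain ⟨x, W, rfl, hW, hx, hi, hWO⟩ := exists_compact_image (hO.mem_nhds ha)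
      obtain ⟨K, hK, hKW, hKc⟩ := local_compact_nhds (hW.mem_nhds hx)
      refine ⟨_, ⟨canonicalMap hα '' K, hKc.image continuous_canonicalMap, t2Space_image hi hW hKW,
        rfl⟩, ?_, interior_subset.trans ((image_mono hKW).trans hWO)⟩
      rw [mem_interior_iff_mem_nhds]
      exact isOpenMap_canonicalMap.image_mem_nhds hK

lemma hasCountableBasis_holonomy [SecondCountableTopology Y] :
    GroupoidStr.HasCountableBasis (flowFoliation α hα).Holonomy := by
  have hB := TopologicalSpace.countable_countableBasis (Y × ℝ)
  have hB' := TopologicalSpace.isBasis_countableBasis (Y × ℝ)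
  refine ⟨(fun V => canonicalMap hα '' closure V) '' {V ∈ TopologicalSpace.countableBasis (Y × ℝ) |
    IsCompact (closure V) ∧ ∃ W, IsOpen W ∧ closure V ⊆ W ∧ InjOn (canonicalMap hα) W},
    (hB.mono (sep_subset _ _)).image _, ?_, ?_⟩
  · rintro _ ⟨V, ⟨-, hVc, W, hW, hVW, hi⟩, rfl⟩
    exact ⟨hVc.image continuous_canonicalMap, t2Space_image hi hW hVW⟩
  · refine TopologicalSpace.isTopologicalBasis_of_isOpen_of_nhds ?_ ?_
    · rintro _ ⟨C, -, rfl⟩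
      exact isOpen_interior
    · intro a O ha hO
      obtain ⟨x, W, rfl, hW, hx, hi, hWO⟩ := exists_compact_image (hO.mem_nhds ha)
      obtain ⟨K, hK, hKW, hKc⟩ := local_compact_nhds (hW.mem_nhds hx)
      obtain ⟨V, hV, hxV, hVK⟩ := hB'.mem_nhds_iff.1 hK
      have hcl : closure V ⊆ K := closure_minimal hVK hKc.isClosed
      refine ⟨_, ⟨_, ⟨V, ⟨hV, hKc.of_isClosed_subset isClosed_closure hcl, W, hW, hcl.trans hKW, hi⟩,
        rfl⟩, rfl⟩, ?_, interior_subset.trans ((image_mono (hcl.trans hKW)).trans hWO)⟩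
      rw [mem_interior_iff_mem_nhds]
      exact isOpenMap_canonicalMap.image_mem_nhds
        (mem_of_superset ((hB'.isOpen hV).mem_nhds hxV) subset_closure)

end FlowFoliation

/-! ### Compactly supported functions and fiber integrals -/

section CompactSupport

variable {X : Type*} [TopologicalSpace X]

lemma mem_Cc_of_continuous [T2Space X] {f : X → ℂ} (hf : Continuous f) (hf' : HasCompactSupport f) :
    f ∈ Cc X := by
  refine Submodule.subset_span ⟨univ, isOpen_univ, inferInstance, by simp, by fun_prop, ?_⟩
  exact hf'.comp_isClosedEmbedding isClosed_univ.isClosedEmbedding_subtypeVal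

/-- In a Hausdorff space the compact support is closed, so extension by zero is continuous. Without
separation this can fail at points outside `U` that cannot be separated from the support. -/
lemma continuous_of_mem_CcZero [T2Space X] {f : X → ℂ} (hf : f ∈ CcZero X) :
    Continuous f ∧ HasCompactSupport f := by
  obtain ⟨U, hU, -, h0, hc, hs⟩ := hf
  have hK : IsCompact (Subtype.val '' tsupport fun x : U => f x) :=
    hs.isCompact.image continuous_subtype_val
  have h0' : ∀ x ∉ Subtype.val '' tsupport (fun x : U => f x), f x = 0 := by
    intro x hx
    by_cases hxU : x ∈ U
    · by_contra h
      exact hx ⟨⟨x, hxU⟩, subset_tsupport _ h, rfl⟩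
    · exact h0 x hxU
  refine ⟨?_, .intro hK h0'⟩
  rw [continuous_iff_continuousAt]
  intro x
  by_cases hxU : x ∈ U
  · exact (continuousOn_iff_continuous_domRestrict.2 hc).continuousAt (hU.mem_nhds hxU)
  · have hx : x ∉ Subtype.val '' tsupport fun x : U => f x := by
      rintro ⟨z, -, rfl⟩
      exact hxU z.2
    have : f =ᶠ[𝓝 x] fun _ => 0 := by
      filter_upwards [hK.isClosed.isOpen_compl.mem_nhds hx] with z hz
      exact h0' z hz
    exact continuousAt_const.congr this.symm

lemma mem_Cc_iff [T2Space X] {f : X → ℂ} : f ∈ Cc X ↔ Continuous f ∧ HasCompactSupport f := by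
  refine ⟨fun hf => ?_, fun hf => mem_Cc_of_continuous hf.1 hf.2⟩
  induction hf using Submodule.span_induction with
  | mem f hf => exact continuous_of_mem_CcZero hf
  | zero => exact ⟨continuous_const, .zero⟩
  | add f g _ _ hf hg => exact ⟨hf.1.add hg.1, hf.2.add hg.2⟩
  | smul c f _ hf => exact ⟨hf.1.const_smul c, hf.2.smul_left⟩

lemma mem_Cc_comp_homeomorph {X' : Type*} [TopologicalSpace X'] [T2Space X] [T2Space X']
    (e : X ≃ₜ X') {f : X' → ℂ} (hf : Continuous f) (hf' : HasCompactSupport f) : f ∘ e ∈ Cc X :=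
  mem_Cc_iff.2 ⟨hf.comp e.continuous, hf'.comp_isClosedEmbedding e.isClosedEmbedding⟩

lemma hasCompactSupport_slice {Y Z : Type*} [TopologicalSpace Y] [TopologicalSpace Z] [T2Space Y]
    [T2Space Z] {g : Y × Z → ℂ} (hg : HasCompactSupport g) (y : Y) :
    HasCompactSupport fun t => g (y, t) :=
  .intro (hg.isCompact.image continuous_snd) fun t ht => by
    by_contra h
    exact ht ⟨(y, t), subset_tsupport _ h, rfl⟩

lemma integrable_slice {Y : Type*} [TopologicalSpace Y] [T2Space Y]
    {g : Y × ℝ → ℂ} (hc : Continuous g) (hg : HasCompactSupport g) (y : Y) :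
    Integrable fun t => g (y, t) :=
  (hc.comp (Continuous.prodMk_right y)).integrable_of_hasCompactSupport
    (hasCompactSupport_slice hg y)

lemma continuous_integral_slice {Y : Type*} [TopologicalSpace Y] [LocallyCompactSpace Y]
    [TopologicalSpace.MetrizableSpace Y] {g : Y × ℝ → ℂ} (hc : Continuous g)
    (hg : HasCompactSupport g) :
    Continuous (fun y => ∫ t, g (y, t)) ∧ HasCompactSupport fun y => ∫ t, g (y, t) := by
  constructor
  · have h := continuous_parametric_integral_of_continuous (μ := volume)
      (f := fun (y : Y) (t : ℝ) => g (y, t)) (by exact hc) (hg.isCompact.image continuous_snd)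
    refine h.congr fun y => setIntegral_eq_integral_of_forall_compl_eq_zero fun t ht => ?_
    by_contra h
    exact ht ⟨(y, t), subset_tsupport _ h, rfl⟩
  · refine .intro (hg.isCompact.image continuous_fst) fun y hy => ?_
    have : ∀ t, g (y, t) = 0 := fun t => by
      by_contra h
      exact hy ⟨(y, t), subset_tsupport _ h, rfl⟩
    simp [this]

end CompactSupport

/-! ### The Lebesgue system is a Haar system -/

namespace FlowFoliation

variable {Y : Type u} [TopologicalSpace Y] {α : Flow ℝ Y}

/-- The range fibers of `Y ⋊ ℝ`. -/
def transFiberHomeo {u : Y × ℝ} (hu : u ∈ (transformationGroupoid α).units) :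
    (transformationGroupoid α).Fiber u ≃ₜ ℝ where
  toFun x := x.1.2
  invFun t := ⟨(u.1, t), hu⟩
  left_inv x := by
    have h : u.1 = x.1.1 := (congrArg Prod.fst (show (x.1.1, (0 : ℝ)) = u from x.2)).symm
    exact Subtype.ext (Prod.ext h rfl)
  right_inv _ := rfl
  continuous_toFun := continuous_snd.comp continuous_subtype_val
  continuous_invFun := Continuous.subtype_mk (Continuous.prodMk_right _) _

lemma lebesgueSystem_eq_map {u : Y × ℝ} (hu : u ∈ (transformationGroupoid α).units) :
    lebesgueSystem α u = (volume : Measure ℝ).map (transFiberHomeo hu).symm :=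
  ((transFiberHomeo hu).toMeasurableEquiv.map_symm (μ := volume)).symm

lemma integral_lebesgueSystem {u : Y × ℝ} (hu : u ∈ (transformationGroupoid α).units)
    (G : (transformationGroupoid α).Fiber u → ℂ) :
    ∫ x, G x ∂lebesgueSystem α u = ∫ t, G ((transFiberHomeo hu).symm t) := by
  rw [lebesgueSystem_eq_map hu]
  exact (transFiberHomeo hu).symm.measurableEmbedding.integral_map _

lemma isHaarSystem_lebesgueSystem [LocallyCompactSpace Y] [TopologicalSpace.MetrizableSpace Y] :
    GroupoidStr.IsHaarSystem (lebesgueSystem α) where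
  regular u hu := by
    rw [lebesgueSystem_eq_map hu]
    exact Measure.Regular.map _
  full_support u hu := by
    rw [lebesgueSystem_eq_map hu]
    exact (transFiberHomeo hu).symm.continuous.isOpenPosMeasure_map
      (transFiberHomeo hu).symm.surjective
  continuous f hf := by
    obtain ⟨hc, hs⟩ := mem_Cc_iff.1 hf
    obtain ⟨h1, h2⟩ := continuous_integral_slice hc hs
    convert mem_Cc_comp_homeomorph (unitsHomeoBase α) h1 h2 using 1
    funext u
    rw [integral_lebesgueSystem u.2]
    rfl
  left_invariant f hf x := by
    have hd : (transformationGroupoid α).d x ∈ (transformationGroupoid α).units :=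
      (transformationGroupoid α).r_d x
    have hr : (transformationGroupoid α).r x ∈ (transformationGroupoid α).units :=
      (transformationGroupoid α).r_r x
    rw [integral_lebesgueSystem hd, integral_lebesgueSystem hr]
    exact integral_add_left_eq_self (fun t => f (x.1, t)) x.2

end FlowFoliation

/-- The predicate `P` is left open because the partition is used both on `Y × ℝ`, for sets on which
the canonical map is injective, and on Hausdorff open subsets of the holonomy groupoid, for images
of such sets. -/
lemma exists_partition {X : Type*} [TopologicalSpace X] [T2Space X] [LocallyCompactSpace X]
    {K : Set X} (hK : IsCompact K) {P : Set X → Prop}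
    (h : ∀ x ∈ K, ∃ V, IsOpen V ∧ x ∈ V ∧ P V) :
    ∃ (n : ℕ) (V : Fin n → Set X) (χ : Fin n → C(X, ℝ)), (∀ i, IsOpen (V i) ∧ P (V i)) ∧
      (∀ i, tsupport (χ i) ⊆ V i) ∧ (∀ x ∈ K, ∑ i, χ i x = 1) ∧
      (∀ i x, χ i x ∈ Icc (0 : ℝ) 1) ∧ ∀ i, HasCompactSupport (χ i) := by
  choose! V hV hxV hP using h
  obtain ⟨t, ht⟩ := hK.elim_finite_subcover (fun x : K => V x) (fun x => hV x x.2)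
    fun x hx => mem_iUnion.2 ⟨⟨x, hx⟩, hxV x hx⟩
  let e := t.equivFin
  obtain ⟨χ, h1, h2, h3, h4⟩ := exists_continuous_sum_one_of_isOpen_isCompact
    (s := fun i => V (e.symm i).1) (fun i => hV _ (e.symm i).1.2) hK fun x hx => by
      obtain ⟨y, hy, hxy⟩ := mem_iUnion₂.1 (ht hx)
      exact mem_iUnion.2 ⟨e ⟨y, hy⟩, by simpa using hxy⟩
  refine ⟨_, fun i => V (e.symm i).1, χ, fun i => ⟨hV _ (e.symm i).1.2, hP _ (e.symm i).1.2⟩, h1,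
    fun x hx => ?_, h3, h4⟩
  simpa using h2 hx

/-! ### Pushing functions forward along the canonical map -/

namespace FlowFoliation

open LineFoliation

variable {Y : Type u} [TopologicalSpace Y] {α : Flow ℝ Y}
variable [TopologicalSpace.MetrizableSpace Y] [LocallyCompactSpace Y]
variable {hα : ∀ y, ∃ t, α t y ≠ y}

variable (hα) in
/-- The times `t` such that the canonical map takes the value `a` at `(y, t)`, for the range `y`
of `a`. -/
def times (a : (flowFoliation α hα).Holonomy) : Set ℝ := {t | canonicalMap hα (a.start, t) = a}

variable (hα) in
/-- The function on the holonomy groupoid obtained by summing over the fibers of the canonical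
map. -/
def pushforward (g : Y × ℝ → ℂ) (a : (flowFoliation α hα).Holonomy) : ℂ :=
  ∑ᶠ t ∈ times hα a, g (a.start, t)

/-- Finitely many sets on which the canonical map is injective cover `K`, and each contributes at
most one time. This makes the sums in `pushforward` finite for compactly supported functions. -/
lemma finite_times_inter {K : Set (Y × ℝ)} (hK : IsCompact K) :
    ∀ a, (times hα a ∩ {t | (a.start, t) ∈ K}).Finite := by
  refine hK.induction_on (p := fun K => ∀ a, (times hα a ∩ {t | (a.start, t) ∈ K}).Finite)
    (by simp) (fun s t hst h a => (h a).subset (inter_subset_inter_right _ fun r hr => hst hr)) ?_ ?_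
  · intro s t hs ht a
    refine ((hs a).union (ht a)).subset ?_
    rintro r ⟨h1, h2 | h2⟩
    · exact Or.inl ⟨h1, h2⟩
    · exact Or.inr ⟨h1, h2⟩
  · intro x _
    obtain ⟨W, hW, hx, hi⟩ := eventually_injOn_canonicalMap (hα := hα) x
    refine ⟨W, mem_nhdsWithin_of_mem_nhds (hW.mem_nhds hx), fun a => Set.Subsingleton.finite ?_⟩
    rintro s ⟨hs, hs'⟩ t ⟨ht, ht'⟩
    exact congrArg Prod.snd (hi hs' ht' (hs.trans ht.symm))

lemma finite_times_inter_support {g : Y × ℝ → ℂ} (hg : HasCompactSupport g)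
    (a : (flowFoliation α hα).Holonomy) :
    (times hα a ∩ Function.support fun t => g (a.start, t)).Finite :=
  (finite_times_inter hg.isCompact a).subset
    (inter_subset_inter_right _ fun _ ht => subset_tsupport _ ht)

lemma pushforward_add {g h : Y × ℝ → ℂ} (hg : HasCompactSupport g) (hh : HasCompactSupport h) :
    pushforward hα (g + h) = pushforward hα g + pushforward hα h := by
  funext a
  exact finsum_mem_add_distrib' (finite_times_inter_support hg a) (finite_times_inter_support hh a)

lemma pushforward_smul {g : Y × ℝ → ℂ} (hg : HasCompactSupport g) (c : ℂ) :
    pushforward hα (c • g) = c • pushforward hα g := by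
  funext a
  exact ((AddMonoidHom.mulLeft c).map_finsum_mem' (finite_times_inter_support hg a)).symm

lemma pushforward_sum {n : ℕ} {g : Fin n → Y × ℝ → ℂ} (hg : ∀ i, HasCompactSupport (g i)) :
    pushforward hα (fun x => ∑ i, g i x) = fun a => ∑ i, pushforward hα (g i) a := by
  induction n with
  | zero =>
    funext a
    simp [pushforward]
  | succ n ih =>
    have h : HasCompactSupport fun x => ∑ i : Fin n, g i.succ x :=
      .intro (isCompact_iUnion fun i => (hg i).isCompact) fun x hx => by
        refine Finset.sum_eq_zero fun i _ => ?_
        by_contra h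
        exact hx (mem_iUnion.2 ⟨i.succ, subset_tsupport _ h⟩)
    simp_rw [Fin.sum_univ_succ]
    rw [show (fun x => g 0 x + ∑ i : Fin n, g i.succ x) = g 0 + fun x => ∑ i : Fin n, g i.succ x
      from rfl, pushforward_add (hg 0) h, ih fun i => hg i.succ]
    rfl

section Small

variable {W : Set (Y × ℝ)} {g : Y × ℝ → ℂ}

/-- Only one preimage lies in `W`, so a single term of the fiber sum survives. -/
lemma pushforward_apply_of_injOn (hi : InjOn (canonicalMap hα) W) (h0 : ∀ x ∉ W, g x = 0)
    {x : Y × ℝ} (hx : x ∈ W) : pushforward hα g (canonicalMap hα x) = g x := by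
  have : times hα (canonicalMap hα x) ∩ Function.support (fun t => g (x.1, t)) =
      {x.2} ∩ Function.support fun t => g (x.1, t) := by
    ext t
    simp only [mem_inter_iff, Function.mem_support, mem_singleton_iff]
    refine and_congr_left fun ht => ⟨fun h => ?_, fun h => by rw [h]; rfl⟩
    have hW : (x.1, t) ∈ W := by
      by_contra h
      exact ht (h0 _ h)
    exact congrArg Prod.snd (hi hW hx h)
  rw [pushforward]
  refine (finsum_mem_inter_support_eq _ _ _ this).trans ?_
  simp

lemma pushforward_eq_zero (h0 : ∀ x ∉ W, g x = 0) {a : (flowFoliation α hα).Holonomy}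
    (ha : a ∉ canonicalMap hα '' W) : pushforward hα g a = 0 :=
  finsum_mem_eq_zero_of_forall_eq_zero fun _ ht => h0 _ fun h => ha ⟨_, h, ht⟩

end Small

/-- A continuous function with compact support in an open set on which the canonical map is
injective. -/
structure IsSmall (hα : ∀ y, ∃ t, α t y ≠ y) (W : Set (Y × ℝ)) (g : Y × ℝ → ℂ) : Prop where
  isOpen : IsOpen W
  injOn : InjOn (canonicalMap hα) W
  continuous : Continuous g
  hasCompactSupport : HasCompactSupport g
  subset : tsupport g ⊆ W

lemma IsSmall.eq_zero {W : Set (Y × ℝ)} {g : Y × ℝ → ℂ} (h : IsSmall hα W g) :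
    ∀ x ∉ W, g x = 0 := fun x hx => by
  by_contra h0
  exact hx (h.subset (subset_tsupport _ h0))

/-- Reduces statements about pushforwards to functions living where the canonical map is a
homeomorphism onto its image. The norms of the pieces add up exactly, so `L¹` estimates lose
nothing. -/
lemma exists_sum_small {g : Y × ℝ → ℂ} (hc : Continuous g) (hs : HasCompactSupport g) :
    ∃ (n : ℕ) (W : Fin n → Set (Y × ℝ)) (χ : Fin n → C(Y × ℝ, ℝ)),
      (∀ i, IsSmall hα (W i) fun x => χ i x * g x) ∧ (∀ i x, χ i x ∈ Icc (0 : ℝ) 1) ∧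
      (∀ x, ∑ i, (χ i x : ℂ) * g x = g x) ∧ ∀ x, ∑ i, χ i x * ‖g x‖ = ‖g x‖ := by
  obtain ⟨n, W, χ, h1, h2, h3, h4, -⟩ := exists_partition hs.isCompact
    (P := fun V => InjOn (canonicalMap hα) V) fun x _ => eventually_injOn_canonicalMap x
  refine ⟨n, W, χ, fun i => ⟨(h1 i).1, (h1 i).2, by fun_prop, hs.mul_left, ?_⟩, h4, fun x => ?_,
    fun x => ?_⟩
  · refine Subset.trans (closure_mono fun x hx => ?_) (h2 i)
    rw [Function.mem_support] at *
    exact fun h => hx (by simp [h])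
  · by_cases hx : x ∈ tsupport g
    · rw [← Finset.sum_mul, ← Complex.ofReal_sum, h3 x hx, Complex.ofReal_one, one_mul]
    · simp [image_eq_zero_of_notMem_tsupport hx]
  · by_cases hx : x ∈ tsupport g
    · rw [← Finset.sum_mul, h3 x hx, one_mul]
    · simp [image_eq_zero_of_notMem_tsupport hx]

/-- The pushforward is `g` transported to the image of `W`, an open set that is homeomorphic to `W`
and hence Hausdorff. -/
lemma IsSmall.pushforward_mem {W : Set (Y × ℝ)} {g : Y × ℝ → ℂ} (h : IsSmall hα W g) :
    pushforward hα g ∈ CcZero (flowFoliation α hα).Holonomy := by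
  have hq : IsOpenQuotientMap (fun x : W => (⟨canonicalMap hα x, x, x.2, rfl⟩ :
      canonicalMap hα '' W)) := by
    refine ⟨?_, ?_, ?_⟩
    · rintro ⟨_, x, hx, rfl⟩
      exact ⟨⟨x, hx⟩, rfl⟩
    · exact (continuous_canonicalMap.comp continuous_subtype_val).subtype_mk _
    · exact (isOpenMap_canonicalMap.comp h.isOpen.isOpenMap_subtype_val).subtype_mk _
  refine ⟨canonicalMap hα '' W, isOpenMap_canonicalMap _ h.isOpen,
    t2Space_image h.injOn h.isOpen Subset.rfl, fun a ha => pushforward_eq_zero h.eq_zero ha, ?_, ?_⟩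
  · refine hq.continuous_comp_iff.1 ((h.continuous.comp continuous_subtype_val).congr fun x => ?_)
    exact (pushforward_apply_of_injOn h.injOn h.eq_zero x.2).symm
  · have := t2Space_image h.injOn h.isOpen Subset.rfl
    refine .intro (K := Subtype.val ⁻¹' (canonicalMap hα '' tsupport g)) ?_ ?_
    · refine IsInducing.subtypeVal.isCompact_preimage' (h.hasCompactSupport.isCompact.image
        continuous_canonicalMap) ?_
      rw [Subtype.range_coe]
      exact image_mono h.subset
    · rintro ⟨_, x, hx, rfl⟩ hxK
      simp only
      rw [pushforward_apply_of_injOn h.injOn h.eq_zero hx]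
      by_contra h0
      exact hxK ⟨x, subset_tsupport _ h0, rfl⟩

lemma pushforward_mem {g : Y × ℝ → ℂ} (hc : Continuous g) (hs : HasCompactSupport g) :
    pushforward hα g ∈ Cc (flowFoliation α hα).Holonomy := by
  obtain ⟨n, W, χ, h1, -, h2, -⟩ := exists_sum_small (hα := hα) hc hs
  have : pushforward hα g = ∑ i, pushforward hα fun x => χ i x * g x := by
    rw [← funext h2, pushforward_sum fun i => (h1 i).hasCompactSupport]
    funext a
    simp [h2]
  rw [this]
  exact Submodule.sum_mem _ fun i _ => Submodule.subset_span (h1 i).pushforward_mem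

lemma locallyCompactSpace_holonomy : LocallyCompactSpace (flowFoliation α hα).Holonomy :=
  isOpenQuotientMap_canonicalMap.locallyCompactSpace

open Classical in
-- A partition of unity on the Hausdorff open set `U` cuts `f` into pieces supported in images of
-- sets `W i` on which the canonical map is injective; each piece is pulled back to `W i` and
-- extended by zero.
lemma exists_pushforward_eq_of_mem_CcZero {f : (flowFoliation α hα).Holonomy → ℂ}
    (hf : f ∈ CcZero (flowFoliation α hα).Holonomy) :
    ∃ g, Continuous g ∧ HasCompactSupport g ∧ pushforward hα g = f := by
  have := locallyCompactSpace_holonomy (hα := hα)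
  obtain ⟨U, hU, hT2, h0, hc, hs⟩ := hf
  have : LocallyCompactSpace U := hU.locallyCompactSpace
  obtain ⟨n, V, χ, hV, hχV, hχ1, -, hχs⟩ := exists_partition hs.isCompact
    (P := fun V => ∃ W, IsOpen W ∧ InjOn (canonicalMap hα) W ∧ canonicalMap hα '' W ⊆ U ∧
      V = Subtype.val ⁻¹' (canonicalMap hα '' W)) fun a _ => by
    obtain ⟨x, W, hx, hW, hxW, hi, hWU⟩ := exists_compact_image (hU.mem_nhds a.2)
    exact ⟨_, (isOpenMap_canonicalMap _ hW).preimage continuous_subtype_val, ⟨x, hxW, hx⟩,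
      W, hW, hi, hWU, rfl⟩
  choose hVo W hW hi hWU hVW using hV
  -- The partition functions exist only on `U`; the value `0` elsewhere agrees with `f`.
  let k : Fin n → (flowFoliation α hα).Holonomy → ℂ := fun i a =>
    if h : a ∈ U then χ i ⟨a, h⟩ * f a else 0
  let g : Fin n → Y × ℝ → ℂ := fun i x => if x ∈ W i then k i (canonicalMap hα x) else 0
  have hg : ∀ i, Continuous (g i) ∧ HasCompactSupport (g i) := by
    intro i
    let j : W i → U := fun x => ⟨canonicalMap hα x, hWU i ⟨x, x.2, rfl⟩⟩
    have hj : IsInducing j := by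
      have := (canonicalMap_homeo_image (hi i) (hW i)).isEmbedding.isInducing
      exact .of_comp ((continuous_canonicalMap.comp continuous_subtype_val).subtype_mk _)
        continuous_subtype_val this
    have hgj : (fun x : W i => g i x) = (fun a : U => χ i a * f a) ∘ j := by
      funext x
      simp only [g, k, x.2, if_true, Function.comp_apply, j]
      rw [dif_pos (hWU i ⟨x, x.2, rfl⟩)]
    refine continuous_of_mem_CcZero ⟨W i, hW i, inferInstance, fun x hx => if_neg hx, ?_, ?_⟩
    · rw [hgj]
      exact ((Complex.continuous_ofReal.comp (χ i).continuous).mul hc).comp hj.continuous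
    · rw [hgj]
      refine .intro (K := j ⁻¹' tsupport (χ i)) (hj.isCompact_preimage' (hχs i).isCompact ?_) ?_
      · intro a ha
        have := hχV i ha
        rw [hVW i] at this
        obtain ⟨x, hx, e⟩ := this
        exact ⟨⟨x, hx⟩, Subtype.ext e⟩
      · intro x hx
        simp [image_eq_zero_of_notMem_tsupport hx]
  have hgk : ∀ i, pushforward hα (g i) = k i := by
    intro i
    funext a
    have hg0 : ∀ x ∉ W i, g i x = 0 := fun x hx => if_neg hx
    by_cases ha : a ∈ canonicalMap hα '' W i
    · obtain ⟨x, hx, rfl⟩ := ha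
      rw [pushforward_apply_of_injOn (hi i) hg0 hx]
      exact if_pos hx
    · rw [pushforward_eq_zero hg0 ha]
      simp only [k]
      split_ifs with haU
      · rw [image_eq_zero_of_notMem_tsupport (f := χ i)]
        · simp
        · intro h
          have := hχV i h
          rw [hVW i] at this
          exact ha this
      · rfl
  refine ⟨fun x => ∑ i, g i x, continuous_finsetSum _ fun i _ => (hg i).1, ?_, ?_⟩
  · refine .intro (isCompact_iUnion fun i => (hg i).2.isCompact) fun x hx => ?_
    refine Finset.sum_eq_zero fun i _ => ?_
    by_contra h
    exact hx (mem_iUnion.2 ⟨i, subset_tsupport _ h⟩)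
  · rw [pushforward_sum fun i => (hg i).2]
    funext a
    simp only [hgk, k]
    by_cases ha : a ∈ U
    · simp only [ha, dif_pos]
      by_cases ht : (⟨a, ha⟩ : U) ∈ tsupport fun x : U => f x
      · rw [← Finset.sum_mul, ← Complex.ofReal_sum, hχ1 _ ht, Complex.ofReal_one, one_mul]
      · have : f a = 0 := image_eq_zero_of_notMem_tsupport (f := fun x : U => f x) ht
        simp [this]
    · simp [ha, h0 a ha]

/-- Extends the generators by linearity. Both the verification of the Haar axioms and the density of
the image of the crossed product rest on this. -/
lemma exists_pushforward_eq {f : (flowFoliation α hα).Holonomy → ℂ}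
    (hf : f ∈ Cc (flowFoliation α hα).Holonomy) :
    ∃ g, Continuous g ∧ HasCompactSupport g ∧ pushforward hα g = f := by
  induction hf using Submodule.span_induction with
  | mem f hf => exact exists_pushforward_eq_of_mem_CcZero hf
  | zero =>
    refine ⟨0, continuous_const, .zero, ?_⟩
    funext a
    exact finsum_mem_zero _
  | add f f' _ _ h h' =>
    obtain ⟨g, h1, h2, rfl⟩ := h
    obtain ⟨g', h1', h2', rfl⟩ := h'
    exact ⟨g + g', h1.add h1', h2.add h2', pushforward_add h2 h2'⟩
  | smul c f _ h =>
    obtain ⟨g, h1, h2, rfl⟩ := h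
    exact ⟨c • g, h1.const_smul c, h2.smul_left, pushforward_smul h2 c⟩

end FlowFoliation

lemma GroupoidStr.continuous_fiber_val {G : Type u} [TopologicalSpace G] (𝒢 : GroupoidStr G) (u : G) :
    Continuous fun x : 𝒢.Fiber u => x.1 := continuous_subtype_val

/-! ### Measures on the range fibers that are intertwined with Lebesgue measure -/

namespace FlowFoliation

open LineFoliation

variable {Y : Type u} [TopologicalSpace Y] {α : Flow ℝ Y}
variable [TopologicalSpace.MetrizableSpace Y] [LocallyCompactSpace Y]
variable {hα : ∀ y, ∃ t, α t y ≠ y}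
variable {lam : (flowFoliation α hα).holonomyGroupoid.FiberMeasures}
variable {W : Set (Y × ℝ)} {g : Y × ℝ → ℂ} {u : (flowFoliation α hα).Holonomy}

/-- The canonical map intertwines the Lebesgue system and `lam`. -/
abbrev IntertwinesLebesgue (lam : (flowFoliation α hα).holonomyGroupoid.FiberMeasures) : Prop :=
  (isFiberwiseCovering_canonicalMap (hα := hα)).Intertwines (lebesgueSystem α) lam

lemma measurableEmbedding_fiberParam (hu : u ∈ (flowFoliation α hα).holonomyGroupoid.units)
    {E : Set ℝ} (hE : IsOpen E) (hi : InjOn (fiberParam hα hu) E) :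
    MeasurableEmbedding fun t : E => fiberParam hα hu t :=
  have h := isOpenQuotientMap_fiberParam hu
  (IsOpenEmbedding.of_continuous_injective_isOpenMap (h.continuous.comp continuous_subtype_val)
    (injOn_iff_injective.1 hi) (h.isOpenMap.domRestrict hE)).measurableEmbedding

lemma map_fiberMap_lebesgueSystem (y : Y) (hW : IsOpen W) :
    ((lebesgueSystem α (y, 0)).restrict {x | x.1 ∈ W}).map
        ((isFiberwiseCovering_canonicalMap (hα := hα)).fiberMap (y, 0)) =
      ((volume : Measure ℝ).restrict {t | (y, t) ∈ W}).map
        (fiberParam hα (canonicalMap_zero_mem_units y)) := by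
  have hy : (y, (0 : ℝ)) ∈ (transformationGroupoid α).units := rfl
  rw [lebesgueSystem_eq_map hy]
  have hA : MeasurableSet {x : (transformationGroupoid α).Fiber (y, (0 : ℝ)) | x.1 ∈ W} :=
    (hW.preimage (GroupoidStr.continuous_fiber_val _ _)).measurableSet
  have hm : Continuous ((isFiberwiseCovering_canonicalMap (hα := hα)).fiberMap (y, (0 : ℝ))) :=
    (continuous_canonicalMap.comp continuous_subtype_val).subtype_mk _
  have hs := (transFiberHomeo (α := α) hy).symm.continuous.measurable
  rw [Measure.restrict_map hs hA, Measure.map_map hm.measurable hs]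
  rfl

/-- The intertwining condition read on `ℝ`: over an injectivity set, `lam u` is the image of
Lebesgue measure. -/
lemma restrict_eq_map (hI : IntertwinesLebesgue lam)
    (hu : u ∈ (flowFoliation α hα).holonomyGroupoid.units) (hW : IsOpen W)
    (hi : InjOn (canonicalMap hα) W) :
    (lam u).restrict {z | z.1 ∈ canonicalMap hα '' W} =
      ((volume : Measure ℝ).restrict {t | (u.start, t) ∈ W}).map (fiberParam hα hu) := by
  obtain ⟨y, rfl⟩ : ∃ y, u = canonicalMap hα (y, 0) := ⟨_, (mem_units_iff.1 hu).symm⟩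
  have hy : (y, (0 : ℝ)) ∈ (transformationGroupoid α).units := rfl
  rw [← hI (y, 0) hy W hW (canonicalMap_homeo_image hi hW).isEmbedding]
  exact map_fiberMap_lebesgueSystem y hW

/-- On the subtype `fiberParam` is injective, hence a measurable embedding, so the change of
variables formulas hold for arbitrary integrands. -/
lemma restrict_eq_map_subtype (hI : IntertwinesLebesgue lam)
    (hu : u ∈ (flowFoliation α hα).holonomyGroupoid.units)
    (hW : IsOpen W) (hi : InjOn (canonicalMap hα) W) :
    (lam u).restrict {z | z.1 ∈ canonicalMap hα '' W} =
      ((volume : Measure ℝ).comap (Subtype.val : {t | (u.start, t) ∈ W} → ℝ)).map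
        fun t : {t : ℝ | (u.start, t) ∈ W} => fiberParam hα hu t.1 := by
  have hE : IsOpen {t | (u.start, t) ∈ W} := hW.preimage (Continuous.prodMk_right _)
  rw [restrict_eq_map hI hu hW hi, ← map_comap_subtype_coe hE.measurableSet,
    Measure.map_map (isOpenQuotientMap_fiberParam hu).continuous.measurable measurable_subtype_coe]
  rfl

lemma injOn_fiberParam (hu : u ∈ (flowFoliation α hα).holonomyGroupoid.units)
    (hi : InjOn (canonicalMap hα) W) : InjOn (fiberParam hα hu) {t | (u.start, t) ∈ W} :=
  fun _ hs _ ht h => congrArg Prod.snd (hi hs ht (congrArg Subtype.val h))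

lemma integral_eq_setIntegral (hI : IntertwinesLebesgue lam)
    (hu : u ∈ (flowFoliation α hα).holonomyGroupoid.units)
    (hW : IsOpen W) (hi : InjOn (canonicalMap hα) W)
    {G : (flowFoliation α hα).holonomyGroupoid.Fiber u → ℂ}
    (hG : ∀ z, z.1 ∉ canonicalMap hα '' W → G z = 0) :
    ∫ z, G z ∂lam u = ∫ t in {t | (u.start, t) ∈ W}, G (fiberParam hα hu t) := by
  have hE : IsOpen {t | (u.start, t) ∈ W} := hW.preimage (Continuous.prodMk_right _)
  rw [← setIntegral_eq_integral_of_forall_compl_eq_zero (s := {z | z.1 ∈ canonicalMap hα '' W}) hG,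
    restrict_eq_map_subtype hI hu hW hi,
    (measurableEmbedding_fiberParam hu hE (injOn_fiberParam hu hi)).integral_map]
  exact integral_subtype_comap hE.measurableSet fun t => G (fiberParam hα hu t)

lemma lintegral_eq_setLIntegral (hI : IntertwinesLebesgue lam)
    (hu : u ∈ (flowFoliation α hα).holonomyGroupoid.units)
    (hW : IsOpen W) (hi : InjOn (canonicalMap hα) W)
    {G : (flowFoliation α hα).holonomyGroupoid.Fiber u → ENNReal}
    (hG : ∀ z, z.1 ∉ canonicalMap hα '' W → G z = 0) :
    ∫⁻ z, G z ∂lam u = ∫⁻ t in {t | (u.start, t) ∈ W}, G (fiberParam hα hu t) := by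
  have hE : IsOpen {t | (u.start, t) ∈ W} := hW.preimage (Continuous.prodMk_right _)
  have hA : MeasurableSet {z : (flowFoliation α hα).holonomyGroupoid.Fiber u |
      z.1 ∈ canonicalMap hα '' W} :=
    ((isOpenMap_canonicalMap _ hW).preimage (GroupoidStr.continuous_fiber_val _ _)).measurableSet
  rw [← setLIntegral_eq_of_support_subset (s := {z | z.1 ∈ canonicalMap hα '' W})
    (fun z hz => by by_contra h; exact hz (hG z h)),
    restrict_eq_map_subtype hI hu hW hi,
    (measurableEmbedding_fiberParam hu hE (injOn_fiberParam hu hi)).lintegral_map]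
  exact lintegral_subtype_comap hE.measurableSet fun t => G (fiberParam hα hu t)

lemma integrable_of_integrableOn (hI : IntertwinesLebesgue lam)
    (hu : u ∈ (flowFoliation α hα).holonomyGroupoid.units)
    (hW : IsOpen W) (hi : InjOn (canonicalMap hα) W)
    {G : (flowFoliation α hα).holonomyGroupoid.Fiber u → ℂ}
    (hG : ∀ z, z.1 ∉ canonicalMap hα '' W → G z = 0)
    (h : IntegrableOn (fun t => G (fiberParam hα hu t)) {t | (u.start, t) ∈ W}) :
    Integrable G (lam u) := by
  have hE : IsOpen {t | (u.start, t) ∈ W} := hW.preimage (Continuous.prodMk_right _)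
  rw [← integrableOn_iff_integrable_of_support_subset
    (s := {z | z.1 ∈ canonicalMap hα '' W}) (fun z hz => by by_contra h; exact hz (hG z h)),
    IntegrableOn, restrict_eq_map_subtype hI hu hW hi,
    (measurableEmbedding_fiberParam hu hE (injOn_fiberParam hu hi)).integrable_map_iff]
  exact (integrableOn_iff_comap_subtypeVal hE.measurableSet).1 h

end FlowFoliation

/-! ### Convolution and adjoint on the two groupoids -/

namespace FlowFoliation

open LineFoliation

variable {Y : Type u} [TopologicalSpace Y] {α : Flow ℝ Y}

variable (α) in
/-- The convolution of functions on `Y ⋊ ℝ`. -/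
def flowConv (g h : Y × ℝ → ℂ) (x : Y × ℝ) : ℂ := ∫ s, g (x.1, s) * h (α (-s) x.1, x.2 - s)

variable (α) in
/-- The adjoint of a function on `Y ⋊ ℝ`. -/
def flowStar (g : Y × ℝ → ℂ) (x : Y × ℝ) : ℂ := star (g (α (-x.2) x.1, -x.2))

variable (α) in
/-- The homeomorphism `(y, t) ↦ (α s y, s + t)`. -/
def flowShift (s : ℝ) : Y × ℝ ≃ₜ Y × ℝ :=
  (α.toHomeomorph s).prodCongr (Homeomorph.addLeft s)

@[simp] lemma flowShift_apply (s : ℝ) (x : Y × ℝ) : flowShift α s x = (α s x.1, s + x.2) := rfl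

variable (α) in
/-- The inversion of `Y ⋊ ℝ`. -/
def flowInv : Y × ℝ ≃ₜ Y × ℝ where
  toFun x := (α (-x.2) x.1, -x.2)
  invFun x := (α (-x.2) x.1, -x.2)
  left_inv x := by simp [← Flow.map_add]
  right_inv x := by simp [← Flow.map_add]
  continuous_toFun := isTopological_transformationGroupoid.continuous_inv
  continuous_invFun := isTopological_transformationGroupoid.continuous_inv

lemma continuous_flowStar {g : Y × ℝ → ℂ} (hg : Continuous g) : Continuous (flowStar α g) :=
  continuous_star.comp (hg.comp (flowInv α).continuous)

lemma hasCompactSupport_flowStar {g : Y × ℝ → ℂ} (hg : HasCompactSupport g) :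
    HasCompactSupport (flowStar α g) :=
  (hg.comp_homeomorph (flowInv α)).comp_left (star_zero _)

lemma continuous_flowConv_integrand {g h : Y × ℝ → ℂ} (hg : Continuous g) (hh : Continuous h) :
    Continuous fun p : (Y × ℝ) × ℝ => g (p.1.1, p.2) * h (α (-p.2) p.1.1, p.1.2 - p.2) := by
  refine (hg.comp (by fun_prop)).mul (hh.comp (.prodMk ?_ (by fun_prop)))
  exact α.continuous (by fun_prop) (by fun_prop)

lemma hasCompactSupport_flowConv_integrand [T2Space Y] {g h : Y × ℝ → ℂ}
    (hg : HasCompactSupport g) (hh : HasCompactSupport h) :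
    HasCompactSupport fun p : (Y × ℝ) × ℝ =>
      g (p.1.1, p.2) * h (α (-p.2) p.1.1, p.1.2 - p.2) := by
  -- A nonzero value at `((y, t), s)` puts `(y, s)` in the support of `g` and `t - s` in the time
  -- projection of that of `h`; the map recovers the point from these.
  refine .intro ((hg.isCompact.prod (hh.isCompact.image continuous_snd)).image
    (f := fun q : (Y × ℝ) × ℝ => ((q.1.1, q.1.2 + q.2), q.1.2)) (by fun_prop)) fun p hp => ?_
  by_contra h0
  obtain ⟨h1, h2⟩ := mul_ne_zero_iff.1 h0
  exact hp ⟨((p.1.1, p.2), p.1.2 - p.2), ⟨subset_tsupport _ h1, _, subset_tsupport _ h2, rfl⟩,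
    by simp⟩

variable [TopologicalSpace.MetrizableSpace Y] [LocallyCompactSpace Y]
variable {hα : ∀ y, ∃ t, α t y ≠ y}
variable {lam : (flowFoliation α hα).holonomyGroupoid.FiberMeasures}
variable {W : Set (Y × ℝ)} {g h : Y × ℝ → ℂ} {u : (flowFoliation α hα).Holonomy}

lemma continuous_flowConv (hg : Continuous g) (hh : Continuous h) (hg' : HasCompactSupport g)
    (hh' : HasCompactSupport h) :
    Continuous (flowConv α g h) ∧ HasCompactSupport (flowConv α g h) :=
  continuous_integral_slice (continuous_flowConv_integrand hg hh)
    (hasCompactSupport_flowConv_integrand hg' hh')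

lemma mem_times {y : Y} {t r : ℝ} :
    t ∈ times hα (canonicalMap hα (y, r)) ↔ t - r ∈ holonomyKernel hα y :=
  canonicalMap_eq_iff_sub_mem

/-- Left multiplication by the class of `(y, s)`, which is undone by left multiplication by the
class of `(α (-s) y, -s)`. -/
lemma mem_times_comp {y : Y} {s t r : ℝ} :
    t ∈ times hα (canonicalMap hα (α (-s) y, r)) ↔
      s + t ∈ times hα (canonicalMap hα (y, s + r)) := by
  constructor
  · intro ht
    change canonicalMap hα (y, s + t) = _
    change canonicalMap hα (α (-s) y, t) = _ at ht
    rw [← comp_canonicalMap, ht, comp_canonicalMap]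
  · intro ht
    change canonicalMap hα (y, s + t) = _ at ht
    change canonicalMap hα (α (-s) y, t) = _
    have e : α (- -s) (α (-s) y) = y := by simp [← Flow.map_add]
    have h1 := comp_canonicalMap (hα := hα) (α (-s) y) (-s) (s + t)
    have h2 := comp_canonicalMap (hα := hα) (α (-s) y) (-s) (s + r)
    rw [e, neg_add_cancel_left] at h1 h2
    rw [← h1, ← h2, ht]

lemma mem_times_inv {a : (flowFoliation α hα).Holonomy} {t : ℝ} :
    t ∈ times hα a.inv ↔ -t ∈ times hα a := by
  obtain ⟨⟨y, r⟩, rfl⟩ := canonicalMap_surjective a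
  rw [inv_canonicalMap, mem_times_comp, mem_times, add_neg_cancel, sub_zero, mem_times]
  rw [← neg_mem_iff]
  ring_nf

lemma finsum_mem_times_add (y : Y) (s r : ℝ) (f : ℝ → ℂ) :
    ∑ᶠ t ∈ times hα (canonicalMap hα (y, s + r)), f t =
      ∑ᶠ t ∈ times hα (canonicalMap hα (α (-s) y, r)), f (s + t) := by
  symm
  refine finsum_mem_eq_of_bijOn (s + ·) ⟨fun t ht => mem_times_comp.1 ht,
    (add_right_injective s).injOn, fun t ht => ⟨t - s, ?_, by simp⟩⟩ fun _ _ => rfl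
  rw [mem_times_comp]
  simpa using ht

lemma pushforward_comp_flowShift (y : Y) (s r : ℝ) :
    pushforward hα g (canonicalMap hα (y, s + r)) =
      pushforward hα (g ∘ flowShift α s) (canonicalMap hα (α (-s) y, r)) := by
  simp only [pushforward, start_canonicalMap, Function.comp_apply, flowShift_apply]
  rw [finsum_mem_times_add]
  simp [← Flow.map_add]

/-- Negation exchanges the times of a class and those of its inverse. Conjugation is an additive
equivalence, so it passes through `finsum` with no finiteness needed. -/
lemma pushforward_flowStar (a : (flowFoliation α hα).Holonomy) :
    pushforward hα (flowStar α g) a = star (pushforward hα g a.inv) := by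
  have h : star (pushforward hα g a.inv) =
      ∑ᶠ t ∈ times hα a.inv, star (g (a.inv.start, t)) :=
    ((starAddEquiv (R := ℂ)).map_finsum _).trans
      (finsum_congr fun _ => (starAddEquiv (R := ℂ)).map_finsum _)
  rw [pushforward]
  refine Eq.trans ?_ h.symm
  refine finsum_mem_eq_of_bijOn Neg.neg ⟨fun t ht => ?_, neg_injective.injOn, fun t ht =>
    ⟨-t, mem_times_inv.1 ht, neg_neg t⟩⟩ fun t ht => ?_
  · rw [mem_times_inv, neg_neg]; exact ht
  · have := congrArg Holonomy.finish (show canonicalMap hα (a.start, t) = a from ht)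
    rw [finish_canonicalMap] at this
    rw [Holonomy.start_inv, ← this]
    rfl

section Intertwine

lemma pushforward_fiberParam_of_injOn
    (hu : u ∈ (flowFoliation α hα).holonomyGroupoid.units)
    (hi : InjOn (canonicalMap hα) W) (h0 : ∀ x ∉ W, g x = 0)
    {t : ℝ} (ht : (u.start, t) ∈ W) : pushforward hα g (fiberParam hα hu t).1 = g (u.start, t) :=
  pushforward_apply_of_injOn hi h0 ht

/-- Integrals against a pushforward along the canonical map. -/
lemma integral_pushforward_mul (hI : IntertwinesLebesgue lam)
    (hu : u ∈ (flowFoliation α hα).holonomyGroupoid.units)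
    (hg : Continuous g) (hg' : HasCompactSupport g)
    {k : (flowFoliation α hα).holonomyGroupoid.Fiber u → ℂ}
    (hk : Integrable fun t => g (u.start, t) * k (fiberParam hα hu t)) :
    Integrable (fun z => pushforward hα g z.1 * k z) (lam u) ∧
      ∫ z, pushforward hα g z.1 * k z ∂lam u = ∫ t, g (u.start, t) * k (fiberParam hα hu t) := by
  -- Each piece of `g` lives on an injectivity set, where the change of variables holds for
  -- arbitrary `k`; the pieces are integrable because the weights are bounded by `1`.
  obtain ⟨n, W, χ, h1, h2, h3, -⟩ := exists_sum_small (hα := hα) hg hg'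
  have hG : ∀ i (z : (flowFoliation α hα).holonomyGroupoid.Fiber u),
      z.1 ∉ canonicalMap hα '' W i → pushforward hα (fun x => χ i x * g x) z.1 * k z = 0 :=
    fun i z hz => by rw [pushforward_eq_zero (h1 i).eq_zero hz, zero_mul]
  have hval : ∀ i, EqOn (fun t => pushforward hα (fun x => χ i x * g x) (fiberParam hα hu t).1 *
      k (fiberParam hα hu t)) (fun t => χ i (u.start, t) * (g (u.start, t) *
        k (fiberParam hα hu t))) {t | (u.start, t) ∈ W i} := fun i t ht => by
    simp only
    rw [pushforward_fiberParam_of_injOn hu (h1 i).injOn (h1 i).eq_zero ht, mul_assoc]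
  have hE : ∀ i, MeasurableSet {t | (u.start, t) ∈ W i} := fun i =>
    ((h1 i).isOpen.preimage (Continuous.prodMk_right _)).measurableSet
  have hint : ∀ i, Integrable fun t => (χ i (u.start, t) : ℂ) * (g (u.start, t) *
      k (fiberParam hα hu t)) := fun i => by
    refine hk.bdd_mul (c := 1) (Continuous.aestronglyMeasurable (by fun_prop)) ?_
    refine .of_forall fun t => ?_
    have := h2 i (u.start, t)
    simp [abs_of_nonneg this.1, this.2]
  have hI' : ∀ i, Integrable (fun z : (flowFoliation α hα).holonomyGroupoid.Fiber u =>
      pushforward hα (fun x => χ i x * g x) z.1 * k z) (lam u) := fun i => by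
    refine integrable_of_integrableOn hI hu (h1 i).isOpen (h1 i).injOn (hG i) ?_
    exact ((hint i).integrableOn).congr_fun (hval i).symm (hE i)
  have hsum : ∀ z : (flowFoliation α hα).holonomyGroupoid.Fiber u, pushforward hα g z.1 * k z =
      ∑ i, pushforward hα (fun x => χ i x * g x) z.1 * k z := fun z => by
    rw [← Finset.sum_mul, ← congrFun (pushforward_sum fun i => (h1 i).hasCompactSupport) z.1]
    simp_rw [h3]
  simp_rw [hsum]
  refine ⟨integrable_finsetSum _ fun i _ => hI' i, ?_⟩
  rw [integral_finsetSum _ fun i _ => hI' i]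
  have : ∀ i, ∫ z, pushforward hα (fun x => χ i x * g x) z.1 * k z ∂lam u =
      ∫ t, (χ i (u.start, t) : ℂ) * (g (u.start, t) * k (fiberParam hα hu t)) := fun i => by
    rw [integral_eq_setIntegral hI hu (h1 i).isOpen (h1 i).injOn (hG i),
      setIntegral_congr_fun (hE i) (hval i)]
    refine setIntegral_eq_integral_of_forall_compl_eq_zero fun t ht => ?_
    rw [← mul_assoc, (h1 i).eq_zero _ ht, zero_mul]
  simp_rw [this]
  rw [← integral_finsetSum _ fun i _ => hint i]
  refine integral_congr_ae (.of_forall fun t => ?_)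
  simp_rw [← mul_assoc]
  rw [← Finset.sum_mul, h3]

lemma integral_pushforward (hI : IntertwinesLebesgue lam)
    (hu : u ∈ (flowFoliation α hα).holonomyGroupoid.units)
    (hg : Continuous g) (hg' : HasCompactSupport g) :
    ∫ z, pushforward hα g z.1 ∂lam u = ∫ t, g (u.start, t) := by
  have := (integral_pushforward_mul hI hu hg hg' (k := 1)
    (by simpa using integrable_slice hg hg' u.start)).2
  simpa using this

/-- The triangle inequality over small pieces, whose `L¹` norms recombine exactly. Equality can
fail, since terms over the same class may cancel. -/
lemma lintegral_pushforward_le (hI : IntertwinesLebesgue lam)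
    (hu : u ∈ (flowFoliation α hα).holonomyGroupoid.units)
    (hg : Continuous g) (hg' : HasCompactSupport g) :
    ∫⁻ z, ‖pushforward hα g z.1‖ₑ ∂lam u ≤ ∫⁻ t, ‖g (u.start, t)‖ₑ := by
  obtain ⟨n, W, χ, h1, h2, h3, h4⟩ := exists_sum_small (hα := hα) hg hg'
  have hm : ∀ i, AEMeasurable (fun z : (flowFoliation α hα).holonomyGroupoid.Fiber u =>
      ‖pushforward hα (fun x => χ i x * g x) z.1‖ₑ) (lam u) := fun i => by
    have := (integral_pushforward_mul hI hu (k := 1) (h1 i).continuous (h1 i).hasCompactSupport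
      (by simpa using integrable_slice (h1 i).continuous (h1 i).hasCompactSupport u.start)).1
    simpa using this.aestronglyMeasurable.enorm
  have hE : ∀ i, MeasurableSet {t | (u.start, t) ∈ W i} := fun i =>
    ((h1 i).isOpen.preimage (Continuous.prodMk_right _)).measurableSet
  calc ∫⁻ z, ‖pushforward hα g z.1‖ₑ ∂lam u
      ≤ ∫⁻ z, ∑ i, ‖pushforward hα (fun x => χ i x * g x) z.1‖ₑ ∂lam u := by
        refine lintegral_mono fun z => ?_
        have : pushforward hα g z.1 = ∑ i, pushforward hα (fun x => χ i x * g x) z.1 := by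
          rw [← congrFun (pushforward_sum fun i => (h1 i).hasCompactSupport) z.1]
          simp_rw [h3]
        rw [this]
        exact enorm_sum_le _ _
    _ = ∑ i, ∫⁻ z, ‖pushforward hα (fun x => χ i x * g x) z.1‖ₑ ∂lam u :=
        lintegral_finsetSum' _ fun i _ => hm i
    _ ≤ ∑ i, ∫⁻ t, ‖(χ i (u.start, t) : ℂ) * g (u.start, t)‖ₑ := by
        refine Finset.sum_le_sum fun i _ => ?_
        rw [lintegral_eq_setLIntegral hI hu (h1 i).isOpen (h1 i).injOn fun z hz => by
          rw [pushforward_eq_zero (h1 i).eq_zero hz, enorm_zero],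
          setLIntegral_congr_fun (hE i) (fun t ht => by
            rw [pushforward_fiberParam_of_injOn hu (h1 i).injOn (h1 i).eq_zero ht])]
        exact setLIntegral_le_lintegral _ _
    _ = ∫⁻ t, ∑ i, ‖(χ i (u.start, t) : ℂ) * g (u.start, t)‖ₑ := by
        refine (lintegral_finsetSum _ fun i _ => ?_).symm
        fun_prop
    _ = ∫⁻ t, ‖g (u.start, t)‖ₑ := by
        refine lintegral_congr fun t => ?_
        rw [← ofReal_norm, ← h4 (u.start, t), ENNReal.ofReal_sum_of_nonneg fun i _ =>
          mul_nonneg (h2 i _).1 (norm_nonneg _)]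
        refine Finset.sum_congr rfl fun i _ => ?_
        rw [← ofReal_norm, norm_mul, Complex.norm_real, Real.norm_of_nonneg (h2 i _).1]

/-- On each fiber the function is bounded by `M` on an interval of length `2 * R`. The second
supremum in the `I`-norm is the first one for `flowStar α g`. -/
lemma iNorm_pushforward_le (hI : IntertwinesLebesgue lam) (hg : Continuous g) (hg' : HasCompactSupport g) {M R : ℝ}
    (hM : ∀ x, ‖g x‖ ≤ M) (hR : ∀ x, R < |x.2| → g x = 0) :
    GroupoidStr.iNorm lam (pushforward hα g) ≤ ENNReal.ofReal (2 * R * M) := by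
  have key : ∀ g : Y × ℝ → ℂ, Continuous g → HasCompactSupport g → (∀ x, ‖g x‖ ≤ M) →
      (∀ x, R < |x.2| → g x = 0) → ∀ u ∈ (flowFoliation α hα).holonomyGroupoid.units,
      ∫⁻ z, ‖pushforward hα g z.1‖ₑ ∂lam u ≤ ENNReal.ofReal (2 * R * M) := by
    intro g hg hg' hM hR u hu
    refine (lintegral_pushforward_le hI hu hg hg').trans ?_
    have hM0 : 0 ≤ M := (norm_nonneg _).trans (hM (u.start, 0))
    calc ∫⁻ t, ‖g (u.start, t)‖ₑ ≤ ∫⁻ t, (Icc (-R) R).indicator (fun _ => ENNReal.ofReal M) t := by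
          refine lintegral_mono fun t => ?_
          simp only [indicator]
          split_ifs with ht
          · rw [← ofReal_norm]
            exact ENNReal.ofReal_le_ofReal (hM _)
          · rw [hR, enorm_zero]
            by_contra h
            exact ht (abs_le.1 (not_lt.1 h))
      _ = ENNReal.ofReal (2 * R * M) := by
          rw [lintegral_indicator_const measurableSet_Icc, Real.volume_Icc, mul_comm,
            ← ENNReal.ofReal_mul' hM0]
          congr 2
          ring
  refine max_le (iSup₂_le fun u hu => key g hg hg' hM hR u hu) (iSup₂_le fun u hu => ?_)
  refine le_trans (lintegral_mono fun z => ?_) (key _ (continuous_flowStar (α := α) hg)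
    (hasCompactSupport_flowStar hg') (fun x => ?_) (fun x hx => ?_) u hu)
  · rw [pushforward_flowStar]
    rw [← ofReal_norm, ← ofReal_norm, norm_star]
    rfl
  · rw [flowStar, norm_star]
    exact hM _
  · rw [flowStar, hR _ (by simpa using hx), star_zero]

/-- Every test function is a pushforward, so its fiber integrals are Lebesgue integrals of slices.
These depend continuously on the unit, and left invariance becomes translation invariance via
`flowShift`. -/
lemma isHaarSystem_of_intertwines (hI : IntertwinesLebesgue lam)
    (h1 : ∀ u ∈ (flowFoliation α hα).holonomyGroupoid.units, (lam u).Regular)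
    (h2 : ∀ u ∈ (flowFoliation α hα).holonomyGroupoid.units, (lam u).IsOpenPosMeasure) :
    GroupoidStr.IsHaarSystem lam where
  regular := h1
  full_support := h2
  continuous f hf := by
    obtain ⟨g, hg, hg', rfl⟩ := exists_pushforward_eq hf
    obtain ⟨h1, h2⟩ := continuous_integral_slice hg hg'
    have : T2Space (flowFoliation α hα).holonomyGroupoid.units :=
      isLocallyCompact_holonomyGroupoid.units_t2
    convert mem_Cc_comp_homeomorph ((unitsHomeo hα).symm.trans (unitsHomeoBase α)) h1 h2 using 1
    funext u
    rw [integral_pushforward hI u.2 hg hg']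
    rfl
  left_invariant f hf x := by
    obtain ⟨g, hg, hg', rfl⟩ := exists_pushforward_eq hf
    obtain ⟨⟨y, s⟩, rfl⟩ := canonicalMap_surjective x
    have hd : (flowFoliation α hα).holonomyGroupoid.d (canonicalMap hα (y, s)) ∈
      (flowFoliation α hα).holonomyGroupoid.units := rfl
    have hr : (flowFoliation α hα).holonomyGroupoid.r (canonicalMap hα (y, s)) ∈
      (flowFoliation α hα).holonomyGroupoid.units := rfl
    rw [integral_pushforward hI hr hg hg']
    have : ∀ z : (flowFoliation α hα).holonomyGroupoid.Fiber
        ((flowFoliation α hα).holonomyGroupoid.d (canonicalMap hα (y, s))),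
        pushforward hα g ((flowFoliation α hα).holonomyGroupoid.mul (canonicalMap hα (y, s)) z.1
          z.2.symm) = pushforward hα (g ∘ flowShift α s) z.1 := fun z => by
      obtain ⟨⟨y', r⟩, hz⟩ := canonicalMap_surjective z.1
      have h := start_of_fiber z
      rw [← hz, holonomyGroupoid_d, finish_canonicalMap] at h
      change y' = α (-s) y at h
      subst h
      rw [holonomyGroupoid_mul, ← hz, comp_canonicalMap, pushforward_comp_flowShift]
    simp_rw [this]
    rw [integral_pushforward hI hd (hg.comp (flowShift α s).continuous)
      (hg'.comp_homeomorph _), holonomyGroupoid_d, holonomyGroupoid_r, finish_canonicalMap]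
    change ∫ t, g (α s (α (-s) y), s + t) = ∫ t, g (y, t)
    simp only [← Flow.map_add, add_neg_cancel, Flow.map_zero_apply]
    exact integral_add_left_eq_self (fun t => g (y, t)) s

/-- Both sides integrate over `s` and sum over the times `r` of the class the quantity `g (y, s) * h
(α (-s) y, r - s)`; the point is to interchange the integral with the sum. -/
lemma conv_pushforward (hI : IntertwinesLebesgue lam) (hg : Continuous g) (hg' : HasCompactSupport g) (hh : Continuous h)
    (hh' : HasCompactSupport h) :
    GroupoidStr.conv lam (pushforward hα g) (pushforward hα h) =
      pushforward hα (flowConv α g h) := by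
  funext a
  obtain ⟨⟨y, t⟩, rfl⟩ := canonicalMap_surjective a
  obtain ⟨A, hA⟩ := (hg'.isCompact.image continuous_snd).isBounded.exists_norm_le
  obtain ⟨B, hB⟩ := (hh'.isCompact.image continuous_snd).isBounded.exists_norm_le
  have hr : (flowFoliation α hα).holonomyGroupoid.r (canonicalMap hα (y, t)) ∈
      (flowFoliation α hα).holonomyGroupoid.units := rfl
  -- `A` and `B` bound the times in the supports of `g` and `h`, so only times with `|r| ≤ A + B`
  -- contribute. They form a finite set independent of `s`, and the interchange involves a finite
  -- sum only.
  have hP := finite_times_inter (hα := hα)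
    (isCompact_singleton.prod (isCompact_Icc (a := -(A + B)) (b := A + B)) :
      IsCompact ({y} ×ˢ _)) (canonicalMap hα (y, t))
  set P := hP.toFinset
  have hz : ∀ s r, g (y, s) * h (α (-s) y, r - s) ≠ 0 →
      (y, r) ∈ ({y} : Set Y) ×ˢ Icc (-(A + B)) (A + B) := fun s r h0 => by
    obtain ⟨h1, h2⟩ := mul_ne_zero_iff.1 h0
    have a1 := hA s ⟨_, subset_tsupport _ h1, rfl⟩
    have a2 := hB (r - s) ⟨_, subset_tsupport _ h2, rfl⟩
    rw [Real.norm_eq_abs, abs_le] at a1 a2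
    exact ⟨rfl, by constructor <;> linarith [a1.1, a1.2, a2.1, a2.2]⟩
  have hsum : ∀ f : ℝ → ℂ, (∀ r, f r ≠ 0 → (y, r) ∈ ({y} : Set Y) ×ˢ Icc (-(A + B)) (A + B)) →
      ∑ᶠ r ∈ times hα (canonicalMap hα (y, t)), f r = ∑ r ∈ P, f r := fun f hf => by
    refine finsum_mem_eq_sum_of_inter_support_eq _ ?_
    ext r
    simp only [P, mem_inter_iff, Function.mem_support, Finite.coe_toFinset, mem_ofPred_eq,
      start_canonicalMap]
    exact ⟨fun ⟨h1, h2⟩ => ⟨⟨h1, hf r h2⟩, h2⟩, fun ⟨⟨h1, _⟩, h2⟩ => ⟨h1, h2⟩⟩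
  have hk : ∀ s, g (y, s) * pushforward hα h (canonicalMap hα (α (-s) y, t - s)) =
      ∑ r ∈ P, g (y, s) * h (α (-s) y, r - s) := fun s => by
    have := finsum_mem_times_add (hα := hα) y s (t - s) fun r => g (y, s) * h (α (-s) y, r - s)
    simp only [add_sub_cancel, add_sub_cancel_left] at this
    rw [hsum _ fun r hr => hz s r hr] at this
    rw [this]
    exact (AddMonoidHom.mulLeft (g (y, s))).map_finsum_mem'
      (finite_times_inter_support hh' (canonicalMap hα (α (-s) y, t - s)))
  have hint : ∀ r, Integrable fun s => g (y, s) * h (α (-s) y, r - s) := fun r =>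
    integrable_slice (continuous_flowConv_integrand hg hh)
      (hasCompactSupport_flowConv_integrand hg' hh') (y, r)
  let k (z : (flowFoliation α hα).holonomyGroupoid.Fiber
      ((flowFoliation α hα).holonomyGroupoid.r (canonicalMap hα (y, t)))) : ℂ :=
    pushforward hα h (z.1.inv.comp (canonicalMap hα (y, t)))
  have hkk : ∀ s, k (fiberParam hα hr s) =
      pushforward hα h (canonicalMap hα (α (-s) y, t - s)) := fun s => by
    change pushforward hα h ((canonicalMap hα (y, s)).inv.comp (canonicalMap hα (y, t))) = _
    have e : α (- -s) (α (-s) y) = y := by simp [← Flow.map_add]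
    have := comp_canonicalMap (hα := hα) (α (-s) y) (-s) t
    rw [e] at this
    rw [inv_canonicalMap, this, neg_add_eq_sub]
  have hg0 : ∀ s, g (((flowFoliation α hα).holonomyGroupoid.r (canonicalMap hα (y, t))).start, s) *
      k (fiberParam hα hr s) = ∑ r ∈ P, g (y, s) * h (α (-s) y, r - s) := fun s => by
    rw [hkk, ← hk]; rfl
  have main := (integral_pushforward_mul hI hr hg hg' (k := k)
    (by simp_rw [hg0]; exact integrable_finsetSum _ fun r _ => hint r)).2
  refine main.trans ?_
  simp_rw [hg0]
  rw [integral_finsetSum _ fun r _ => hint r, pushforward, hsum]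
  · rfl
  · intro r hr
    by_contra h0
    refine hr (integral_eq_zero_of_ae (.of_forall fun s => ?_))
    by_contra h1
    exact h0 (hz s r h1)

end Intertwine

end FlowFoliation

/-! ### A Haar system on the holonomy groupoid -/

namespace FlowFoliation

open LineFoliation

variable {Y : Type u} [TopologicalSpace Y] {α : Flow ℝ Y}
variable [TopologicalSpace.MetrizableSpace Y] [LocallyCompactSpace Y]
variable {hα : ∀ y, ∃ t, α t y ≠ y}
variable {u : (flowFoliation α hα).Holonomy}

lemma exists_isAddFundamentalDomain_holonomyKernel (y : Y) :
    ∃ D : Set ℝ, MeasurableSet D ∧ IsAddFundamentalDomain (holonomyKernel hα y) D := by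
  obtain ⟨b, hb⟩ := exists_holonomyKernel_eq_zmultiples (hα := hα) y
  rw [hb]
  -- A trivial kernel has the whole line as fundamental domain; otherwise a half-open interval of
  -- length `|b|` serves.
  rcases eq_or_ne b 0 with rfl | h0
  · refine ⟨univ, .univ, .mk' nullMeasurableSet_univ fun x => ⟨0, mem_univ _, fun g _ => ?_⟩⟩
    obtain ⟨g, hg⟩ := g
    rw [AddSubgroup.zmultiples_zero_eq_bot, AddSubgroup.mem_bot] at hg
    exact Subtype.ext hg
  · have h : AddSubgroup.zmultiples b = AddSubgroup.zmultiples |b| := by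
      rcases abs_choice b with h | h <;> simp [h]
    rw [h]
    exact ⟨_, measurableSet_Ioc, isAddFundamentalDomain_Ioc (abs_pos.2 h0) 0⟩

variable (hα) in
/-- A measurable set of times that represents each element of the range fiber over `y` once. -/
def fundamentalTimes (y : Y) : Set ℝ :=
  (exists_isAddFundamentalDomain_holonomyKernel (hα := hα) y).choose

lemma measurableSet_fundamentalTimes (y : Y) : MeasurableSet (fundamentalTimes hα y) :=
  (exists_isAddFundamentalDomain_holonomyKernel y).choose_spec.1

lemma isAddFundamentalDomain_fundamentalTimes (y : Y) :
    IsAddFundamentalDomain (holonomyKernel hα y) (fundamentalTimes hα y) :=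
  (exists_isAddFundamentalDomain_holonomyKernel y).choose_spec.2

open Classical in
variable (hα) in
/-- The Haar system on the holonomy groupoid given by Lebesgue measure along the leaves. -/
def holonomyHaar : (flowFoliation α hα).holonomyGroupoid.FiberMeasures := fun u =>
  if hu : u ∈ (flowFoliation α hα).holonomyGroupoid.units then
    ((volume : Measure ℝ).restrict (fundamentalTimes hα u.start)).map (fiberParam hα hu)
  else 0

instance (y : Y) : Countable (holonomyKernel hα y) := by
  obtain ⟨b, hb⟩ := exists_holonomyKernel_eq_zmultiples (hα := hα) y
  rw [hb]
  exact (AddSubgroup.coe_zmultiples b ▸ countable_range _ : (AddSubgroup.zmultiples b : Set ℝ).Countable).to_subtype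

/-- Let `S` be the set of times in `W` that map into `A`. All times mapping into `A` and the image
of `W` form the union of the translates of `S` by the kernel, disjoint because the canonical map is
injective on `W`. Their parts in a fundamental domain have total measure `volume S`. -/
lemma intertwines_holonomyHaar : IntertwinesLebesgue (holonomyHaar hα) := by
  rintro ⟨y, s⟩ hs W hW he
  obtain rfl : s = 0 := (congrArg Prod.snd hs).symm
  have hu := canonicalMap_zero_mem_units (hα := hα) y
  have hi : InjOn (canonicalMap hα) W := injOn_iff_injective.2 he.injective
  have hE : IsOpen {t | (y, t) ∈ W} := hW.preimage (Continuous.prodMk_right _)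
  have hm := (isOpenQuotientMap_fiberParam hu).continuous.measurable
  rw [map_fiberMap_lebesgueSystem y hW, holonomyHaar, dif_pos hu]
  ext A hA
  have hB : MeasurableSet {z : (flowFoliation α hα).holonomyGroupoid.Fiber (canonicalMap hα (y, 0)) |
      z.1 ∈ canonicalMap hα '' W} :=
    ((isOpenMap_canonicalMap _ hW).preimage (GroupoidStr.continuous_fiber_val _ _)).measurableSet
  rw [Measure.restrict_apply hA, Measure.map_apply hm hA, Measure.map_apply hm (hA.inter hB),
    Measure.restrict_apply (hm hA), Measure.restrict_apply (hm (hA.inter hB))]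
  set S := fiberParam hα hu ⁻¹' A ∩ {t | (y, t) ∈ W} with hS
  have hSm : MeasurableSet S := (hm hA).inter hE.measurableSet
  have hfib : ∀ (g : holonomyKernel hα y) (t : ℝ),
      fiberParam hα hu (g +ᵥ t) = fiberParam hα hu t := fun g t => by
    refine Subtype.ext (canonicalMap_eq_iff_sub_mem.2 ?_)
    simp [AddSubgroup.vadd_def]
  have hset : fiberParam hα hu ⁻¹' (A ∩ {z | z.1 ∈ canonicalMap hα '' W}) =
      ⋃ g : holonomyKernel hα y, g +ᵥ S := by
    ext t
    simp only [mem_preimage, mem_inter_iff, mem_iUnion]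
    constructor
    · rintro ⟨h1, ⟨y', r⟩, h2, h3⟩
      obtain rfl : y' = y := congrArg Holonomy.start h3
      have hr : t - r ∈ holonomyKernel hα y' := canonicalMap_eq_iff_sub_mem.1 h3.symm
      have ht : (⟨t - r, hr⟩ : holonomyKernel hα y') +ᵥ r = t := by
        simp [AddSubgroup.vadd_def]
      refine ⟨⟨t - r, hr⟩, mem_vadd_set.2 ⟨r, ⟨?_, h2⟩, ht⟩⟩
      rw [mem_preimage, ← hfib ⟨t - r, hr⟩, ht]
      exact h1
    · rintro ⟨g, hg⟩
      obtain ⟨r, ⟨h1, h2⟩, rfl⟩ := mem_vadd_set.1 hg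
      rw [hfib]
      exact ⟨h1, (y, r), h2, rfl⟩
  rw [(isAddFundamentalDomain_fundamentalTimes (hα := hα) y).measure_eq_tsum S, hset, iUnion_inter,
    measure_iUnion]
  · rfl
  · intro g g' hgg
    refine Set.disjoint_left.2 fun t ht ht' => hgg ?_
    obtain ⟨r, ⟨-, h1⟩, hr⟩ := mem_vadd_set.1 ht.1
    obtain ⟨r', ⟨-, h1'⟩, hr'⟩ := mem_vadd_set.1 ht'.1
    have h2 : r = r' := injOn_fiberParam hu hi h1 h1' (by
      rw [← hfib g r, ← hfib g' r', hr, hr'])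
    rw [← hr', h2] at hr
    exact Subtype.ext (vadd_right_cancel _ hr)
  · intro g
    exact (hSm.const_vadd g).inter (measurableSet_fundamentalTimes y)

variable {lam : (flowFoliation α hα).holonomyGroupoid.FiberMeasures}

/-- Small sets on which `lam u` has Lebesgue mass: their finiteness yields regularity, their
positivity full support. -/
lemma exists_injOn_nhds_fiber (hI : IntertwinesLebesgue lam)
    (hu : u ∈ (flowFoliation α hα).holonomyGroupoid.units) {O : Set _} (hO : IsOpen O) {t : ℝ}
    (ht : fiberParam hα hu t ∈ O) :
    ∃ E, IsOpen E ∧ t ∈ E ∧ fiberParam hα hu '' E ⊆ O ∧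
      lam u (fiberParam hα hu '' E) = volume E ∧ volume E < ⊤ := by
  obtain ⟨W, hW, hxW, hi⟩ := eventually_injOn_canonicalMap (hα := hα) (u.start, t)
  have hm := (isOpenQuotientMap_fiberParam hu).continuous
  have hE : IsOpen {t | (u.start, t) ∈ W} := hW.preimage (Continuous.prodMk_right _)
  set E := fiberParam hα hu ⁻¹' O ∩ {t | (u.start, t) ∈ W} ∩ Ioo (t - 1) (t + 1) with hEdef
  have hEo : IsOpen E := ((hO.preimage hm).inter hE).inter isOpen_Ioo
  have hsub : fiberParam hα hu '' E ⊆ {z | z.1 ∈ canonicalMap hα '' W} := by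
    rintro _ ⟨r, hr, rfl⟩
    exact ⟨_, hr.1.2, rfl⟩
  refine ⟨E, hEo, ⟨⟨ht, hxW⟩, by simp⟩, ?_, ?_, ?_⟩
  · rintro _ ⟨r, hr, rfl⟩
    exact hr.1.1
  · have hmE := ((isOpenQuotientMap_fiberParam hu).isOpenMap _ hEo).measurableSet
    rw [← Measure.restrict_eq_self (lam u) hsub, restrict_eq_map hI hu hW hi,
      Measure.map_apply hm.measurable hmE, Measure.restrict_apply (hm.measurable hmE)]
    congr 1
    ext r
    constructor
    · rintro ⟨⟨r', hr', e⟩, h⟩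
      rwa [← injOn_fiberParam hu hi hr'.1.2 h e]
    · exact fun hr => ⟨⟨r, hr, rfl⟩, hr.1.2⟩
  · exact (measure_mono inter_subset_right).trans_lt (by simp)

/-- As an open quotient of `ℝ` that is Hausdorff, the fiber is second countable, locally compact and
metrizable; there, local finiteness implies regularity. -/
lemma regular_of_intertwines (hI : IntertwinesLebesgue lam)
    (hu : u ∈ (flowFoliation α hα).holonomyGroupoid.units) : (lam u).Regular := by
  have hq := isOpenQuotientMap_fiberParam hu
  have := t2Space_fiber hu
  have := locallyCompactSpace_fiber hu
  have := hq.isQuotientMap.secondCountableTopology hq.isOpenMap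
  have := TopologicalSpace.metrizableSpace_of_t3_secondCountable
    ((flowFoliation α hα).holonomyGroupoid.Fiber u)
  have : IsLocallyFiniteMeasure (lam u) := ⟨fun z => by
    obtain ⟨t, rfl⟩ := hq.surjective z
    obtain ⟨E, hE, ht, -, h1, h2⟩ := exists_injOn_nhds_fiber hI hu isOpen_univ (mem_univ _)
    exact ⟨_, (hq.isOpenMap _ hE).mem_nhds ⟨t, ht, rfl⟩, h1 ▸ h2⟩⟩
  infer_instance

lemma isOpenPosMeasure_of_intertwines (hI : IntertwinesLebesgue lam)
    (hu : u ∈ (flowFoliation α hα).holonomyGroupoid.units) : (lam u).IsOpenPosMeasure where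
  open_pos := by
    rintro O hO ⟨z, hz⟩ h0
    obtain ⟨t, rfl⟩ := (isOpenQuotientMap_fiberParam hu).surjective z
    obtain ⟨E, hE, ht, hEO, h1, -⟩ := exists_injOn_nhds_fiber hI hu hO hz
    exact (hE.measure_pos volume ⟨t, ht⟩).ne' (h1.symm.trans (measure_mono_null hEO h0))

lemma isHaarSystem_holonomyHaar : GroupoidStr.IsHaarSystem (holonomyHaar hα) :=
  isHaarSystem_of_intertwines intertwines_holonomyHaar
    (fun _ => regular_of_intertwines intertwines_holonomyHaar)
    fun _ => isOpenPosMeasure_of_intertwines intertwines_holonomyHaar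

end FlowFoliation

/-! ### Extension of multipliers of a represented `*`-algebra -/

namespace EssentialSpace

open scoped InnerProductSpace

variable {A H : Type*} [NormedAddCommGroup H] [InnerProductSpace ℂ H]

/-- The closed linear span of the ranges of the operators `L g`. -/
def ess (L : A → H →L[ℂ] H) : Submodule ℂ H :=
  (Submodule.span ℂ {ξ | ∃ g η, L g η = ξ}).topologicalClosure

variable {L : A → H →L[ℂ] H}

lemma apply_mem_ess (g : A) (η : H) : L g η ∈ ess L :=
  Submodule.le_topologicalClosure _ (Submodule.subset_span ⟨g, η, rfl⟩)

variable (L) in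
/-- The evaluation map with values in the essential space. -/
def ev : (A →₀ H) →ₗ[ℂ] ess L :=
  (Finsupp.lsum ℂ fun g => (L g).toLinearMap).codRestrict (ess L) fun x =>
    Submodule.sum_mem _ fun g _ => apply_mem_ess g (x g)

@[simp] lemma ev_single (g : A) (η : H) :
    ev L (Finsupp.single g η) = ⟨L g η, apply_mem_ess g η⟩ :=
  Subtype.ext (Finsupp.lsum_single _ _ _ _)

lemma denseRange_ev : DenseRange (ev L) := by
  intro x
  rw [closure_subtype]
  refine closure_mono ?_ x.2
  change ((Submodule.span ℂ {ξ | ∃ g η, L g η = ξ} : Submodule ℂ H) : Set H) ⊆ _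
  have : Submodule.span ℂ {ξ | ∃ g η, L g η = ξ} ≤ (LinearMap.range (ev L)).map (ess L).subtype := by
    refine Submodule.span_le.2 ?_
    rintro _ ⟨g, η, rfl⟩
    exact ⟨_, ⟨Finsupp.single g η, rfl⟩, by simp⟩
  intro ξ hξ
  obtain ⟨_, ⟨z, rfl⟩, hz⟩ := this hξ
  exact ⟨_, ⟨z, rfl⟩, hz⟩

lemma ext_ess {F : Type*} [TopologicalSpace F] [T2Space F] {f g : ess L → F} (hf : Continuous f)
    (hg : Continuous g) (h : ∀ x, f (ev L x) = g (ev L x)) : f = g :=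
  denseRange_ev.equalizer hf hg (funext h)

lemma linear_ext {F : Type*} [AddCommGroup F] [Module ℂ F] {f g : (A →₀ H) →ₗ[ℂ] F}
    (h : ∀ a η, f (Finsupp.single a η) = g (Finsupp.single a η)) : f = g :=
  Finsupp.lhom_ext h

variable (L) in
/-- The map `T` is bounded for the seminorm given by `L`. -/
def IsBdd (T : A → A) (C : ℝ) : Prop :=
  ∀ x, ‖ev L (Finsupp.lmapDomain H ℂ T x)‖ ≤ C * ‖ev L x‖

/-- Operators on the essential space are determined by their values at the vectors `L g η`. -/
lemma operator_ext {F : Type*} [NormedAddCommGroup F] [NormedSpace ℂ F] {f g : ess L →L[ℂ] F}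
    (h : ∀ a η, f ⟨L a η, apply_mem_ess a η⟩ = g ⟨L a η, apply_mem_ess a η⟩) : f = g := by
  refine ContinuousLinearMap.coeFn_injective (ext_ess f.continuous g.continuous fun x => ?_)
  have : f.toLinearMap ∘ₗ ev L = g.toLinearMap ∘ₗ ev L := linear_ext fun a η => by simpa using h a η
  exact LinearMap.congr_fun this x

lemma lmapDomain_comp_apply (T S : A → A) (x : A →₀ H) :
    Finsupp.lmapDomain H ℂ T (Finsupp.lmapDomain H ℂ S x) = Finsupp.lmapDomain H ℂ (T ∘ S) x := by
  simp [Finsupp.mapDomain_comp]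

variable [CompleteSpace H]

instance : CompleteSpace (ess L) :=
  (Submodule.isClosed_topologicalClosure _).completeSpace_coe

variable (L) in
/-- The operator on the essential space with `L g η ↦ L (T g) η`. -/
def multOp (T : A → A) : ess L →L[ℂ] ess L :=
  (ev L ∘ₗ Finsupp.lmapDomain H ℂ T).extendOfNorm (ev L)

/-- The bound makes the assignment well defined on the range of `ev L` and continuous there, so it
extends by density. -/
lemma multOp_ev {T : A → A} {C : ℝ} (hT : IsBdd L T C) (x : A →₀ H) :
    multOp L T (ev L x) = ev L (Finsupp.lmapDomain H ℂ T x) :=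
  LinearMap.extendOfNorm_eq (f := ev L ∘ₗ Finsupp.lmapDomain H ℂ T) denseRange_ev ⟨C, hT⟩ x

lemma multOp_apply {T : A → A} {C : ℝ} (hT : IsBdd L T C) (g : A) (η : H) :
    multOp L T ⟨L g η, apply_mem_ess g η⟩ = ⟨L (T g) η, apply_mem_ess _ η⟩ := by
  have := multOp_ev hT (Finsupp.single g η)
  rwa [Finsupp.lmapDomain_apply, Finsupp.mapDomain_single, ev_single, ev_single] at this

lemma norm_multOp_le {T : A → A} {C : ℝ} (hC : 0 ≤ C) (hT : IsBdd L T C) : ‖multOp L T‖ ≤ C :=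
  LinearMap.opNorm_extendOfNorm_le (f := ev L ∘ₗ Finsupp.lmapDomain H ℂ T) denseRange_ev hC hT

variable (L) in
/-- `T` and `T'` are adjoint to each other. -/
def IsAdj (T T' : A → A) : Prop := ∀ g h, star (L (T g)) * L h = star (L g) * L (T' h)

lemma IsAdj.symm {T T' : A → A} (h : IsAdj L T T') : IsAdj L T' T := fun g g' => by
  have := congrArg star (h g' g)
  simpa using this.symm

lemma IsAdj.inner_eq {T T' : A → A} (h : IsAdj L T T') (x y : A →₀ H) :
    ⟪ev L (Finsupp.lmapDomain H ℂ T x), ev L y⟫_ℂ =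
      ⟪ev L x, ev L (Finsupp.lmapDomain H ℂ T' y)⟫_ℂ := by
  induction x using Finsupp.induction_linear with
  | zero => simp
  | add x x' hx hx' => simp only [map_add, inner_add_left, hx, hx']
  | single g ξ =>
    induction y using Finsupp.induction_linear with
    | zero => simp
    | add y y' hy hy' => simp only [map_add, inner_add_right, hy, hy']
    | single g' ξ' =>
      simp only [Finsupp.lmapDomain_apply, Finsupp.mapDomain_single, ev_single, Submodule.coe_inner]
      have := congrArg (fun B : H →L[ℂ] H => ⟪ξ, B ξ'⟫_ℂ) (h g g')
      simpa [ContinuousLinearMap.star_eq_adjoint, ContinuousLinearMap.adjoint_inner_right] using this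

/-- `‖T x‖² = ⟪x, T' T x⟫ = ‖x‖²`, so `T` acts isometrically. -/
lemma isBdd_of_leftInverse {T T' : A → A} (h : IsAdj L T T') (hT : ∀ g, T' (T g) = g) :
    IsBdd L T 1 := fun x => by
  have h1 := h.inner_eq x (Finsupp.lmapDomain H ℂ T x)
  rw [lmapDomain_comp_apply, show T' ∘ T = id from funext hT, Finsupp.lmapDomain_id,
    LinearMap.id_apply, inner_self_eq_norm_sq_to_K, inner_self_eq_norm_sq_to_K] at h1
  have h2 : ‖ev L (Finsupp.lmapDomain H ℂ T x)‖ ^ 2 = ‖ev L x‖ ^ 2 := by exact_mod_cast h1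
  rw [one_mul]
  exact (pow_left_inj₀ (norm_nonneg _) (norm_nonneg _) two_ne_zero).1 h2 |>.le

/-- Here `S` supplies the defect: `‖T x‖² + ‖S x‖² = C² ‖x‖²`. For multiplication by `φ` it is
multiplication by the square root of `‖φ‖² - |φ|²`. -/
lemma isBdd_of_sq {T T' S S' : A → A} (h : IsAdj L T T') (h' : IsAdj L S S') {C : ℝ} (hC : 0 ≤ C)
    (hTS : ∀ g, L (T' (T g)) + L (S' (S g)) = (C ^ 2 : ℂ) • L g) : IsBdd L T C := fun x => by
  have h1 := h.inner_eq x (Finsupp.lmapDomain H ℂ T x)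
  have h2 := h'.inner_eq x (Finsupp.lmapDomain H ℂ S x)
  rw [lmapDomain_comp_apply, inner_self_eq_norm_sq_to_K] at h1 h2
  have h3 : ev L (Finsupp.lmapDomain H ℂ (T' ∘ T) x) + ev L (Finsupp.lmapDomain H ℂ (S' ∘ S) x) =
      (C ^ 2 : ℂ) • ev L x := by
    have : ev L ∘ₗ Finsupp.lmapDomain H ℂ (T' ∘ T) + ev L ∘ₗ Finsupp.lmapDomain H ℂ (S' ∘ S) =
        (C ^ 2 : ℂ) • ev L := linear_ext fun a η => Subtype.ext (by
      simpa using congrArg (fun B : H →L[ℂ] H => B η) (hTS a))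
    exact LinearMap.congr_fun this x
  have h4 := congrArg₂ (fun a b : ℂ => a + b) h1 h2
  beta_reduce at h4
  rw [← inner_add_right, h3, inner_smul_right, inner_self_eq_norm_sq_to_K] at h4
  have h5 : ‖ev L (Finsupp.lmapDomain H ℂ T x)‖ ^ 2 + ‖ev L (Finsupp.lmapDomain H ℂ S x)‖ ^ 2 =
    C ^ 2 * ‖ev L x‖ ^ 2 := by
    apply Complex.ofReal_injective
    push_cast
    simpa using h4
  refine abs_le_of_sq_le_sq' ?_ (by positivity) |>.2
  rw [mul_pow]
  linarith [sq_nonneg ‖ev L (Finsupp.lmapDomain H ℂ S x)‖]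

lemma multOp_mul {T S : A → A} {C D E : ℝ} (hT : IsBdd L T C) (hS : IsBdd L S D)
    (hTS : IsBdd L (T ∘ S) E) : multOp L T * multOp L S = multOp L (T ∘ S) :=
  operator_ext fun a η => by
    rw [mul_apply_eq_comp, multOp_apply hS, multOp_apply hT, multOp_apply hTS]; rfl

lemma star_multOp {T T' : A → A} {C D : ℝ} (h : IsAdj L T T') (hT : IsBdd L T C)
    (hT' : IsBdd L T' D) : star (multOp L T) = multOp L T' := by
  rw [ContinuousLinearMap.star_eq_adjoint, eq_comm, ContinuousLinearMap.eq_adjoint_iff]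
  intro v w
  have h1 : (fun v => ⟪multOp L T' v, w⟫_ℂ) = fun v => ⟪v, multOp L T w⟫_ℂ := by
    refine ext_ess (by fun_prop) (by fun_prop) fun x => ?_
    have h2 : (fun w => ⟪multOp L T' (ev L x), w⟫_ℂ) = fun w => ⟪ev L x, multOp L T w⟫_ℂ := by
      refine ext_ess (by fun_prop) (by fun_prop) fun y => ?_
      rw [multOp_ev hT, multOp_ev hT', h.symm.inner_eq]
    exact congrFun h2 w
  exact congrFun h1 v

end EssentialSpace

/-! ### The covariant representation given by a representation of the convolution algebra -/

namespace FlowFoliation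

open EssentialSpace
open scoped CompactlySupported ZeroAtInfty

variable {Y : Type u} [TopologicalSpace Y] {α : Flow ℝ Y}

variable (α) in
/-- Translation by the flow, that is, left multiplication by the unitary `U s`. -/
def shiftC (s : ℝ) (g : C_c(Y × ℝ, ℂ)) : C_c(Y × ℝ, ℂ) :=
  ⟨⟨g ∘ flowShift α (-s), g.continuous.comp (flowShift α (-s)).continuous⟩,
    g.hasCompactSupport.comp_homeomorph _⟩

@[simp] lemma shiftC_apply (s : ℝ) (g : C_c(Y × ℝ, ℂ)) (x : Y × ℝ) :
    shiftC α s g x = g (α (-s) x.1, -s + x.2) := rfl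

/-- Multiplication by a function on the base. -/
def mulBase (φ : C(Y, ℂ)) (g : C_c(Y × ℝ, ℂ)) : C_c(Y × ℝ, ℂ) :=
  ⟨⟨fun x => φ x.1 * g x, (φ.continuous.comp continuous_fst).mul g.continuous⟩,
    g.hasCompactSupport.mul_left⟩

@[simp] lemma mulBase_apply (φ : C(Y, ℂ)) (g : C_c(Y × ℝ, ℂ)) (x : Y × ℝ) :
    mulBase φ g x = φ x.1 * g x := rfl

variable (α) in
/-- The adjoint, as an element of `C_c(Y × ℝ)`. -/
def starC (g : C_c(Y × ℝ, ℂ)) : C_c(Y × ℝ, ℂ) :=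
  ⟨⟨flowStar α g, continuous_flowStar g.continuous⟩, hasCompactSupport_flowStar g.hasCompactSupport⟩

@[simp] lemma starC_apply (g : C_c(Y × ℝ, ℂ)) (x : Y × ℝ) : starC α g x = flowStar α g x := rfl

variable {H : Type u} [NormedAddCommGroup H] [InnerProductSpace ℂ H] [CompleteSpace H]

variable (α) in
/-- A representation of the convolution algebra `C_c(Y × ℝ)` that is bounded by the `I`-norm. -/
structure IsFlowRep (L : C_c(Y × ℝ, ℂ) →ₗ[ℂ] (H →L[ℂ] H)) : Prop where
  map_conv : ∀ f g h : C_c(Y × ℝ, ℂ), (h : Y × ℝ → ℂ) = flowConv α f g → L h = L f * L g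
  map_star : ∀ f, L (starC α f) = star (L f)
  bound : ∀ (f : C_c(Y × ℝ, ℂ)) (M R : ℝ), 0 ≤ M → 0 ≤ R → (∀ x, ‖f x‖ ≤ M) →
    (∀ x, R < |x.2| → f x = 0) → ‖L f‖ ≤ 2 * R * M

variable {L : C_c(Y × ℝ, ℂ) →ₗ[ℂ] (H →L[ℂ] H)}

lemma shiftC_shiftC (s t : ℝ) (g : C_c(Y × ℝ, ℂ)) :
    shiftC α s (shiftC α t g) = shiftC α (s + t) g := by
  ext ⟨y, r⟩
  simp only [shiftC_apply, ← Flow.map_add]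
  congr 2 <;> [congr 1; skip] <;> ring_nf

lemma shiftC_zero (g : C_c(Y × ℝ, ℂ)) : shiftC α 0 g = g := by
  ext ⟨y, r⟩
  simp

/-- Compactness of `K` upgrades joint continuity to uniform convergence. -/
lemma eventually_norm_sub_le {P : Type*} [TopologicalSpace P] {G : P → C_c(Y × ℝ, ℂ)}
    (hG : Continuous fun p : P × (Y × ℝ) => G p.1 p.2) {p₀ : P} {K : Set (Y × ℝ)}
    (hK : IsCompact K) (hp : ∀ᶠ p in 𝓝 p₀, ∀ x ∉ K, G p x = 0) {ε : ℝ} (hε : 0 < ε) :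
    ∀ᶠ p in 𝓝 p₀, ∀ x, ‖G p x - G p₀ x‖ ≤ ε := by
  have h1 : ∀ᶠ p in 𝓝 p₀, ∀ x ∈ K, ‖G p x - G p₀ x‖ < ε := by
    refine hK.eventually_forall_of_forall_eventually fun x _ => ?_
    have hc : Continuous fun z : P × (Y × ℝ) => ‖G z.1 z.2 - G p₀ z.2‖ :=
      (hG.sub ((G p₀).continuous.comp continuous_snd)).norm
    exact (hc.tendsto (p₀, x)).eventually_lt_const (by simpa using hε)
  filter_upwards [h1, hp] with p h1 h2 x
  by_cases hx : x ∈ K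
  · exact (h1 x hx).le
  · rw [h2 x hx, hp.self_of_nhds x hx, sub_zero, norm_zero]
    exact hε.le

/-- Continuity of `L` along continuous families. -/
lemma IsFlowRep.continuous_family (hL : IsFlowRep α L) {P : Type*} [TopologicalSpace P]
    {G : P → C_c(Y × ℝ, ℂ)} (hG : Continuous fun p : P × (Y × ℝ) => G p.1 p.2)
    (hK : ∀ p₀, ∃ K : Set (Y × ℝ), IsCompact K ∧ ∀ᶠ p in 𝓝 p₀, ∀ x ∉ K, G p x = 0) :
    Continuous fun p => L (G p) := by
  rw [continuous_iff_continuousAt]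
  intro p₀
  obtain ⟨K, hK, hp⟩ := hK p₀
  obtain ⟨R, hR⟩ := (hK.image continuous_snd).isBounded.exists_norm_le
  rw [ContinuousAt, tendsto_iff_norm_sub_tendsto_zero, Metric.tendsto_nhds]
  intro ε hε
  -- `R` may be zero or negative; `|R| + 1` is a positive radius that still bounds the times in `K`.
  have hR' : 0 < 2 * (|R| + 1) := by positivity
  filter_upwards [eventually_norm_sub_le hG hK hp (ε := ε / (2 * (2 * (|R| + 1))))
    (by positivity), hp] with p h1 h2
  rw [dist_zero_right, norm_norm, ← map_sub]
  refine (hL.bound _ _ (|R| + 1) (by positivity) (by positivity) h1 fun x hx => ?_).trans_lt ?_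
  · have hxK : x ∉ K := fun h => by
      have := hR x.2 ⟨x, h, rfl⟩
      rw [Real.norm_eq_abs] at this
      linarith [le_abs_self R]
    change G p x - G p₀ x = 0
    rw [h2 x hxK, hp.self_of_nhds x hxK, sub_zero]
  · field_simp
    linarith

lemma IsFlowRep.continuous_shiftC (hL : IsFlowRep α L) (g : C_c(Y × ℝ, ℂ)) :
    Continuous fun s => L (shiftC α s g) := by
  have hc : Continuous fun p : ℝ × (Y × ℝ) => flowShift α p.1 p.2 := by
    simp only [flowShift_apply]
    exact (α.continuous continuous_fst (by fun_prop)).prodMk (by fun_prop)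
  refine hL.continuous_family ?_ fun s₀ => ?_
  · exact g.continuous.comp (hc.comp (continuous_fst.neg.prodMk continuous_snd))
  · refine ⟨_, ((isCompact_Icc (a := s₀ - 1) (b := s₀ + 1)).prod g.hasCompactSupport).image hc, ?_⟩
    filter_upwards [Icc_mem_nhds (by linarith : s₀ - 1 < s₀) (by linarith : s₀ < s₀ + 1)]
      with s hs x hx
    by_contra h0
    refine hx ⟨(s, flowShift α (-s) x), ⟨hs, subset_tsupport _ h0⟩, ?_⟩
    simp [← Flow.map_add]

variable [TopologicalSpace.MetrizableSpace Y] [LocallyCompactSpace Y]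

variable (α) in
/-- The convolution product, as an element of `C_c(Y × ℝ)`. -/
def convC (g h : C_c(Y × ℝ, ℂ)) : C_c(Y × ℝ, ℂ) :=
  ⟨⟨flowConv α g h, (continuous_flowConv g.continuous h.continuous g.hasCompactSupport
    h.hasCompactSupport).1⟩, (continuous_flowConv g.continuous h.continuous g.hasCompactSupport
    h.hasCompactSupport).2⟩

lemma convC_apply (g h : C_c(Y × ℝ, ℂ)) (x : Y × ℝ) : convC α g h x = flowConv α g h x := rfl

namespace IsFlowRep

lemma star_mul (hL : IsFlowRep α L) (g h : C_c(Y × ℝ, ℂ)) :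
    star (L g) * L h = L (convC α (starC α g) h) := by
  rw [hL.map_conv (starC α g) h (convC α (starC α g) h) rfl, hL.map_star]

/-- Both products are values of `L` at convolutions, which agree after a translation of the
integration variable by `s`. -/
lemma isAdj_shiftC (hL : IsFlowRep α L) (s : ℝ) :
    IsAdj (fun g => L g) (shiftC α s) (shiftC α (-s)) := fun g h => by
  rw [hL.star_mul, hL.star_mul]
  congr 1
  ext ⟨y, t⟩
  simp only [convC_apply, flowConv, starC_apply, flowStar, shiftC_apply]
  refine (integral_sub_right_eq_self _ s).symm.trans (integral_congr_ae (.of_forall fun r => ?_))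
  simp only [← Flow.map_add]
  rw [show -s + -(r - s) = -r by ring, show -(r - s) = - -s + -r by ring,
    show t - (r - s) = - -s + (t - r) by ring]

lemma isAdj_mulBase (hL : IsFlowRep α L) (φ : C(Y, ℂ)) :
    IsAdj (fun g => L g) (mulBase φ) (mulBase (star φ)) := fun g h => by
  rw [hL.star_mul, hL.star_mul]
  congr 1
  ext ⟨y, t⟩
  simp only [convC_apply, flowConv, starC_apply, flowStar, mulBase_apply]
  refine integral_congr_ae (.of_forall fun r => ?_)
  simp
  ring

lemma isBdd_shiftC (hL : IsFlowRep α L) (s : ℝ) : IsBdd (fun g => L g) (shiftC α s) 1 :=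
  isBdd_of_leftInverse (hL.isAdj_shiftC s) fun g => by
    rw [shiftC_shiftC, neg_add_cancel, shiftC_zero]

/-- The defect function `ψ` need not vanish at infinity, which is why `mulBase` accepts arbitrary
continuous functions on `Y`. -/
lemma isBdd_mulBase (hL : IsFlowRep α L) (φ : C₀(Y, ℂ)) :
    IsBdd (fun g => L g) (mulBase (φ : C(Y, ℂ))) ‖φ‖ := by
  let ψ : C(Y, ℂ) := ⟨fun y => (√(‖φ‖ ^ 2 - ‖φ y‖ ^ 2) : ℝ), by fun_prop⟩
  refine isBdd_of_sq (hL.isAdj_mulBase φ) (hL.isAdj_mulBase ψ) (norm_nonneg _) fun g => ?_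
  rw [← map_add, ← map_smul]
  congr 1
  ext ⟨y, t⟩
  have h1 : ‖φ y‖ ^ 2 ≤ ‖φ‖ ^ 2 := pow_le_pow_left₀ (norm_nonneg _)
    (by simpa using φ.toBCF.norm_coe_le_norm y) 2
  have h2 : ((√(‖φ‖ ^ 2 - ‖φ y‖ ^ 2) : ℝ) : ℂ) * (√(‖φ‖ ^ 2 - ‖φ y‖ ^ 2) : ℝ) =
      ‖φ‖ ^ 2 - ‖φ y‖ ^ 2 := by
    rw [← Complex.ofReal_mul, Real.mul_self_sqrt (by linarith)]
    push_cast
    rfl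
  have h3 : star (φ y) * φ y = (‖φ y‖ ^ 2 : ℂ) := by
    have := Complex.conj_mul' (φ y)
    simpa using this
  change star (φ y) * (φ y * g (y, t)) + star (ψ y) * (ψ y * g (y, t)) = (‖φ‖ ^ 2 : ℂ) * g (y, t)
  have h4 : star (ψ y) = ψ y := Complex.conj_ofReal _
  rw [h4, ← mul_assoc, ← mul_assoc, h3, show ψ y * ψ y = _ from h2]
  ring

/-- The operators are contractions, so orbit maps of vectors in the dense range approximate the
orbit map of `v` uniformly in `s`. -/
lemma continuous_multOp_shiftC (hL : IsFlowRep α L) (v : ess fun g => L g) :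
    Continuous fun s => multOp (fun g => L g) (shiftC α s) v := by
  refine continuous_of_uniform_approx_of_continuous fun u hu => ?_
  obtain ⟨ε, hε, hu⟩ := Metric.mem_uniformity_dist.1 hu
  obtain ⟨x, hx⟩ := denseRange_ev.exists_dist_lt v hε
  refine ⟨fun s => multOp (fun g => L g) (shiftC α s) (ev _ x), ?_, fun s => hu ?_⟩
  · simp_rw [multOp_ev (hL.isBdd_shiftC _)]
    clear hx
    induction x using Finsupp.induction_linear with
    | zero => simpa using continuous_const
    | add x x' hx hx' =>
      simp only [map_add]
      exact hx.add hx'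
    | single g η =>
      simp only [Finsupp.lmapDomain_apply, Finsupp.mapDomain_single, ev_single]
      exact ((hL.continuous_shiftC g).clm_apply continuous_const).subtype_mk _
  · rw [dist_eq_norm, ← map_sub]
    refine (ContinuousLinearMap.le_of_opNorm_le _
      (norm_multOp_le zero_le_one (hL.isBdd_shiftC s)) _).trans_lt ?_
    rwa [one_mul, ← dist_eq_norm]

lemma multOp_shiftC_mul (hL : IsFlowRep α L) (s t : ℝ) :
    multOp (fun g => L g) (shiftC α s) * multOp (fun g => L g) (shiftC α t) =
      multOp (fun g => L g) (shiftC α (s + t)) := by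
  have : shiftC α s ∘ shiftC α t = shiftC (Y := Y) α (s + t) := funext fun g => shiftC_shiftC s t g
  rw [multOp_mul (hL.isBdd_shiftC s) (hL.isBdd_shiftC t) (this ▸ hL.isBdd_shiftC (s + t)), this]

lemma multOp_shiftC_zero (hL : IsFlowRep α L) : multOp (fun g => L g) (shiftC α 0) = 1 :=
  operator_ext fun a η => by
    rw [multOp_apply (hL.isBdd_shiftC 0)]
    simp [shiftC_zero]

/-- The covariant representation on the essential space. -/
def covariantRep (hL : IsFlowRep α L) : CovariantRep α where
  H := ess fun g => L g
  π :=
    { toFun := fun φ => multOp (fun g => L g) (mulBase (φ : C(Y, ℂ)))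
      map_smul' := fun c φ => operator_ext fun a η => by
        rw [multOp_apply (hL.isBdd_mulBase _)]
        change _ = c • multOp (fun g => L g) (mulBase (φ : C(Y, ℂ))) _
        rw [multOp_apply (hL.isBdd_mulBase _)]
        refine Subtype.ext ?_
        change L _ η = c • L _ η
        rw [show mulBase ((c • φ : C₀(Y, ℂ)) : C(Y, ℂ)) a = c • mulBase (φ : C(Y, ℂ)) a from ?_,
          map_smul]
        · rfl
        · ext x
          change c * φ x.1 * a x = c * (φ x.1 * a x)
          ring
      map_zero' := operator_ext fun a η => by
        rw [multOp_apply (hL.isBdd_mulBase _)]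
        refine Subtype.ext ?_
        change L _ η = 0
        rw [show mulBase ((0 : C₀(Y, ℂ)) : C(Y, ℂ)) a = 0 from ?_, map_zero]
        · rfl
        · ext x
          exact zero_mul _
      map_add' := fun φ ψ => operator_ext fun a η => by
        rw [add_apply, multOp_apply (hL.isBdd_mulBase _),
          multOp_apply (hL.isBdd_mulBase _), multOp_apply (hL.isBdd_mulBase _)]
        refine Subtype.ext ?_
        change L _ η = L _ η + L _ η
        rw [show mulBase ((φ + ψ : C₀(Y, ℂ)) : C(Y, ℂ)) a =
          mulBase (φ : C(Y, ℂ)) a + mulBase (ψ : C(Y, ℂ)) a from ?_, map_add]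
        · rfl
        · ext x
          exact add_mul _ _ _
      map_mul' := fun φ ψ => by
        have : mulBase (φ : C(Y, ℂ)) ∘ mulBase (ψ : C(Y, ℂ)) =
            mulBase ((φ * ψ : C₀(Y, ℂ)) : C(Y, ℂ)) := by
          ext g x
          exact (mul_assoc _ _ _).symm
        rw [multOp_mul (hL.isBdd_mulBase φ) (hL.isBdd_mulBase ψ) (this ▸ hL.isBdd_mulBase _), this]
      map_star' := fun φ =>
        (star_multOp (hL.isAdj_mulBase φ) (hL.isBdd_mulBase φ) (hL.isBdd_mulBase (star φ))).symm }
  U t := ⟨multOp (fun g => L g) (shiftC α t), by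
    rw [Unitary.mem_iff, star_multOp (hL.isAdj_shiftC t) (hL.isBdd_shiftC t) (hL.isBdd_shiftC _),
      hL.multOp_shiftC_mul, hL.multOp_shiftC_mul, neg_add_cancel, add_neg_cancel,
      hL.multOp_shiftC_zero]
    exact ⟨rfl, rfl⟩⟩
  U_add s t := Subtype.ext (hL.multOp_shiftC_mul s t).symm
  U_continuous := hL.continuous_multOp_shiftC
  covariant t φ := operator_ext fun a η => by
    change (multOp (fun g => L g) (shiftC α t) * multOp (fun g => L g) (mulBase (φ : C(Y, ℂ))) *
      star (multOp (fun g => L g) (shiftC α t))) _ = multOp (fun g => L g)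
        (mulBase (flowAction α t φ : C(Y, ℂ))) _
    rw [star_multOp (hL.isAdj_shiftC t) (hL.isBdd_shiftC t) (hL.isBdd_shiftC _),
      mul_apply_eq_comp, mul_apply_eq_comp, multOp_apply (hL.isBdd_shiftC _),
      multOp_apply (hL.isBdd_mulBase _), multOp_apply (hL.isBdd_shiftC _),
      multOp_apply (hL.isBdd_mulBase _)]
    congr 3
    ext ⟨y, r⟩
    change φ (α (-t) y) * a (α (- -t) (α (-t) y), - -t + (-t + r)) = φ (α (-t) y) * a (y, r)
    simp [← Flow.map_add]

end IsFlowRep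

end FlowFoliation

namespace FlowFoliation

open EssentialSpace
open scoped CompactlySupported ZeroAtInfty BoundedContinuousFunction

/-! ### Integration of continuous families -/

section Family

variable {X : Type*} [TopologicalSpace X]

/-- The bounded continuous functions that vanish outside `K`. -/
def supportedIn (K : Set X) : Submodule ℂ (X →ᵇ ℂ) where
  carrier := {f | ∀ x ∉ K, f x = 0}
  add_mem' hf hg x hx := by simp [hf x hx, hg x hx]
  zero_mem' _ _ := rfl
  smul_mem' c f hf x hx := by simp [hf x hx]

/-- A fixed compact support gives a Banach space on which `L` will be bounded, so that Bochner
integrals commute with `L`. -/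
instance (K : Set X) : CompleteSpace (supportedIn K) := by
  have : (supportedIn K : Set (X →ᵇ ℂ)) = ⋂ x ∈ Kᶜ, {f | f x = 0} := by
    ext f
    simp only [mem_iInter]
    rfl
  have hc : IsClosed (supportedIn K : Set (X →ᵇ ℂ)) := by
    rw [this]
    exact isClosed_biInter fun x _ =>
      isClosed_eq (BoundedContinuousFunction.evalCLM ℂ x).continuous continuous_const
  exact hc.completeSpace_coe

/-- Functions supported in a compact set are compactly supported. -/
def toCc [T2Space X] {K : Set X} (hK : IsCompact K) : supportedIn K →ₗ[ℂ] C_c(X, ℂ) where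
  toFun f := ⟨f.1.toContinuousMap, .intro hK f.2⟩
  map_add' _ _ := rfl
  map_smul' _ _ := rfl

end Family

variable {Y : Type u} [TopologicalSpace Y] {α : Flow ℝ Y}
variable {H : Type u} [NormedAddCommGroup H] [InnerProductSpace ℂ H] [CompleteSpace H]
variable {L : C_c(Y × ℝ, ℂ) →ₗ[ℂ] (H →L[ℂ] H)}

/-- The `I`-norm bound makes `L` continuous on functions supported in `K`. The Bochner integral of
`G` in that space is `I`, since point evaluations are continuous. -/
lemma IsFlowRep.integral_family [T2Space Y] (hL : IsFlowRep α L) {G : ℝ → C_c(Y × ℝ, ℂ)}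
    (hG : Continuous fun p : ℝ × (Y × ℝ) => G p.1 p.2) {K : Set (Y × ℝ)} (hK : IsCompact K)
    (hGK : ∀ t, ∀ x ∉ K, G t x = 0) {J : Set ℝ} (hJ : IsCompact J) (hGJ : ∀ t ∉ J, G t = 0)
    {I : C_c(Y × ℝ, ℂ)} (hI : ∀ x, I x = ∫ t, G t x) (ξ : H) : L I ξ = ∫ t, L (G t) ξ := by
  obtain ⟨R, hR⟩ := (hK.image continuous_snd).isBounded.exists_norm_le
  let Λ : supportedIn K →L[ℂ] (H →L[ℂ] H) := (L ∘ₗ toCc hK).mkContinuous (2 * |R|) fun f => by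
    refine hL.bound _ _ |R| (norm_nonneg _) (abs_nonneg R) (fun x => f.1.norm_coe_le_norm x)
      fun x hx => f.2 x fun h => ?_
    have := hR x.2 ⟨x, h, rfl⟩
    rw [Real.norm_eq_abs] at this
    linarith [le_abs_self R]
  let g (t : ℝ) : supportedIn K := ⟨(G t : Y × ℝ →ᵇ ℂ), hGK t⟩
  have hgc : Continuous g := by
    refine Continuous.subtype_mk ?_ _
    rw [continuous_iff_continuousAt]
    intro t
    rw [ContinuousAt, tendsto_iff_norm_sub_tendsto_zero, Metric.tendsto_nhds]
    intro ε hε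
    filter_upwards [eventually_norm_sub_le hG hK (p₀ := t) (.of_forall hGK) (half_pos hε)] with s hs
    rw [dist_zero_right, norm_norm]
    exact ((BoundedContinuousFunction.norm_le (half_pos hε).le).2 hs).trans_lt (half_lt_self hε)
  have hgs : HasCompactSupport g := .intro hJ fun t ht => by
    refine Subtype.ext (BoundedContinuousFunction.ext fun x => ?_)
    exact DFunLike.congr_fun (hGJ t ht) x
  have hgi : Integrable g := hgc.integrable_of_hasCompactSupport hgs
  have h1 : toCc hK (∫ t, g t) = I := by
    ext x
    let e : supportedIn K →L[ℂ] ℂ :=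
      (BoundedContinuousFunction.evalCLM ℂ x).comp (supportedIn K).subtypeL
    have h2 := e.integral_comp_comm hgi
    rw [hI]
    exact h2.symm
  have h3 := (((ContinuousLinearMap.apply ℂ H ξ).comp Λ).integral_comp_comm hgi)
  have h4 : Λ (∫ t, g t) = L I := by rw [← h1]; rfl
  rw [← h4]
  exact h3.symm

/-! ### Integrated forms -/

namespace CovariantForm

variable (ρ : CovariantRep α) (f : C_c(ℝ, C₀(Y, ℂ)))

lemma continuous_integrand (ξ : ρ.H) :
    Continuous fun t => ρ.π (f t) ((ρ.U t : ρ.H →L[ℂ] ρ.H) ξ) := by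
  have hπ : Continuous ρ.π := AddMonoidHomClass.continuous_of_bound ρ.π 1 fun a => by
    rw [one_mul]
    exact NonUnitalStarAlgHom.norm_apply_le ρ.π a
  exact (hπ.comp f.continuous).clm_apply (ρ.U_continuous ξ)

lemma integrable_integrand (ξ : ρ.H) :
    Integrable fun t => ρ.π (f t) ((ρ.U t : ρ.H →L[ℂ] ρ.H) ξ) :=
  (continuous_integrand ρ f ξ).integrable_of_hasCompactSupport
    (.intro f.hasCompactSupport fun t ht => by simp [image_eq_zero_of_notMem_tsupport ht])

lemma norm_integrand_le (ξ : ρ.H) (t : ℝ) :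
    ‖ρ.π (f t) ((ρ.U t : ρ.H →L[ℂ] ρ.H) ξ)‖ ≤ ‖f t‖ * ‖ξ‖ := by
  refine (ContinuousLinearMap.le_opNorm _ _).trans ?_
  gcongr
  · exact NonUnitalStarAlgHom.norm_apply_le ρ.π (f t)
  · exact (ContinuousLinearMap.norm_map_of_mem_unitary (ρ.U t).2 ξ).le

/-- The integrated form of a covariant representation. -/
def intOp : ρ.H →L[ℂ] ρ.H :=
  LinearMap.mkContinuous
    { toFun := fun ξ => ∫ t, ρ.π (f t) ((ρ.U t : ρ.H →L[ℂ] ρ.H) ξ)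
      map_add' := fun ξ η => by
        simp only [map_add]
        exact integral_add (integrable_integrand ρ f ξ) (integrable_integrand ρ f η)
      map_smul' := fun c ξ => by
        simp only [map_smul, RingHom.id_apply]
        exact integral_smul c _ }
    (∫ t, ‖f t‖) fun ξ => by
      refine (norm_integral_le_integral_norm _).trans ?_
      rw [← integral_mul_const]
      refine integral_mono (integrable_integrand ρ f ξ).norm ?_ (norm_integrand_le ρ f ξ)
      exact (f.continuous.integrable_of_hasCompactSupport f.hasCompactSupport).norm.mul_const _

lemma intOp_apply (ξ : ρ.H) : intOp ρ f ξ = ∫ t, ρ.π (f t) ((ρ.U t : ρ.H →L[ℂ] ρ.H) ξ) := rfl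

lemma norm_intOp_le : ‖intOp ρ f‖ ≤ ∫ t, ‖f t‖ :=
  LinearMap.mkContinuous_norm_le _ (integral_nonneg fun _ => norm_nonneg _) _

lemma intOp_sub (f' : C_c(ℝ, C₀(Y, ℂ))) : intOp ρ (f - f') = intOp ρ f - intOp ρ f' := by
  ext ξ
  rw [sub_apply, intOp_apply, intOp_apply, intOp_apply,
    ← integral_sub (integrable_integrand ρ f ξ) (integrable_integrand ρ f' ξ)]
  simp

end CovariantForm

/-! ### The integrated form of the covariant representation of a representation -/

variable [TopologicalSpace.MetrizableSpace Y] [LocallyCompactSpace Y]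

open CovariantForm

/-- On a vector `L g η` the integrand is `L` applied to a family of functions whose integral over
`t` is the convolution of `F` and `g`. So the integral equals `L F (L g η)`. -/
lemma IsFlowRep.intOp_covariantRep (hL : IsFlowRep α L) {f : C_c(ℝ, C₀(Y, ℂ))}
    {F : C_c(Y × ℝ, ℂ)} (hF : ∀ y t, F (y, t) = f t y) (v : ess fun g => L g) :
    intOp hL.covariantRep f v = ⟨L F v, apply_mem_ess F v.1⟩ := by
  let T : (ess fun g => L g) →L[ℂ] (ess fun g => L g) :=
    ((L F).comp (ess fun g => L g).subtypeL).codRestrict (ess fun g => L g)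
      fun v => apply_mem_ess F v.1
  suffices intOp hL.covariantRep f = T by rw [this]; rfl
  refine operator_ext fun g η => ?_
  let G (t : ℝ) : C_c(Y × ℝ, ℂ) := mulBase (f t : C(Y, ℂ)) (shiftC α t g)
  have hGF : ∀ t x, G t x = F (x.1, t) * g (α (-t) x.1, x.2 - t) := fun t x => by
    rw [hF, sub_eq_neg_add]
    rfl
  let v : hL.covariantRep.H := (⟨L g η, apply_mem_ess g η⟩ : ess fun g => L g)
  have hint : ∀ t, (hL.covariantRep.π (f t))
      ((hL.covariantRep.U t : hL.covariantRep.H →L[ℂ] hL.covariantRep.H) v) =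
      (⟨L (G t) η, apply_mem_ess (G t) η⟩ : ess fun g => L g) := fun t => by
    change multOp (fun g => L g) (mulBase (f t : C(Y, ℂ)))
      (multOp (fun g => L g) (shiftC α t) ⟨L g η, apply_mem_ess g η⟩) = _
    rw [multOp_apply (hL.isBdd_shiftC t), multOp_apply (hL.isBdd_mulBase _)]
  change intOp hL.covariantRep f v = _
  rw [intOp_apply]
  simp_rw [hint]
  refine Subtype.ext ?_
  have hi := integrable_integrand hL.covariantRep f v
  simp_rw [hint] at hi
  refine ((ess fun g => L g).subtypeL.integral_comp_comm hi).symm.trans ?_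
  change ∫ t, L (G t) η = L F (L g η)
  have hc := continuous_flowConv_integrand (α := α) F.continuous g.continuous
  have hs := hasCompactSupport_flowConv_integrand (α := α) F.hasCompactSupport g.hasCompactSupport
  have h0 : ∀ t x, G t x ≠ 0 → (x, t) ∈ tsupport fun p : (Y × ℝ) × ℝ =>
      F (p.1.1, p.2) * g (α (-p.2) p.1.1, p.1.2 - p.2) := fun t x h => subset_tsupport _ (by
    rw [Function.mem_support]
    rwa [hGF] at h)
  rw [← mul_apply_eq_comp, ← hL.map_conv F g (convC α F g) rfl]
  refine (hL.integral_family (G := G) ?_ (hs.isCompact.image continuous_fst) (fun t x hx => ?_)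
    (hs.isCompact.image continuous_snd) (fun t ht => ?_) (fun x => ?_) η).symm
  · simp_rw [hGF]
    exact hc.comp continuous_swap
  · by_contra h
    exact hx ⟨_, h0 t x h, rfl⟩
  · ext x
    by_contra h
    exact ht ⟨_, h0 t x h, rfl⟩
  · simp_rw [hGF]
    rfl

end FlowFoliation

/-! ### The range of a homomorphism of `C*`-algebras is closed -/

section ClosedRange

variable {A B : Type*} [NonUnitalCStarAlgebra A] [NonUnitalCStarAlgebra B]

lemma norm_le_of_mem_quasispectrum (b : B) [IsStarNormal b] {z : ℂ} (hz : z ∈ quasispectrum ℂ b) :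
    ‖z‖ ≤ ‖b‖ := by
  have := norm_apply_le_norm_cfcₙ (fun z : ℂ => z) b hz
  rwa [cfcₙ_id' ℂ b] at this

/-- A normal element of the range of `Φ` with a normal preimage has a preimage of at most the same
norm. -/
lemma exists_norm_le_of_isStarNormal (Φ : A →⋆ₙₐ[ℂ] B) (a : A) [IsStarNormal a] :
    ∃ a', Φ a' = Φ a ∧ ‖a'‖ ≤ ‖Φ a‖ := by
  rcases eq_or_ne (Φ a) 0 with h0 | h0
  · exact ⟨0, by rw [map_zero, h0], by simp⟩
  have hr : 0 < ‖Φ a‖ := norm_pos_iff.2 h0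
  set r := ‖Φ a‖ with hrdef
  have hm : ∀ z : ℂ, 0 < max r ‖z‖ := fun z => hr.trans_le (le_max_left _ _)
  -- The radial retraction onto the disc of radius `r`. It is the identity on the quasispectrum of
  -- `Φ a`, so applying it to `a` does not change the image but brings the norm down to `r`.
  let f : ℂ → ℂ := fun z => ((r / max r ‖z‖ : ℝ) : ℂ) * z
  have hf : Continuous f := by
    refine (Complex.continuous_ofReal.comp ?_).mul continuous_id
    exact continuous_const.div (by fun_prop) fun z => (hm z).ne'
  have hn : IsStarNormal (Φ a) := ⟨by
    rw [← map_star]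
    exact (star_comm_self (x := a)).map Φ⟩
  have hΦ : Continuous Φ := AddMonoidHomClass.continuous_of_bound Φ 1 fun a => by
    rw [one_mul]
    exact NonUnitalStarAlgHom.norm_apply_le Φ a
  refine ⟨cfcₙ f a, ?_, norm_cfcₙ_le fun z _ => ?_⟩
  · rw [NonUnitalStarAlgHom.map_cfcₙ Φ f a hf.continuousOn (by simp [f]) hΦ ‹_› hn]
    refine (cfcₙ_congr fun z hz => ?_).trans (cfcₙ_id' ℂ (Φ a))
    have : max r ‖z‖ = r := max_eq_left (norm_le_of_mem_quasispectrum (Φ a) hz)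
    simp [f, this, hr.ne']
  · simp only [f, norm_mul, Complex.norm_real]
    rw [Real.norm_of_nonneg (div_nonneg hr.le (hm z).le), div_mul_eq_mul_div, div_le_iff₀ (hm z)]
    gcongr
    exact le_max_right _ _

/-- The normal case is applied to the real and imaginary parts. The value of the constant is
immaterial; only its uniformity is used. -/
lemma exists_norm_le (Φ : A →⋆ₙₐ[ℂ] B) (a : A) : ∃ a', Φ a' = Φ a ∧ ‖a'‖ ≤ 2 * ‖Φ a‖ := by
  have h1 : IsStarNormal (realPart a : A) := (realPart a).2.isStarNormal
  have h2 : IsStarNormal (imaginaryPart a : A) := (imaginaryPart a).2.isStarNormal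
  obtain ⟨x, hx, hx'⟩ := exists_norm_le_of_isStarNormal Φ (realPart a : A)
  obtain ⟨y, hy, hy'⟩ := exists_norm_le_of_isStarNormal Φ (imaginaryPart a : A)
  refine ⟨x + Complex.I • y, ?_, ?_⟩
  · rw [map_add, map_smul, hx, hy, ← map_smul, ← map_add, realPart_add_I_smul_imaginaryPart]
  · have hs : ∀ z : A, Φ ((2⁻¹ : ℝ) • z) = (2⁻¹ : ℝ) • Φ z := fun z => by
      rw [RCLike.real_smul_eq_coe_smul (K := ℂ), RCLike.real_smul_eq_coe_smul (K := ℂ), map_smul]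
    have e1 : Φ (realPart a : A) = realPart (Φ a) := by
      simp only [realPart_apply_coe, hs, map_add, map_star]
    have e2 : Φ (imaginaryPart a : A) = imaginaryPart (Φ a) := by
      simp only [imaginaryPart_apply_coe, hs, map_sub, map_smul, map_star]
    rw [e1] at hx'
    rw [e2] at hy'
    calc ‖x + Complex.I • y‖ ≤ ‖x‖ + ‖y‖ := by
          refine (norm_add_le _ _).trans ?_
          rw [norm_smul, Complex.norm_I, one_mul]
      _ ≤ ‖Φ a‖ + ‖Φ a‖ := add_le_add (hx'.trans (realPart.norm_le (Φ a)))
          (hy'.trans (imaginaryPart.norm_le (Φ a)))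
      _ = 2 * ‖Φ a‖ := by ring

/-- Uniformly bounded preimages and completeness of the domain allow limits of images to be lifted.
-/
lemma isClosed_range_starAlgHom (Φ : A →⋆ₙₐ[ℂ] B) : IsClosed (range Φ) := by
  let f : NormedAddGroupHom A B := (Φ : A →+ B).mkNormedAddGroupHom 1 fun a => by
    rw [one_mul]
    exact NonUnitalStarAlgHom.norm_apply_le Φ a
  have h : f.SurjectiveOnWith f.range 2 := by
    rintro _ ⟨a, rfl⟩
    obtain ⟨a', h1, h2⟩ := exists_norm_le Φ a
    exact ⟨a', h1, h2⟩
  have h' := controlled_closure_of_complete two_pos one_pos h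
  refine isClosed_of_closure_subset fun b hb => ?_
  obtain ⟨a, ha, -⟩ := h' b hb
  exact ⟨a, ha⟩

lemma exists_surjective_of_subset_closure (Φ : A →⋆ₙₐ[ℂ] B) (S : NonUnitalStarSubalgebra ℂ A)
    (T : NonUnitalStarSubalgebra ℂ B) (hS : IsClosed (S : Set A)) (hST : ∀ a ∈ S, Φ a ∈ T)
    (hT : (T : Set B) ⊆ closure (Φ '' S)) : ∃ q : S →⋆ₙₐ[ℂ] T, Function.Surjective q := by
  let Φ' : S →⋆ₙₐ[ℂ] B := Φ.comp (NonUnitalStarSubalgebraClass.subtype S)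
  refine ⟨NonUnitalStarAlgHom.codRestrict Φ' T fun a => hST a a.2, fun b => ?_⟩
  have h1 : Φ '' S = range Φ' := by
    rw [image_eq_range]
    rfl
  have hb := hT b.2
  rw [h1, (isClosed_range_starAlgHom Φ').closure_eq] at hb
  obtain ⟨a, ha⟩ := hb
  exact ⟨a, Subtype.ext ha⟩

lemma closure_adjoin_subset_closure_image (Φ : A →⋆ₙₐ[ℂ] B) (S : NonUnitalStarSubalgebra ℂ A)
    {E : Set B} (hE : E ⊆ Φ '' S) :
    ((NonUnitalStarAlgebra.adjoin ℂ E).topologicalClosure : Set B) ⊆ closure (Φ '' S) := by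
  refine closure_mono ?_
  exact NonUnitalStarAlgebra.adjoin_le (S := S.map Φ) hE

end ClosedRange

/-! ### Maps between products of operator algebras -/

section Lp

open scoped ENNReal

variable {ι κ : Type*} {A : ι → Type*} {B : κ → Type*} [∀ i, NonUnitalCStarAlgebra (A i)]
  [∀ k, NonUnitalCStarAlgebra (B k)]

/-- The homomorphism of `ℓ^∞`-products given by homomorphisms from the factors `A (σ k)`
to `B k`. -/
def lpComap (σ : κ → ι) (φ : ∀ k, A (σ k) →⋆ₙₐ[ℂ] B k) : lp A ∞ →⋆ₙₐ[ℂ] lp B ∞ where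
  toFun a := ⟨fun k => φ k (a (σ k)), memℓp_infty ⟨‖a‖, by
    rintro _ ⟨k, rfl⟩
    exact (NonUnitalStarAlgHom.norm_apply_le (φ k) _).trans (lp.norm_apply_le_norm (by simp) a _)⟩⟩
  map_smul' c a := lp.ext (funext fun k => map_smul (φ k) c _)
  map_zero' := lp.ext (funext fun k => map_zero (φ k))
  map_add' a b := lp.ext (funext fun k => map_add (φ k) _ _)
  map_mul' a b := lp.ext (funext fun k => map_mul (φ k) _ _)
  map_star' a := lp.ext (funext fun k => map_star (φ k) _)

end Lp

section Compress

variable {H : Type*} [NormedAddCommGroup H] [InnerProductSpace ℂ H] [CompleteSpace H]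

open ContinuousLinearMap

/-- Operators on a closed subspace, extended by zero on the orthogonal complement. -/
def extendByZero (V : Submodule ℂ H) [CompleteSpace V] : (V →L[ℂ] V) →⋆ₙₐ[ℂ] (H →L[ℂ] H) where
  toFun T := V.subtypeL ∘L T ∘L adjoint V.subtypeL
  map_smul' c T := by ext; simp
  map_zero' := by ext; simp
  map_add' S T := by ext; simp
  map_mul' S T := by
    -- The adjoint of the inclusion is the orthogonal projection; being a left inverse of the
    -- inclusion, it makes the extension multiplicative.
    have h : ∀ v : V, adjoint V.subtypeL (v : H) = v := fun v =>
      ext_inner_right ℂ fun w => by rw [adjoint_inner_left]; rfl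
    ext ξ
    simp [h]
  map_star' T := by
    simp only [star_eq_adjoint, adjoint_comp, adjoint_adjoint]
    rfl

/-- If the range of `T*` lies in `V`, then `T` vanishes on the orthogonal complement, so projecting
to `V` first changes nothing. -/
lemma apply_adjoint_subtypeL (V : Submodule ℂ H) [CompleteSpace V] {T : H →L[ℂ] H}
    (hT : ∀ η, star T η ∈ V) (ξ : H) : T (adjoint V.subtypeL ξ : V) = T ξ := by
  refine ext_inner_right ℂ fun η => ?_
  rw [← adjoint_inner_right, ← adjoint_inner_right]
  exact adjoint_inner_left V.subtypeL ⟨_, hT η⟩ ξ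

end Compress

/-! ### Approximation of families in `C₀(Y)` by functions on `Y × ℝ` -/

section ZeroAtInfty

open scoped ZeroAtInfty CompactlySupported

variable {Y : Type*} [TopologicalSpace Y]

/-- The range of `f` is compact in `C₀(Y)`, and a compact set good for one function up to `ε / 2` is
good up to `ε` on a ball around it. -/
lemma exists_compact_norm_lt (f : C_c(ℝ, C₀(Y, ℂ))) {ε : ℝ} (hε : 0 < ε) :
    ∃ K : Set Y, IsCompact K ∧ ∀ t, ∀ y ∉ K, ‖f t y‖ < ε := by
  have hc : IsCompact (range f) := f.hasCompactSupport.isCompact_range f.continuous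
  have := hc.induction_on
    (p := fun S : Set C₀(Y, ℂ) => ∃ K : Set Y, IsCompact K ∧ ∀ φ ∈ S, ∀ y ∉ K, ‖φ y‖ < ε)
    ⟨∅, isCompact_empty, by simp⟩
    (fun S T hST ⟨K, hK, h⟩ => ⟨K, hK, fun φ hφ => h φ (hST hφ)⟩)
    (fun S T ⟨K, hK, h⟩ ⟨K', hK', h'⟩ => ⟨K ∪ K', hK.union hK', fun φ hφ y hy => by
      rw [mem_union, not_or] at hy
      exact hφ.elim (fun hφ => h φ hφ y hy.1) fun hφ => h' φ hφ y hy.2⟩)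
    fun φ _ => by
      have h0 := φ.zero_at_infty'.norm.eventually_lt_const (u := ε / 2) (by simpa using hε)
      obtain ⟨K, hK, hφ⟩ := mem_cocompact.1 h0
      refine ⟨_, mem_nhdsWithin_of_mem_nhds (Metric.ball_mem_nhds φ (half_pos hε)), K, hK,
        fun ψ hψ y hy => ?_⟩
      have h1 : ‖φ y‖ < ε / 2 := hφ hy
      have h2 : ‖(ψ - φ) y‖ ≤ ‖ψ - φ‖ := (ψ - φ).toBCF.norm_coe_le_norm y
      rw [mem_ball_iff_norm] at hψ
      have h3 : ψ y = (ψ - φ) y + φ y := by simp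
      rw [h3]
      linarith [norm_add_le ((ψ - φ) y) (φ y)]
  obtain ⟨K, hK, h⟩ := this
  exact ⟨K, hK, fun t => h _ ⟨t, rfl⟩⟩

lemma norm_le_of_forall {φ : C₀(Y, ℂ)} {C : ℝ} (hC : 0 ≤ C) (h : ∀ y, ‖φ y‖ ≤ C) : ‖φ‖ ≤ C := by
  rw [← ZeroAtInftyContinuousMap.norm_toBCF_eq_norm]
  exact (BoundedContinuousFunction.norm_le hC).2 h

/-- Compactly supported families of functions on `Y` are approximated by those given by compactly
supported functions on `Y × ℝ`. -/
lemma exists_approx [T2Space Y] [LocallyCompactSpace Y] (f : C_c(ℝ, C₀(Y, ℂ))) {ε : ℝ}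
    (hε : 0 < ε) : ∃ (f' : C_c(ℝ, C₀(Y, ℂ))) (F : C_c(Y × ℝ, ℂ)), (∀ y t, F (y, t) = f' t y) ∧
      (∀ t, ‖f t - f' t‖ ≤ ε) ∧ ∀ t ∉ tsupport f, f t - f' t = 0 := by
  obtain ⟨K, hK, hf⟩ := exists_compact_norm_lt f hε
  -- Multiplication by a cutoff that is `1` on `K` alters `f` only where it is already small, and
  -- never enlarges the time support.
  obtain ⟨χ, h1, -, h3, h4⟩ := exists_continuous_one_zero_of_isCompact hK isClosed_empty
    (disjoint_empty K)
  let χ' : C_c(Y, ℂ) := ⟨⟨fun y => χ y, by fun_prop⟩, h3.comp_left (g := Complex.ofReal) rfl⟩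
  let f' : C_c(ℝ, C₀(Y, ℂ)) := ⟨⟨fun t => (χ' : C₀(Y, ℂ)) * f t, by fun_prop⟩,
    f.hasCompactSupport.mul_left⟩
  have hf' : ∀ t y, f' t y = χ y * f t y := fun t y => rfl
  have hev : Continuous fun p : Y × ℝ => f p.2 p.1 := by
    have h5 : Continuous fun t => (f t).toBCF :=
      (ZeroAtInftyContinuousMap.isometry_toBCF).continuous.comp f.continuous
    exact (h5.comp continuous_snd).eval continuous_fst
  refine ⟨f', ⟨⟨fun p => χ p.1 * f p.2 p.1, (by fun_prop : Continuous fun p : Y × ℝ => (χ p.1 : ℂ)).mul hev⟩, ?_⟩, fun y t => rfl, fun t => ?_,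
    fun t ht => ?_⟩
  · refine .intro (h3.isCompact.prod f.hasCompactSupport.isCompact) fun p hp => ?_
    by_contra h0
    obtain ⟨h5, h6⟩ := mul_ne_zero_iff.1 h0
    refine hp ⟨subset_tsupport _ fun h => h5 (by simp [h]), subset_tsupport _ fun h => h6 ?_⟩
    simp [h]
  · refine norm_le_of_forall hε.le fun y => ?_
    change ‖f t y - χ y * f t y‖ ≤ ε
    by_cases hy : y ∈ K
    · rw [h1 hy]
      simpa using hε.le
    · rw [show f t y - χ y * f t y = ((1 - χ y : ℝ) : ℂ) * f t y by push_cast; ring, norm_mul,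
        Complex.norm_real, Real.norm_of_nonneg (by linarith [(h4 y).2])]
      refine (mul_le_of_le_one_left (norm_nonneg _) ?_).trans (hf t y hy).le
      linarith [(h4 y).1]
  · have : f t = 0 := image_eq_zero_of_notMem_tsupport ht
    change f t - (χ' : C₀(Y, ℂ)) * f t = 0
    rw [this, mul_zero, sub_zero]

/-- The family of functions on `Y` given by a compactly supported function on `Y × ℝ`. -/
lemma exists_curry [T2Space Y] (F : C_c(Y × ℝ, ℂ)) :
    ∃ f : C_c(ℝ, C₀(Y, ℂ)), ∀ y t, F (y, t) = f t y := by
  have hK := F.hasCompactSupport.isCompact.image continuous_fst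
  have h0 : ∀ t, ∀ y ∉ Prod.fst '' tsupport F, F (y, t) = 0 := fun t y hy => by
    by_contra h
    exact hy ⟨(y, t), subset_tsupport _ h, rfl⟩
  let s (t : ℝ) : C_c(Y, ℂ) := ⟨⟨fun y => F (y, t), by fun_prop⟩, .intro hK (h0 t)⟩
  refine ⟨⟨⟨fun t => (s t : C₀(Y, ℂ)), ?_⟩, ?_⟩, fun y t => rfl⟩
  · rw [continuous_iff_continuousAt]
    intro t
    rw [ContinuousAt, tendsto_iff_norm_sub_tendsto_zero, Metric.tendsto_nhds]
    intro ε hε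
    have h1 : ∀ᶠ r in 𝓝 t, ∀ y ∈ Prod.fst '' tsupport F, ‖F (y, r) - F (y, t)‖ < ε / 2 := by
      refine hK.eventually_forall_of_forall_eventually fun y _ => ?_
      have hc : Continuous fun z : ℝ × Y => ‖F (z.2, z.1) - F (z.2, t)‖ := by fun_prop
      exact (hc.tendsto (t, y)).eventually_lt_const (by simpa using hε)
    filter_upwards [h1] with r hr
    rw [dist_zero_right, norm_norm]
    refine (norm_le_of_forall (half_pos hε).le fun y => ?_).trans_lt (half_lt_self hε)
    change ‖F (y, r) - F (y, t)‖ ≤ ε / 2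
    by_cases hy : y ∈ Prod.fst '' tsupport F
    · exact (hr y hy).le
    · rw [h0 r y hy, h0 t y hy, sub_zero, norm_zero]
      exact (half_pos hε).le
  · refine .intro (F.hasCompactSupport.isCompact.image continuous_snd) fun t ht => ?_
    ext y
    by_contra h
    exact ht ⟨(y, t), subset_tsupport _ h, rfl⟩

end ZeroAtInfty

/-! ### The surjection from the crossed product -/

namespace FlowFoliation

open LineFoliation EssentialSpace CovariantForm
open scoped CompactlySupported ZeroAtInfty ENNReal

variable {Y : Type u} [TopologicalSpace Y] {α : Flow ℝ Y}

/-- The element of the product of all covariant representations given by the integrated forms. -/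
def intForm (f : C_c(ℝ, C₀(Y, ℂ))) : lp (fun ρ : CovariantRep α => ρ.H →L[ℂ] ρ.H) ∞ :=
  ⟨fun ρ => intOp ρ f, memℓp_infty ⟨∫ t, ‖f t‖, by
    rintro _ ⟨ρ, rfl⟩
    exact norm_intOp_le ρ f⟩⟩

lemma intForm_mem (f : C_c(ℝ, C₀(Y, ℂ))) : intForm f ∈ crossedProduct α :=
  NonUnitalStarSubalgebra.le_topologicalClosure _ <| NonUnitalStarAlgebra.subset_adjoin ℂ _
    ⟨f, f.continuous, f.hasCompactSupport, fun _ _ => rfl⟩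

lemma norm_intForm_sub_le {f f' : C_c(ℝ, C₀(Y, ℂ))} {ε : ℝ} (hε : 0 ≤ ε)
    (h : ∀ t, ‖f t - f' t‖ ≤ ε) (h0 : ∀ t ∉ tsupport f, f t - f' t = 0) :
    ‖(intForm f : lp (fun ρ : CovariantRep α => ρ.H →L[ℂ] ρ.H) ∞) - intForm f'‖ ≤
      ε * volume.real (tsupport f) := by
  refine lp.norm_le_of_forall_le (by positivity) fun ρ => ?_
  change ‖intOp ρ f - intOp ρ f'‖ ≤ _
  rw [← intOp_sub]
  refine (norm_intOp_le ρ _).trans ?_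
  have hm : MeasurableSet (tsupport f) := (isClosed_tsupport f).measurableSet
  have hfin : volume (tsupport f) ≠ ⊤ := f.hasCompactSupport.isCompact.measure_ne_top
  calc ∫ t, ‖(f - f') t‖ ≤ ∫ t, (tsupport f).indicator (fun _ => ε) t := by
        refine integral_mono ((f - f').continuous.integrable_of_hasCompactSupport
          (f - f').hasCompactSupport).norm ((integrable_indicator_iff hm).2
            (integrableOn_const hfin)) fun t => ?_
        by_cases ht : t ∈ tsupport f
        · simpa [ht] using h t
        · simp [ht, h0 t ht]
    _ = ε * volume.real (tsupport f) := by
        rw [integral_indicator_const _ hm, smul_eq_mul, mul_comm]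

variable [TopologicalSpace.MetrizableSpace Y] [LocallyCompactSpace Y]
variable {hα : ∀ y, ∃ t, α t y ≠ y}
variable {lam : (flowFoliation α hα).holonomyGroupoid.FiberMeasures}

variable (hα) in
/-- The pushforward along the canonical map, as a linear map. -/
def pushforwardCc : C_c(Y × ℝ, ℂ) →ₗ[ℂ] Cc (flowFoliation α hα).Holonomy where
  toFun g := ⟨pushforward hα g, pushforward_mem g.continuous g.hasCompactSupport⟩
  map_add' g h := Subtype.ext (pushforward_add g.hasCompactSupport h.hasCompactSupport)
  map_smul' c g := Subtype.ext (pushforward_smul g.hasCompactSupport c)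

/-- The pushforward is a `*`-homomorphism for convolution, and its `I`-norm estimate gives the
bound. -/
lemma isFlowRep_pullback (hI : IntertwinesLebesgue lam) (ρ : GroupoidStr.Rep lam) :
    IsFlowRep α (ρ.toLin ∘ₗ pushforwardCc hα) where
  map_conv f g h hh := by
    refine ρ.map_conv _ _ _ ?_
    change pushforward hα h = GroupoidStr.conv lam (pushforward hα f) (pushforward hα g)
    rw [hh]
    exact (conv_pushforward hI f.continuous f.hasCompactSupport g.continuous
      g.hasCompactSupport).symm
  map_star f := ρ.map_star _ _ fun a => pushforward_flowStar a
  bound f M R hM hR h1 h2 := by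
    have := (ρ.bounded (pushforwardCc hα f)).trans
      (iNorm_pushforward_le hI f.continuous f.hasCompactSupport h1 h2)
    rw [← ofReal_norm, ENNReal.ofReal_le_ofReal_iff (by positivity)] at this
    exact this

/-- Each representation of the holonomy groupoid, cut down to its essential space, comes from a
covariant representation of the flow; this gives a homomorphism between the products of all
representations. -/
def toRepProduct (hI : IntertwinesLebesgue lam) :
    lp (fun ρ : CovariantRep α => ρ.H →L[ℂ] ρ.H) ∞ →⋆ₙₐ[ℂ]
      lp (fun ρ : GroupoidStr.Rep lam => ρ.H →L[ℂ] ρ.H) ∞ :=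
  lpComap (fun ρ : GroupoidStr.Rep lam => (isFlowRep_pullback hI ρ).covariantRep)
    fun ρ => extendByZero (ess fun g => (ρ.toLin ∘ₗ pushforwardCc hα) g)

/-- The integrated form is the restriction of the represented operator to the essential space. The
adjoint of that operator represents `starC α F`, so its range is essential too, and extension by
zero recovers the operator on the whole space. -/
lemma toRepProduct_intForm (hI : IntertwinesLebesgue lam) {f : C_c(ℝ, C₀(Y, ℂ))}
    {F : C_c(Y × ℝ, ℂ)} (hF : ∀ y t, F (y, t) = f t y) (ρ : GroupoidStr.Rep lam) :
    toRepProduct hI (intForm f) ρ = ρ.toLin (pushforwardCc hα F) := by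
  have hL := isFlowRep_pullback hI ρ
  ext ξ
  have h1 := hL.intOp_covariantRep hF
    (ContinuousLinearMap.adjoint (ess fun g => (ρ.toLin ∘ₗ pushforwardCc hα) g).subtypeL ξ)
  have h2 := apply_adjoint_subtypeL (ess fun g => (ρ.toLin ∘ₗ pushforwardCc hα) g)
    (T := (ρ.toLin ∘ₗ pushforwardCc hα) F) (fun η => by
      rw [← hL.map_star]
      exact apply_mem_ess (L := fun g => (ρ.toLin ∘ₗ pushforwardCc hα) g) (starC α F) η) ξ
  exact (congrArg Subtype.val h1).trans h2

/-- A general `f` need not come from a compactly supported function on `Y × ℝ`, so it is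
approximated by families that do, and `cstar` is closed. -/
lemma toRepProduct_intForm_mem (hI : IntertwinesLebesgue lam) (f : C_c(ℝ, C₀(Y, ℂ))) :
    toRepProduct hI (intForm f) ∈ GroupoidStr.cstar lam := by
  have hcl : IsClosed (GroupoidStr.cstar lam : Set (lp (fun ρ : GroupoidStr.Rep lam =>
    ρ.H →L[ℂ] ρ.H) ∞)) := NonUnitalStarSubalgebra.isClosed_topologicalClosure _
  refine hcl.closure_subset (Metric.mem_closure_iff.2 fun ε hε => ?_)
  set V := volume.real (tsupport f)
  have hV : 0 ≤ V := measureReal_nonneg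
  -- The error in norm is at most `ε / (V + 1) * V < ε`; the summand `1` covers the case `V = 0`.
  obtain ⟨f', F, hF, h1, h2⟩ := exists_approx f (ε := ε / (V + 1)) (by positivity)
  refine ⟨toRepProduct hI (intForm f'), ?_, ?_⟩
  · exact NonUnitalStarSubalgebra.le_topologicalClosure _ <|
      NonUnitalStarAlgebra.subset_adjoin ℂ _ ⟨pushforwardCc hα F, toRepProduct_intForm hI hF⟩
  · rw [dist_eq_norm, ← map_sub]
    refine (NonUnitalStarAlgHom.norm_apply_le (toRepProduct hI) _).trans_lt ?_
    refine (norm_intForm_sub_le (by positivity) h1 h2).trans_lt ?_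
    rw [div_mul_eq_mul_div, div_lt_iff₀ (by positivity)]
    nlinarith

lemma toRepProduct_mem (hI : IntertwinesLebesgue lam)
    {a : lp (fun ρ : CovariantRep α => ρ.H →L[ℂ] ρ.H) ∞} (ha : a ∈ crossedProduct α) :
    toRepProduct hI a ∈ GroupoidStr.cstar lam := by
  have hcl : IsClosed (GroupoidStr.cstar lam : Set (lp (fun ρ : GroupoidStr.Rep lam =>
    ρ.H →L[ℂ] ρ.H) ∞)) := NonUnitalStarSubalgebra.isClosed_topologicalClosure _
  have hc : Continuous (toRepProduct hI) :=
    AddMonoidHomClass.continuous_of_bound (toRepProduct hI) 1 fun a => by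
      rw [one_mul]
      exact NonUnitalStarAlgHom.norm_apply_le (toRepProduct hI) a
  have h : crossedProduct α ≤ (GroupoidStr.cstar lam).comap (toRepProduct hI) := by
    refine NonUnitalStarSubalgebra.topologicalClosure_minimal _
      (NonUnitalStarAlgebra.adjoin_le ?_) (hcl.preimage hc)
    rintro b ⟨f, h1, h2, h3⟩
    have : b = intForm ⟨⟨f, h1⟩, h2⟩ := lp.ext (funext fun ρ => by
      ext ξ
      exact h3 ρ ξ)
    rw [this]
    exact toRepProduct_intForm_mem hI _
  exact h ha

/-- Every function in `C_c` of the holonomy groupoid is a pushforward, so all generators of `cstar`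
are images of integrated forms; closedness of the range does the rest. -/
lemma exists_surjective_starAlgHom (hI : IntertwinesLebesgue lam) :
    ∃ q : crossedProduct α →⋆ₙₐ[ℂ] GroupoidStr.cstar lam, Function.Surjective q := by
  have hcl : IsClosed (crossedProduct α : Set (lp (fun ρ : CovariantRep α => ρ.H →L[ℂ] ρ.H) ∞)) :=
    NonUnitalStarSubalgebra.isClosed_topologicalClosure _
  refine exists_surjective_of_subset_closure (toRepProduct hI) (crossedProduct α)
    (GroupoidStr.cstar lam) hcl (fun _ => toRepProduct_mem hI)
    (closure_adjoin_subset_closure_image (toRepProduct hI) (crossedProduct α) ?_)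
  rintro b ⟨k, hk⟩
  obtain ⟨g, hg, hg', hgk⟩ := exists_pushforward_eq k.2
  obtain ⟨f, hf⟩ := exists_curry (⟨⟨g, hg⟩, hg'⟩ : C_c(Y × ℝ, ℂ))
  refine ⟨intForm f, intForm_mem f, lp.ext (funext fun ρ => ?_)⟩
  refine (toRepProduct_intForm hI hf ρ).trans ((hk ρ).trans (congrArg _ ?_)).symm
  exact (Subtype.ext hgk).symm

end FlowFoliation

end

theorem mainTheorem8 {Y : Type u} [TopologicalSpace Y] [LocallyCompactSpace Y]
    [TopologicalSpace.MetrizableSpace Y] (α : Flow ℝ Y) (hα : ∀ y, ∃ t, α t y ≠ y) :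
    ∃ F : LineFoliation Y, F.IsInducedBy α ∧
      F.holonomyGroupoid.IsLocallyCompact ∧
      (SecondCountableTopology Y → GroupoidStr.HasCountableBasis F.Holonomy) ∧
      GroupoidStr.IsHaarSystem (lebesgueSystem α) ∧
      ∃ π : Y × ℝ → F.Holonomy, IsCanonicalMap α F π ∧
        ∃ hπ : IsFiberwiseCovering (transformationGroupoid α) F.holonomyGroupoid π,
          (∃ lam : F.holonomyGroupoid.FiberMeasures,
            GroupoidStr.IsHaarSystem lam ∧ hπ.Intertwines (lebesgueSystem α) lam) ∧
          ∀ lam : F.holonomyGroupoid.FiberMeasures,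
            GroupoidStr.IsHaarSystem lam → hπ.Intertwines (lebesgueSystem α) lam →
            ∃ q : crossedProduct α →⋆ₙₐ[ℂ] GroupoidStr.cstar lam, Function.Surjective q := by
  have hI := FlowFoliation.intertwines_holonomyHaar (hα := hα)
  exact ⟨FlowFoliation.flowFoliation α hα, rfl, FlowFoliation.isLocallyCompact_holonomyGroupoid,
    fun _ => FlowFoliation.hasCountableBasis_holonomy, FlowFoliation.isHaarSystem_lebesgueSystem,
    FlowFoliation.canonicalMap hα, FlowFoliation.isCanonicalMap,
    FlowFoliation.isFiberwiseCovering_canonicalMap,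
    ⟨FlowFoliation.holonomyHaar hα, FlowFoliation.isHaarSystem_holonomyHaar, hI⟩,
    fun _ _ hlam => FlowFoliation.exists_surjective_starAlgHom hlam⟩
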